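/- Consider random access machines whose memory cells hold natural numbers. A program is a fixed finite list of instructions: load a constant; add, subtract (truncated at $0$), multiply, divide with floor, or reduce modulo; direct and indirect read and write; unconditional jump and jump on $<$; append a memory cell to a write-only output stream. The input is placed in the first memory cells and all other cells are $0$. \emph{Time} is the number of instructions executed until the program halts. The \emph{number of bits in memory} at a given moment is the sum, over all cells from address $0$ to the largest address accessed so far, of the length of the binary expansion of the content (at least $1$ per cell). A bound on \emph{space} means that it holds at every moment until the program halts. All integers stored are required to be of size $O(N)$. All implied constants are absolute, and the bounds hold for all integers $N\ge 2$. (i) There is a program that, given $N$, outputs all primes $p\le N$, in increasing order, in space $O(N^{1/3}(\log N)^{2/3})$ and time $O(N\log N)$. (ii) There is a program that, given $N$, outputs for every $1\le n\le N$, in increasing order of $n$, the complete list of the pairs $(p,v_p(n))$ with $p$ prime, $p\mid n$ (where $v_p(n)$ is the exponent of $p$ in $n$; the pairs for a given $n$ come in some order, each once), in space $O(N^{1/3}(\log N)^{5/3})$ and time $O(N\log N)$. In (i) and (ii) space is the number of bits in memory; the output, which is written only once and never read, is not counted. (iii) There is a program that, given integers $N$ and $\Delta$ with $N^{1/3}(\log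 N)^{2/3}\le\Delta\le N$, finds all primes in $[N-\Delta,N+\Delta]$, that is, it outputs for each integer $n$ in the interval, in increasing order, a bit telling whether $n$ is prime, in space $O(\Delta)$ and time $O(\Delta\log N)$. (iv) There is a program that, given such $N$ and $\Delta$, outputs for every positive integer $n\in[N-\Delta,N+\Delta]$, in increasing order, the complete list of the pairs $(p,v_p(n))$ with $p$ prime, $p\mid n$ (as in (ii)), in space $O(\Delta\log N)$ and time $O(\Delta\log N)$. In (iii) and (iv) space is the number of bits in memory plus the number of bits of the output. -/

import Mathlib

/-!
A random access machine with unit-cost arithmetic on words, used to measure time (number of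
executed instructions) and space (number of bits held in memory).
-/

namespace SieveRAM

/-- The unit-cost arithmetic operations (on natural numbers; subtraction is truncated at `0`,
division is rounded down). -/
inductive ArithOp where
  | add
  | sub
  | mul
  | div
  | mod

/-- The value of an arithmetic operation. -/
def ArithOp.eval : ArithOp → ℕ → ℕ → ℕ
  | .add, x, y => x + y
  | .sub, x, y => x - y
  | .mul, x, y => x * y
  | .div, x, y => x / y
  | .mod, x, y => x % y

/-- The instructions. `M` denotes the memory; `d`, `a`, `b` are fixed addresses and `l` is a
fixed position in the program. -/
inductive Instr where
  /-- `M[d] := v` for a fixed number `v` -/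
  | const (d v : ℕ)
  /-- `M[d] := M[a] op M[b]` -/
  | arith (op : ArithOp) (d a b : ℕ)
  /-- `M[d] := M[M[a]]` -/
  | load (d a : ℕ)
  /-- `M[M[a]] := M[b]` -/
  | store (a b : ℕ)
  /-- go to position `l` -/
  | jump (l : ℕ)
  /-- go to position `l` if `M[a] < M[b]` -/
  | jumpLt (a b l : ℕ)
  /-- append `M[a]` to the write-only output stream -/
  | emit (a : ℕ)

/-- One more than the largest memory address that the instruction reads or writes when the
memory is `m` (and `0` if it does not access the memory). -/
def Instr.reach (m : ℕ → ℕ) : Instr → ℕ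
  | .const d _ => d + 1
  | .arith _ d a b => max d (max a b) + 1
  | .load d a => max (max d a) (m a) + 1
  | .store a b => max (max a b) (m a) + 1
  | .jump _ => 0
  | .jumpLt a b _ => max a b + 1
  | .emit a => a + 1

/-- A program is a finite list of instructions. -/
abbrev Program := List Instr

/-- A configuration of the machine: the position in the program, the content of the memory,
the number `top` such that every address accessed so far is `< top`, and the output stream. -/
structure Config where
  pc : ℕ
  mem : ℕ → ℕ
  top : ℕ
  out : List ℕ

/-- The initial configuration: the input occupies the first memory cells, the others are `0`. -/
def start (input : List ℕ) : Config where
  pc := 0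
  mem := fun i => input.getD i 0
  top := input.length
  out := []

/-- The machine has halted when it has left the program. -/
def Config.Halted (P : Program) (c : Config) : Prop := P.length ≤ c.pc

/-- Execution of one instruction (nothing happens once the machine has halted). -/
def step (P : Program) (c : Config) : Config :=
  match P[c.pc]? with
  | none => c
  | some i =>
    let c' : Config := { c with pc := c.pc + 1, top := max c.top (i.reach c.mem) }
    match i with
    | .const d v => { c' with mem := Function.update c.mem d v }
    | .arith op d a b => { c' with mem := Function.update c.mem d (op.eval (c.mem a) (c.mem b)) }
    | .load d a => { c' with mem := Function.update c.mem d (c.mem (c.mem a)) }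
    | .store a b => { c' with mem := Function.update c.mem (c.mem a) (c.mem b) }
    | .jump l => { c' with pc := l }
    | .jumpLt a b l => { c' with pc := if c.mem a < c.mem b then l else c.pc + 1 }
    | .emit a => { c' with out := c.out ++ [c.mem a] }

/-- The configuration after `t` steps on the given input. -/
def configAt (P : Program) (input : List ℕ) (t : ℕ) : Config := (step P)^[t] (start input)

/-- The number of bits that a memory cell with content `v` takes: the length of the binary
expansion of `v`, and at least `1`. -/
def cellBits (v : ℕ) : ℕ := max 1 v.size

/-- The number of bits in the memory. All cells up to the largest address accessed so far are
counted, the ones skipped included. -/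
def Config.memBits (c : Config) : ℕ := ∑ i ∈ Finset.range c.top, cellBits (c.mem i)

/-- The number of bits in the memory and in the output together. -/
def Config.totalBits (c : Config) : ℕ := c.memBits + (c.out.map cellBits).sum

/-- On the given input the program halts after at most `T` steps with an output that satisfies
`Good`; up to then no memory cell ever holds a number larger than `W`, and the space in use, as
measured by `space`, never exceeds `S`. -/
def RunsWithin (P : Program) (input : List ℕ) (Good : List ℕ → Prop) (space : Config → ℕ)
    (T W S : ℝ) : Prop :=
  ∃ t : ℕ, (t : ℝ) ≤ T ∧
    (configAt P input t).Halted P ∧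
    Good (configAt P input t).out ∧
    ∀ s ≤ t, (∀ i, ((configAt P input s).mem i : ℝ) ≤ W) ∧
      (space (configAt P input s) : ℝ) ≤ S

/-- `L` lists, in some order and without repetition, the pairs `(p, v_p(n))` for the primes `p`
that divide `n`. -/
def IsFactorization (n : ℕ) (L : List (ℕ × ℕ)) : Prop :=
  L.Nodup ∧ ∀ p k : ℕ, (p, k) ∈ L ↔ p.Prime ∧ p ∣ n ∧ k = padicValNat p n

/-- The encoding of a number `n` together with a list `(p₁, k₁), …, (pᵣ, kᵣ)` as the sequence
`n, p₁, k₁, …, pᵣ, kᵣ, 0`. -/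
def encodeFactored (n : ℕ) (L : List (ℕ × ℕ)) : List ℕ :=
  n :: (L.flatMap fun pk => [pk.1, pk.2]) ++ [0]

/-- The output consists of the factorizations of the numbers in `ns`, one after the other. -/
def IsFactorTable (ns : List ℕ) (out : List ℕ) : Prop :=
  ∃ F : ℕ → List (ℕ × ℕ), (∀ n ∈ ns, IsFactorization n (F n)) ∧
    out = ns.flatMap fun n => encodeFactored n (F n)

/-- The output is the increasing list of all primes `p ≤ N`. -/
def IsPrimeList (N : ℕ) (out : List ℕ) : Prop :=
  out = (List.range' 1 N).filter fun n => n.Prime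

/-- The output is the sequence of `0`s and `1`s that tells, for each `n` in the list `ns`,
whether `n` is prime. -/
def IsPrimeIndicator (ns : List ℕ) (out : List ℕ) : Prop :=
  out = ns.map fun n => if n.Prime then 1 else 0

/-- The integers in `[N - Δ, N + Δ]`, in increasing order (for `Δ ≤ N`). -/
def interval (N Δ : ℕ) : List ℕ := List.range' (N - Δ) (2 * Δ + 1)

end SieveRAM

/-!
The integers are treated in segments `[A, A + L)` of length `L = K * l`, where `l` is about `log N`
and `K` is about `(N / l) ^ (1 / 3)`; so `L` is about `N ^ (1 / 3) * (log N) ^ (2 / 3)`. It suffices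
to treat a segment in time `O(L * l)`, with `O(L)` bits for the primes and `O(L * l)` bits for the
factorizations. As divisors, all integers `d` are used, not only the primes, so that no table of
primes is needed.

*Small divisors*, `d < L`, are sieved directly; the sum of `L / d` is `O(L * l)`.

*Large divisors*, `L ≤ d` and `d ^ 2 < A + L`, have at most one multiple in the segment, and most of
them have none, so those that have one must be found quickly. They are divided into windows
`[m, m + m / K)`. In a window the function `A / d` is almost linear: if `m + r` has a multiple in the
segment, then `r * k + s` is congruent modulo `m` to a number less than `5 * L`, where
`k = A / m + 1` and `s = m - A % m` (`exists_small_residue`). The Euclidean algorithm for `k` and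
`m`, stopped at the length `R = m / K` of the window, yields a good approximation of `k / m` with a
denominator `q ≤ R`, and the candidates `r` lie in `O(L * q / m + 1)` residue classes modulo `q`
(`EuclidInv.exists_class`); thus there are `O(L * R / m + R / q)` of them. The first term is summed
over the windows by comparison with a logarithm. For the second one, the windows are grouped
according to the approximating fraction `a / q`: such a window is close to the place `x` where
`A / x ^ 2 = a / q`, and `a * q` is `O(L)` (`window_facts`), so that the windows of a group cover
only a short interval (`sum_group_le`). The sum over the pairs `(a, q)` is a sum over lattice points
below a hyperbola (`sum_hyperbola_le`). The result is that the windows take the time `O(L * l)`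
altogether (`sum_window_cost_le`).

*Primes.* One bit for each number of the segment records whether a proper divisor has been found.

*Factorizations.* The cofactor that remains after the division by the small primes has no prime
factor below `L`. It is less than `L ^ 3`, so it has at most two prime factors, and a single large
divisor determines its factorization (`emitL_spec`). The lists of the small prime factors would be
too long for a whole segment, as a number can have about `log N` of them and a cell about `log N`
bits. They are therefore kept only for blocks of `K` numbers; they are computed first to obtain the
cofactors, and a second time for the output.

*The machine.* The programs are written in a structured language with a calculus of weakest
preconditions that keeps track of the elapsed time and of the bounds for addresses and for the
contents of cells (`wp`). The compilation to the machine is sound for it (`wp_sound`, `exists_run`).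
All numbers that occur are at most `1000 * N`.
-/

set_option linter.constructorNameAsVariable false

namespace SieveRAM

/-! ### A structured language over the machine -/

/-- The registers of the structured programs. The register with index `i` is the memory cell with
address `i`; the input is in `N` and `Dl`. -/
inductive Reg
  | N | Dl | zero | one | two | l | K | L | W5 | cap | A | E | hi | Bc | Bb | Bn | Bs
  | m | mm | R | k | s | q0 | q1 | q2 | d0 | d1 | go | c | t | z | ze | w | r | d | x | p | f
  | g | ge | n | y | ye | b | e | u | v
  deriving DecidableEq

/-- The number of memory cells that are set aside for registers. The cells from this address on
form the heap. -/
def base : ℕ := 64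

theorem Reg.ctorIdx_inj {a b : Reg} (h : a.ctorIdx = b.ctorIdx) : a = b := by
  rw [← Reg.ofNat_ctorIdx a, h, Reg.ofNat_ctorIdx]

theorem Reg.ctorIdx_lt (a : Reg) : a.ctorIdx < base := by
  cases a <;> decide

theorem base_eq : base = 64 := rfl

attribute [irreducible] base

/-- A state of a structured program: registers, heap (indexed by absolute addresses) and
output. -/
structure St where
  r : Reg → ℕ
  h : ℕ → ℕ
  o : List ℕ

/-- Assignment to a register. -/
def St.set (σ : St) (x : Reg) (v : ℕ) : St := { σ with r := Function.update σ.r x v }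

/-- Assignment to a heap cell. -/
def St.put (σ : St) (a v : ℕ) : St := { σ with h := Function.update σ.h a v }

/-- Extension of the output. -/
def St.emit (σ : St) (l : List ℕ) : St := { σ with o := σ.o ++ l }

@[simp] theorem St.set_r (σ : St) (x y : Reg) (v : ℕ) :
    (σ.set x v).r y = if y = x then v else σ.r y := by
  simp [St.set, Function.update_apply]

@[simp] theorem St.set_h (σ : St) (x : Reg) (v : ℕ) : (σ.set x v).h = σ.h := rfl
@[simp] theorem St.set_o (σ : St) (x : Reg) (v : ℕ) : (σ.set x v).o = σ.o := rfl
@[simp] theorem St.put_r (σ : St) (a v : ℕ) : (σ.put a v).r = σ.r := rfl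
@[simp] theorem St.put_h (σ : St) (a v : ℕ) : (σ.put a v).h = Function.update σ.h a v := rfl
@[simp] theorem St.put_o (σ : St) (a v : ℕ) : (σ.put a v).o = σ.o := rfl
@[simp] theorem St.emit_r (σ : St) (l : List ℕ) : (σ.emit l).r = σ.r := rfl
@[simp] theorem St.emit_h (σ : St) (l : List ℕ) : (σ.emit l).h = σ.h := rfl
@[simp] theorem St.emit_o (σ : St) (l : List ℕ) : (σ.emit l).o = σ.o ++ l := rfl

/-- The non-branching instructions. -/
inductive Op
  | const (d : Reg) (v : ℕ)
  | arith (op : ArithOp) (d a b : Reg)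
  | load (d a : Reg)
  | store (a b : Reg)
  | emit (a : Reg)

/-- Structured programs; the guards of `ite` and `loop` are of the form `a < b`. -/
inductive Stmt
  | skip
  | op (o : Op)
  | seq (s₁ s₂ : Stmt)
  | ite (a b : Reg) (s₁ s₂ : Stmt)
  | loop (a b : Reg) (s : Stmt)

/-- Sequential composition. -/
infixr:30 " ;; " => Stmt.seq

namespace Stmt
/-- `d := v` -/
abbrev cst (d : Reg) (v : ℕ) : Stmt := .op (.const d v)
/-- `d := a + b` -/
abbrev add (d a b : Reg) : Stmt := .op (.arith .add d a b)
/-- `d := a - b` -/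
abbrev sub (d a b : Reg) : Stmt := .op (.arith .sub d a b)
/-- `d := a * b` -/
abbrev mul (d a b : Reg) : Stmt := .op (.arith .mul d a b)
/-- `d := a / b` -/
abbrev div (d a b : Reg) : Stmt := .op (.arith .div d a b)
/-- `d := a % b` -/
abbrev mod (d a b : Reg) : Stmt := .op (.arith .mod d a b)
/-- `d := M[a]` -/
abbrev load (d a : Reg) : Stmt := .op (.load d a)
/-- `M[a] := b` -/
abbrev store (a b : Reg) : Stmt := .op (.store a b)
/-- output `a` -/
abbrev emit (a : Reg) : Stmt := .op (.emit a)
end Stmt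

/-- The resources: all addresses are `< T`, registers hold numbers `≤ W`, and heap cells hold
numbers `≤ H`. -/
structure Env where
  T : ℕ
  W : ℕ
  H : ℕ

/-- The effect of a non-branching instruction. -/
def Op.eval (σ : St) : Op → St
  | .const d v => σ.set d v
  | .arith op d a b => σ.set d (op.eval (σ.r a) (σ.r b))
  | .load d a => σ.set d (σ.h (σ.r a))
  | .store a b => σ.put (σ.r a) (σ.r b)
  | .emit a => σ.emit [σ.r a]

/-- The condition under which a non-branching instruction respects the resources. Only `add` and
`mul` can produce a number that exceeds the bound on registers. -/
def Op.safe (E : Env) (σ : St) : Op → Prop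
  | .const _ v => v ≤ E.W
  | .arith .add _ a b => σ.r a + σ.r b ≤ E.W
  | .arith .mul _ a b => σ.r a * σ.r b ≤ E.W
  | .arith _ _ _ _ => True
  | .load _ a => base ≤ σ.r a ∧ σ.r a < E.T
  | .store a b => base ≤ σ.r a ∧ σ.r a < E.T ∧ σ.r b ≤ E.H
  | .emit _ => True

/-- Postconditions: properties of the state and of the elapsed time. -/
abbrev Post := St → ℕ → Prop

/-- The weakest precondition of a loop with body transformer `B`, restricted to less than `n`
iterations. -/
def wpLoop (B : Post → Post) (a b : Reg) (Q : Post) : ℕ → Post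
  | 0 => fun _ _ => False
  | n + 1 => fun σ t =>
    if σ.r a < σ.r b then B (fun σ' t' => wpLoop B a b Q n σ' (t' + 1)) σ (t + 1)
    else Q σ (t + 2)

/-- `wp E s Q σ t`: started in the state `σ` at time `t`, the program `s` respects the resources
`E`, terminates, and `Q` holds for the final state and time. The time is the number of machine
instructions of the compiled program. -/
def wp (E : Env) : Stmt → Post → Post
  | .skip, Q => Q
  | .op i, Q => fun σ t => i.safe E σ ∧ Q (i.eval σ) (t + 1)
  | .seq s₁ s₂, Q => wp E s₁ (wp E s₂ Q)
  | .ite a b s₁ s₂, Q => fun σ t =>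
    if σ.r a < σ.r b then wp E s₁ Q σ (t + 1)
    else wp E s₂ (fun σ' t' => Q σ' (t' + 1)) σ (t + 1)
  | .loop a b s, Q => fun σ t => ∃ n, wpLoop (wp E s) a b Q n σ t

section
variable {E : Env} {Q Q' : Post} {σ : St} {t : ℕ}

theorem wpLoop_mono {B : Post → Post}
    (hB : ∀ Q Q' : Post, (∀ σ t, Q σ t → Q' σ t) → ∀ σ t, B Q σ t → B Q' σ t)
    {a b : Reg} (h : ∀ σ t, Q σ t → Q' σ t) (n : ℕ) :
    ∀ σ t, wpLoop B a b Q n σ t → wpLoop B a b Q' n σ t := by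
  induction n with
  | zero => intro σ t h; exact h
  | succ n ih =>
    intro σ t h1
    simp only [wpLoop] at h1 ⊢
    split_ifs at h1 ⊢
    · exact hB _ _ (fun σ t => ih σ (t + 1)) _ _ h1
    · exact h _ _ h1

theorem wp_mono (s : Stmt) : ∀ Q Q' : Post, (∀ σ t, Q σ t → Q' σ t) →
    ∀ σ t, wp E s Q σ t → wp E s Q' σ t := by
  induction s with
  | skip => intro Q Q' h; exact h
  | op i => intro Q Q' h σ t h1; exact ⟨h1.1, h _ _ h1.2⟩
  | seq s₁ s₂ ih₁ ih₂ => intro Q Q' h; exact ih₁ _ _ (ih₂ _ _ h)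
  | ite a b s₁ s₂ ih₁ ih₂ =>
    intro Q Q' h σ t h1
    simp only [wp] at h1 ⊢
    split_ifs at h1 ⊢
    · exact ih₁ _ _ h _ _ h1
    · exact ih₂ _ _ (fun σ t => h σ (t + 1)) _ _ h1
  | loop a b s ih =>
    intro Q Q' h σ t h1
    obtain ⟨n, hn⟩ := h1
    exact ⟨n, wpLoop_mono ih h n σ t hn⟩

theorem wp_conseq {s : Stmt} (h : wp E s Q σ t) (hQ : ∀ σ t, Q σ t → Q' σ t) : wp E s Q' σ t :=
  wp_mono s _ _ hQ _ _ h

/-- The registers that a program may change. -/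
def Stmt.wr (y : Reg) : Stmt → Bool
  | .skip => false
  | .op (.const d _) => decide (y = d)
  | .op (.arith _ d _ _) => decide (y = d)
  | .op (.load d _) => decide (y = d)
  | .op (.store _ _) => false
  | .op (.emit _) => false
  | .seq s₁ s₂ => s₁.wr y || s₂.wr y
  | .ite _ _ s₁ s₂ => s₁.wr y || s₂.wr y
  | .loop _ _ s => s.wr y

/-- Whether a program may change the heap. -/
def Stmt.stores : Stmt → Bool
  | .op (.store _ _) => true
  | .skip | .op _ => false
  | .seq s₁ s₂ => s₁.stores || s₂.stores
  | .ite _ _ s₁ s₂ => s₁.stores || s₂.stores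
  | .loop _ _ s => s.stores

/-- Whether a program may produce output. -/
def Stmt.emits : Stmt → Bool
  | .op (.emit _) => true
  | .skip | .op _ => false
  | .seq s₁ s₂ => s₁.emits || s₂.emits
  | .ite _ _ s₁ s₂ => s₁.emits || s₂.emits
  | .loop _ _ s => s.emits

/-- What a program cannot have changed on the way from `σ` to `σ'`. -/
structure Frame (s : Stmt) (σ σ' : St) : Prop where
  reg : ∀ x, s.wr x = false → σ'.r x = σ.r x
  heap : s.stores = false → σ'.h = σ.h
  out : s.emits = false → σ'.o = σ.o

theorem Frame.refl (s : Stmt) (σ : St) : Frame s σ σ := ⟨fun _ _ => rfl, fun _ => rfl, fun _ => rfl⟩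

theorem Frame.trans {s : Stmt} {σ σ' σ'' : St} (h : Frame s σ σ') (h' : Frame s σ' σ'') :
    Frame s σ σ'' :=
  ⟨fun x hx => (h'.reg x hx).trans (h.reg x hx), fun hx => (h'.heap hx).trans (h.heap hx),
    fun hx => (h'.out hx).trans (h.out hx)⟩

theorem Frame.seq_left {s₁ s₂ : Stmt} {σ σ' : St} (h : Frame s₁ σ σ') : Frame (s₁ ;; s₂) σ σ' := by
  constructor
  · intro x hx; simp only [Stmt.wr, Bool.or_eq_false_iff] at hx; exact h.reg x hx.1
  · intro hx; simp only [Stmt.stores, Bool.or_eq_false_iff] at hx; exact h.heap hx.1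
  · intro hx; simp only [Stmt.emits, Bool.or_eq_false_iff] at hx; exact h.out hx.1

theorem Frame.seq_right {s₁ s₂ : Stmt} {σ σ' : St} (h : Frame s₂ σ σ') :
    Frame (s₁ ;; s₂) σ σ' := by
  constructor
  · intro x hx; simp only [Stmt.wr, Bool.or_eq_false_iff] at hx; exact h.reg x hx.2
  · intro hx; simp only [Stmt.stores, Bool.or_eq_false_iff] at hx; exact h.heap hx.2
  · intro hx; simp only [Stmt.emits, Bool.or_eq_false_iff] at hx; exact h.out hx.2

theorem Op.frame (i : Op) (σ : St) : Frame (.op i) σ (i.eval σ) := by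
  constructor
  · intro x hx
    cases i <;> simp_all [Stmt.wr, Op.eval]
  · intro hx
    cases i <;> simp_all [Stmt.stores, Op.eval]
  · intro hx
    cases i <;> simp_all [Stmt.emits, Op.eval]

theorem wp_frame {s : Stmt} : ∀ {Q : Post} {σ : St} {t : ℕ}, wp E s Q σ t →
    wp E s (fun σ' t' => Q σ' t' ∧ Frame s σ σ') σ t := by
  induction s with
  | skip => intro Q σ t h; exact ⟨h, .refl _ _⟩
  | op i => intro Q σ t h; exact ⟨h.1, h.2, i.frame σ⟩
  | seq s₁ s₂ ih₁ ih₂ =>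
    intro Q σ t h
    refine wp_conseq (s := s₁) (ih₁ h) fun σ' t' h' => ?_
    refine wp_conseq (s := s₂) (ih₂ h'.1) fun σ'' t'' h'' => ?_
    exact ⟨h''.1, h'.2.seq_left.trans h''.2.seq_right⟩
  | ite a b s₁ s₂ ih₁ ih₂ =>
    intro Q σ t h
    simp only [wp] at h ⊢
    split_ifs at h ⊢
    · refine wp_conseq (ih₁ h) fun σ' t' h' => ⟨h'.1, ?_⟩
      obtain ⟨h1, h2, h3⟩ := (h'.2.seq_left : Frame (s₁ ;; s₂) _ _)
      exact ⟨h1, h2, h3⟩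
    · refine wp_conseq (ih₂ h) fun σ' t' h' => ⟨h'.1, ?_⟩
      obtain ⟨h1, h2, h3⟩ := (h'.2.seq_right : Frame (s₁ ;; s₂) _ _)
      exact ⟨h1, h2, h3⟩
  | loop a b s ih =>
    intro Q σ t h
    obtain ⟨n, hn⟩ := h
    refine ⟨n, ?_⟩
    have key : ∀ n σ₀ t, Frame s σ σ₀ → wpLoop (wp E s) a b Q n σ₀ t →
        wpLoop (wp E s) a b (fun σ' t' => Q σ' t' ∧ Frame (.loop a b s) σ σ') n σ₀ t := by
      intro n
      induction n with
      | zero => intro σ₀ t _ h; exact h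
      | succ n ihn =>
        intro σ₀ t hf h
        simp only [wpLoop] at h ⊢
        split_ifs at h ⊢
        · exact wp_conseq (ih h) fun σ' t' h' => ihn _ _ (hf.trans h'.2) h'.1
        · exact ⟨h, hf.1, hf.2, hf.3⟩
    exact key n σ t (.refl _ _) hn

/-- Sequential composition: the second program may rely on what the first one leaves alone. -/
theorem wp_seq {s₁ s₂ : Stmt} {Q₁ : Post} (h₁ : wp E s₁ Q₁ σ t)
    (h₂ : ∀ σ' t', Q₁ σ' t' → Frame s₁ σ σ' → wp E s₂ Q σ' t') : wp E (s₁ ;; s₂) Q σ t :=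
  wp_conseq (s := s₁) (wp_frame h₁) fun σ' t' h => h₂ σ' t' h.1 h.2

/-- The rule for loops with a termination measure. -/
theorem wp_loop {a b : Reg} {s : Stmt} (I : Post) (μ : St → ℕ) (h0 : I σ t)
    (hstep : ∀ τ t', Frame s σ τ → I τ t' → τ.r a < τ.r b →
      wp E s (fun τ' t'' => I τ' (t'' + 1) ∧ μ τ' < μ τ) τ (t' + 1))
    (hend : ∀ τ t', Frame s σ τ → I τ t' → ¬ τ.r a < τ.r b → Q τ (t' + 2)) :
    wp E (.loop a b s) Q σ t := by
  have key : ∀ n τ t', μ τ < n → Frame s σ τ → I τ t' → wpLoop (wp E s) a b Q n τ t' := by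
    intro n
    induction n with
    | zero => intro τ t' h; omega
    | succ n ih =>
      intro τ t' hμ hf hI
      simp only [wpLoop]
      split_ifs with h
      · refine wp_conseq (wp_frame (hstep τ t' hf hI h)) fun τ' t'' h' => ?_
        exact ih _ _ (by omega) (hf.trans h'.2) h'.1.1
      · exact hend τ t' hf hI h
  exact ⟨_, key (μ σ + 1) σ t (by omega) (.refl _ _) h0⟩

/-- The rule for loops whose number of iterations is known beforehand. -/
theorem wp_loop_count {a b : Reg} {s : Stmt} (n : ℕ) (I : ℕ → Post) (h0 : I 0 σ t)
    (hstep : ∀ i < n, ∀ τ t', Frame s σ τ → I i τ t' → τ.r a < τ.r b ∧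
      wp E s (fun τ' t'' => I (i + 1) τ' (t'' + 1)) τ (t' + 1))
    (hend : ∀ τ t', Frame s σ τ → I n τ t' → ¬ τ.r a < τ.r b ∧ Q τ (t' + 2)) :
    wp E (.loop a b s) Q σ t := by
  have key : ∀ k, ∀ i τ t', i + k = n → Frame s σ τ → I i τ t' →
      wpLoop (wp E s) a b Q (k + 1) τ t' := by
    intro k
    induction k with
    | zero =>
      intro i τ t' hi hf hI
      obtain rfl : i = n := by omega
      have := hend τ t' hf hI
      simp only [wpLoop, this.1, if_false]
      exact this.2
    | succ k ih =>
      intro i τ t' hi hf hI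
      have := hstep i (by omega) τ t' hf hI
      rw [wpLoop]
      simp only [this.1, if_true]
      exact wp_conseq (wp_frame this.2) fun τ' t'' h' => ih (i + 1) _ _ (by omega) (hf.trans h'.2) h'.1
  exact ⟨_, key n 0 σ t (by omega) (.refl _ _) h0⟩

/-! ### Compilation -/

/-- The machine instruction for a non-branching instruction. -/
def Op.toInstr : Op → Instr
  | .const d v => .const d.ctorIdx v
  | .arith op d a b => .arith op d.ctorIdx a.ctorIdx b.ctorIdx
  | .load d a => .load d.ctorIdx a.ctorIdx
  | .store a b => .store a.ctorIdx b.ctorIdx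
  | .emit a => .emit a.ctorIdx

/-- The length of the compiled program. -/
def Stmt.size : Stmt → ℕ
  | .skip => 0
  | .op _ => 1
  | .seq s₁ s₂ => s₁.size + s₂.size
  | .ite _ _ s₁ s₂ => s₁.size + s₂.size + 2
  | .loop _ _ s => s.size + 3

/-- The machine code of a program that is placed at position `o`. -/
def Stmt.compile : Stmt → ℕ → List Instr
  | .skip, _ => []
  | .op i, _ => [i.toInstr]
  | .seq s₁ s₂, o => s₁.compile o ++ s₂.compile (o + s₁.size)
  | .ite a b s₁ s₂, o =>
    .jumpLt a.ctorIdx b.ctorIdx (o + s₂.size + 2) ::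
      (s₂.compile (o + 1) ++ (.jump (o + s₁.size + s₂.size + 2) :: s₁.compile (o + s₂.size + 2)))
  | .loop a b s, o =>
    .jumpLt a.ctorIdx b.ctorIdx (o + 2) :: .jump (o + s.size + 3) ::
      (s.compile (o + 2) ++ [.jump o])

theorem Stmt.length_compile (s : Stmt) : ∀ o, (s.compile o).length = s.size := by
  induction s with
  | skip => intro o; rfl
  | op i => intro o; rfl
  | seq s₁ s₂ ih₁ ih₂ => intro o; simp [compile, size, ih₁, ih₂]
  | ite a b s₁ s₂ ih₁ ih₂ => intro o; simp [compile, size, ih₁, ih₂]; omega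
  | loop a b s ih => intro o; simp [compile, size, ih]

/-- The code `l` occurs in `P` at position `o`. -/
def CodeAt (P : Program) (o : ℕ) (l : List Instr) : Prop := ∀ i < l.length, P[o + i]? = l[i]?

theorem CodeAt.left {P : Program} {o : ℕ} {l l' : List Instr} (h : CodeAt P o (l ++ l')) :
    CodeAt P o l := by
  intro i hi
  rw [h i (by simp; omega), List.getElem?_append_left hi]

theorem CodeAt.right {P : Program} {o : ℕ} {l l' : List Instr} (h : CodeAt P o (l ++ l')) :
    CodeAt P (o + l.length) l' := by
  intro i hi
  have := h (l.length + i) (by simp; omega)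
  rw [add_assoc, this, List.getElem?_append_right (by omega)]
  simp

theorem CodeAt.head {P : Program} {o : ℕ} {i : Instr} {l : List Instr} (h : CodeAt P o (i :: l)) :
    P[o]? = some i := by
  simpa using h 0 (by simp)

theorem CodeAt.tail {P : Program} {o : ℕ} {i : Instr} {l : List Instr} (h : CodeAt P o (i :: l)) :
    CodeAt P (o + 1) l := by
  intro j hj
  have := h (j + 1) (by simpa using hj)
  rw [add_assoc, add_comm 1 j, this]
  simp

/-- The machine configuration `c` at position `pc` represents the state `σ`. -/
structure Sim (pc : ℕ) (σ : St) (c : Config) : Prop where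
  pc : c.pc = pc
  reg : ∀ x : Reg, c.mem x.ctorIdx = σ.r x
  heap : ∀ i, base ≤ i → c.mem i = σ.h i
  out : c.out = σ.o

/-- The machine configuration `c` respects the resources. -/
structure Valid (E : Env) (c : Config) : Prop where
  top : c.top ≤ E.T
  reg : ∀ i < base, c.mem i ≤ E.W
  heap : ∀ i, base ≤ i → c.mem i ≤ E.H

theorem Op.sim_step {P : Program} {pc : ℕ} {c : Config} (hB : base ≤ E.T) (hH : E.H ≤ E.W)
    (i : Op) (hP : P[pc]? = some i.toInstr) (hs : Sim pc σ c) (hv : Valid E c)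
    (hi : i.safe E σ) : Sim (pc + 1) (i.eval σ) (step P c) ∧ Valid E (step P c) := by
  have hP' : P[c.pc]? = some i.toInstr := by rw [hs.pc]; exact hP
  have upd : ∀ (d : Reg) (v : ℕ), v ≤ E.W → ∀ tp, tp ≤ E.T →
      Sim (pc + 1) (σ.set d v)
        { pc := c.pc + 1, mem := Function.update c.mem d.ctorIdx v, top := tp, out := c.out } ∧
      Valid E
        { pc := c.pc + 1, mem := Function.update c.mem d.ctorIdx v, top := tp, out := c.out } := by
    intro d v hvW tp htp
    have hd := d.ctorIdx_lt
    refine ⟨⟨by simp [hs.pc], ?_, ?_, hs.out⟩, htp, ?_, ?_⟩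
    · intro x
      by_cases hx : x = d
      · subst hx; simp
      · have : x.ctorIdx ≠ d.ctorIdx := fun h => hx (Reg.ctorIdx_inj h)
        simp [hx, this, hs.reg]
    · intro j hj
      have : j ≠ d.ctorIdx := by omega
      simp [this, hs.heap j hj]
    · intro j hj
      simp only [Function.update_apply]
      split_ifs
      · exact hvW
      · exact hv.reg j hj
    · intro j hj
      have : j ≠ d.ctorIdx := by omega
      simp [this, hv.heap j hj]
  have hregW : ∀ x : Reg, σ.r x ≤ E.W := fun x => by
    rw [← hs.reg]; exact hv.reg _ x.ctorIdx_lt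
  have htop := hv.top
  have hlt := Reg.ctorIdx_lt
  cases i with
  | const d v =>
    simp only [step, hP', Op.toInstr, Op.eval]
    exact upd d v hi _ (max_le htop (by have := hlt d; simp [Instr.reach]; omega))
  | arith op d a b =>
    simp only [step, hP', Op.toInstr, Op.eval, hs.reg]
    refine upd d _ ?_ _ (max_le htop ?_)
    · cases op with
      | add => exact hi
      | mul => exact hi
      | sub => exact (Nat.sub_le _ _).trans (hregW a)
      | div => exact (Nat.div_le_self _ _).trans (hregW a)
      | mod => exact (Nat.mod_le _ _).trans (hregW a)
    · have := hlt d; have := hlt a; have := hlt b; simp [Instr.reach]; omega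
  | load d a =>
    simp only [step, hP', Op.toInstr, Op.eval, hs.reg]
    rw [hs.heap _ hi.1]
    refine upd d _ ?_ _ (max_le htop ?_)
    · rw [← hs.heap _ hi.1]; exact (hv.heap _ hi.1).trans hH
    · have := hlt d; have := hlt a; have := hi.2; simp [Instr.reach, hs.reg]; omega
  | store a b =>
    simp only [step, hP', Op.toInstr, Op.eval, hs.reg]
    refine ⟨⟨by simp [hs.pc], ?_, ?_, hs.out⟩, ?_, ?_, ?_⟩
    · intro x
      have := hlt x; have := hi.1
      have : x.ctorIdx ≠ σ.r a := by omega
      simp [this, hs.reg]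
    · intro j hj
      simp only [Function.update_apply, St.put_h, hs.heap j hj]
    · refine max_le htop ?_
      have := hlt a; have := hlt b; have := hi.2; simp [Instr.reach, hs.reg]; omega
    · intro j hj
      have := hi.1
      have : j ≠ σ.r a := by omega
      simp [this, hv.reg j hj]
    · intro j hj
      simp only [Function.update_apply]
      split_ifs
      · exact hi.2.2
      · exact hv.heap j hj
  | emit a =>
    simp only [step, hP', Op.toInstr, Op.eval, hs.reg]
    refine ⟨⟨by simp [hs.pc], hs.reg, hs.heap, by simp [hs.out]⟩, ?_, hv.reg, hv.heap⟩
    refine max_le htop ?_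
    have := hlt a; simp [Instr.reach]; omega

theorem sim_jump {P : Program} {pc l : ℕ} {c : Config}
    (hP : P[pc]? = some (.jump l)) (hs : Sim pc σ c) (hv : Valid E c) :
    Sim l σ (step P c) ∧ Valid E (step P c) := by
  have hP' : P[c.pc]? = some (.jump l) := by rw [hs.pc]; exact hP
  simp only [step, hP']
  exact ⟨⟨rfl, hs.reg, hs.heap, hs.out⟩, by simpa [Instr.reach] using hv.top, hv.reg, hv.heap⟩

theorem sim_jumpLt {P : Program} {pc l : ℕ} {a b : Reg} {c : Config} (hB : base ≤ E.T)
    (hP : P[pc]? = some (.jumpLt a.ctorIdx b.ctorIdx l)) (hs : Sim pc σ c) (hv : Valid E c) :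
    Sim (if σ.r a < σ.r b then l else pc + 1) σ (step P c) ∧ Valid E (step P c) := by
  have hP' : P[c.pc]? = some (.jumpLt a.ctorIdx b.ctorIdx l) := by rw [hs.pc]; exact hP
  simp only [step, hP', hs.reg]
  refine ⟨⟨by simp [hs.pc], hs.reg, hs.heap, hs.out⟩, max_le hv.top ?_, hv.reg, hv.heap⟩
  have := a.ctorIdx_lt; have := b.ctorIdx_lt; simp [Instr.reach]; omega

/-- The machine runs from `c` at time `t` to a configuration at position `pc'` that satisfies
the postcondition `Q`, and it respects the resources on the way. -/
def Reaches (E : Env) (P : Program) (c : Config) (t pc' : ℕ) (Q : Post) : Prop :=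
  ∃ n σ', Sim pc' σ' ((step P)^[n] c) ∧ Q σ' (t + n) ∧ ∀ j ≤ n, Valid E ((step P)^[j] c)

theorem Reaches.of_step {P : Program} {c : Config} {pc' : ℕ} (hv : Valid E c)
    (h : Reaches E P (step P c) (t + 1) pc' Q) : Reaches E P c t pc' Q := by
  obtain ⟨n, σ', h1, h2, h3⟩ := h
  refine ⟨n + 1, σ', by simpa using h1, by rw [add_comm n, ← add_assoc]; exact h2, ?_⟩
  intro j hj
  cases j with
  | zero => exact hv
  | succ j => simpa using h3 j (by omega)

theorem Reaches.trans {P : Program} {c : Config} {pc₁ pc₂ : ℕ} {Q₁ : Post}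
    (h : Reaches E P c t pc₁ Q₁)
    (h' : ∀ σ' t' c', Sim pc₁ σ' c' → Valid E c' → Q₁ σ' t' → Reaches E P c' t' pc₂ Q) :
    Reaches E P c t pc₂ Q := by
  obtain ⟨n, σ', h1, h2, h3⟩ := h
  obtain ⟨n', σ'', h4, h5, h6⟩ := h' _ _ _ h1 (h3 n le_rfl) h2
  refine ⟨n + n', σ'', by rw [add_comm, Function.iterate_add_apply]; exact h4,
    by rw [← add_assoc]; exact h5, ?_⟩
  intro j hj
  rcases le_total j n with h | h
  · exact h3 j h
  · obtain ⟨k, rfl⟩ := Nat.exists_eq_add_of_le h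
    rw [add_comm, Function.iterate_add_apply]
    exact h6 k (by omega)

/-- The compiled program does what the weakest precondition promises. -/
theorem wp_sound {P : Program} (hB : base ≤ E.T) (hH : E.H ≤ E.W) (s : Stmt) :
    ∀ (o : ℕ) (Q : Post) (σ : St) (t : ℕ) (c : Config), CodeAt P o (s.compile o) → Sim o σ c →
      Valid E c → wp E s Q σ t → Reaches E P c t (o + s.size) Q := by
  induction s with
  | skip =>
    intro o Q σ t c _ hs hv h
    exact ⟨0, σ, hs, h, fun j hj => by obtain rfl : j = 0 := by omega
                                       exact hv⟩
  | op i =>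
    intro o Q σ t c hc hs hv h
    obtain ⟨h1, h2⟩ := i.sim_step hB hH hc.head hs hv h.1
    exact .of_step hv ⟨0, _, h1, h.2, fun j hj => by obtain rfl : j = 0 := by omega
                                                     exact h2⟩
  | seq s₁ s₂ ih₁ ih₂ =>
    intro o Q σ t c hc hs hv h
    refine (ih₁ o _ σ t c hc.left hs hv h).trans fun σ' t' c' hs' hv' h' => ?_
    have := hc.right
    rw [s₁.length_compile] at this
    have := ih₂ _ _ _ _ _ this hs' hv' h'
    rwa [add_assoc] at this
  | ite a b s₁ s₂ ih₁ ih₂ =>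
    intro o Q σ t c hc hs hv h
    obtain ⟨h1, h2⟩ := sim_jumpLt hB hc.head hs hv
    refine .of_step hv ?_
    simp only [wp] at h
    split_ifs at h h1 with hlt
    · have hc1 := hc.tail.right.tail
      rw [s₂.length_compile, show o + 1 + s₂.size + 1 = o + s₂.size + 2 by ring] at hc1
      have := ih₁ _ _ _ _ _ hc1 h1 h2 h
      rwa [show o + s₂.size + 2 + s₁.size = o + (s₁.size + s₂.size + 2) by ring] at this
    · refine (ih₂ _ _ _ _ _ hc.tail.left h1 h2 h).trans fun σ' t' c' hs' hv' h' => ?_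
      have hc1 := hc.tail.right.head
      rw [s₂.length_compile] at hc1
      obtain ⟨h3, h4⟩ := sim_jump hc1 hs' hv'
      refine .of_step hv' ⟨0, _, ?_, h', fun j hj => by obtain rfl : j = 0 := by omega
                                                        exact h4⟩
      rwa [show o + s₁.size + s₂.size + 2 = o + (s₁.size + s₂.size + 2) by ring] at h3
  | loop a b s ih =>
    intro o Q σ t c hc hs hv h
    obtain ⟨n, hn⟩ := h
    induction n generalizing σ t c with
    | zero => exact hn.elim
    | succ n ihn =>
      obtain ⟨h1, h2⟩ := sim_jumpLt hB hc.head hs hv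
      refine .of_step hv ?_
      simp only [wpLoop] at hn
      split_ifs at hn h1 with hlt
      · refine (ih _ _ _ _ _ hc.tail.tail.left h1 h2 hn).trans fun σ' t' c' hs' hv' h' => ?_
        have hc1 := hc.tail.tail.right.head
        rw [s.length_compile] at hc1
        obtain ⟨h3, h4⟩ := sim_jump hc1 hs' hv'
        exact .of_step hv' (ihn _ _ _ h3 h4 h')
      · obtain ⟨h3, h4⟩ := sim_jump hc.tail.head h1 h2
        refine .of_step h2 ⟨0, _, ?_, hn, fun j hj => by obtain rfl : j = 0 := by omega
                                                         exact h4⟩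
        rwa [show o + s.size + 3 = o + (Stmt.loop a b s).size by simp [Stmt.size]; ring] at h3

theorem out_prefix_step (P : Program) (c : Config) : c.out <+: (step P c).out := by
  unfold step
  rcases P[c.pc]? with _ | i
  · exact List.prefix_rfl
  · cases i <;> simp

theorem out_prefix (P : Program) (c : Config) {i j : ℕ} (h : i ≤ j) :
    ((step P)^[i] c).out <+: ((step P)^[j] c).out := by
  induction j, h using Nat.le_induction with
  | base => exact List.prefix_rfl
  | succ j _ ih =>
    rw [Function.iterate_succ_apply']
    exact ih.trans (out_prefix_step _ _)

theorem cellBits_mono {a b : ℕ} (h : a ≤ b) : cellBits a ≤ cellBits b :=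
  max_le_max le_rfl (Nat.size_le_size h)

theorem Valid.memBits_le {c : Config} (h : Valid E c) (hB : base ≤ E.T) :
    c.memBits ≤ base * cellBits E.W + (E.T - base) * cellBits E.H := by
  have h1 : c.memBits ≤ ∑ i ∈ Finset.range E.T, cellBits (c.mem i) :=
    Finset.sum_le_sum_of_subset (Finset.range_mono h.top)
  rw [← Finset.sum_range_add_sum_Ico _ hB] at h1
  have h2 : ∑ i ∈ Finset.range base, cellBits (c.mem i) ≤ base * cellBits E.W := by
    have := Finset.sum_le_card_nsmul (Finset.range base) (fun i => cellBits (c.mem i))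
      (cellBits E.W) fun i hi => cellBits_mono (h.reg i (Finset.mem_range.1 hi))
    simpa using this
  have h3 : ∑ i ∈ Finset.Ico base E.T, cellBits (c.mem i) ≤ (E.T - base) * cellBits E.H := by
    have := Finset.sum_le_card_nsmul (Finset.Ico base E.T) (fun i => cellBits (c.mem i))
      (cellBits E.H) fun i hi => cellBits_mono (h.heap i (Finset.mem_Ico.1 hi).1)
    simpa using this
  omega

/-- The state in which a program starts. -/
def initSt (input : List ℕ) : St where
  r := fun x => input.getD x.ctorIdx 0
  h := fun _ => 0
  o := []

/-- A structured program, run on the machine: if the weakest precondition gives an output `out`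
within time `n`, the machine respects the resources and its output is `out`. -/
theorem exists_run {s : Stmt} {input : List ℕ} {Good : List ℕ → Prop} {n : ℕ} (hB : base ≤ E.T)
    (hH : E.H ≤ E.W) (hlen : input.length ≤ base) (hin : ∀ v ∈ input, v ≤ E.W)
    (h : wp E s (fun σ t => Good σ.o ∧ t ≤ n) (initSt input) 0) :
    ∃ t ≤ n, (configAt (s.compile 0) input t).Halted (s.compile 0) ∧
      Good (configAt (s.compile 0) input t).out ∧
      ∀ j ≤ t, Valid E (configAt (s.compile 0) input j) ∧
        (configAt (s.compile 0) input j).out <+: (configAt (s.compile 0) input t).out := by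
  have hge : ∀ i, base ≤ i → input.getD i 0 = 0 := fun i hi => by
    simp [show input.length ≤ i by omega]
  have hle : ∀ i, input.getD i 0 ≤ E.W := fun i => by
    rcases lt_or_ge i input.length with hi | hi
    · rw [List.getD_eq_getElem _ _ hi]; exact hin _ (List.getElem_mem _)
    · simp [hi]
  have hs : Sim 0 (initSt input) (start input) := ⟨rfl, fun x => rfl, hge, rfl⟩
  have hv : Valid E (start input) :=
    ⟨hlen.trans hB, fun i _ => hle i, fun i hi => by
      have := hge i hi
      change input.getD i 0 ≤ _
      omega⟩
  have hc : CodeAt (s.compile 0) 0 (s.compile 0) := fun i _ => by simp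
  obtain ⟨t, σ', h1, h2, h3⟩ := wp_sound hB hH s 0 _ _ 0 _ hc hs hv h
  refine ⟨t, by simpa using h2.2, ?_, ?_, fun j hj => ⟨h3 j hj, out_prefix _ _ hj⟩⟩
  · have := h1.pc
    simp only [Config.Halted, configAt, this, s.length_compile]
    omega
  · simp only [configAt, h1.out]; exact h2.1

end

/-! ### Parameters of the sieve -/

/-- The parameters: `l` is about `log N`, `K` is about `(N / l) ^ (1 / 3)`, and the numbers up to
`2 * N` are treated in segments of length `L = K * l`, which is about
`N ^ (1 / 3) * (log N) ^ (2 / 3)`. The window of large divisors that starts at `m` has length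
`m / K`. As `N ≤ K ^ 3 * l = K ^ 2 * L`, the error of the linear approximation in a window is
`O(L)`; as there are `O(K * l)` windows, the Euclidean algorithm, with `O(l)` steps in each of them,
takes only the time `O(L * l)` that is available for a segment. -/
structure Par (N K l L : ℕ) : Prop where
  two_le : 2 ≤ N
  three_le_l : 3 ≤ l
  one_le_K : 1 ≤ K
  L_eq : L = K * l
  le_cube : N ≤ K * K * K * l
  cube_le : K * K * K * l ≤ 8 * N
  pow_le : 2 ^ (l - 2) ≤ N
  lt_pow : N < 2 ^ (l - 1)

namespace Par

variable {N K l L : ℕ} (h : Par N K l L)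
include h

theorem l_le_L : l ≤ L := by rw [h.L_eq]; exact Nat.le_mul_of_pos_left _ h.one_le_K

theorem K_le_L : K ≤ L := by
  rw [h.L_eq]; exact Nat.le_mul_of_pos_right _ (by have := h.three_le_l; omega)

theorem three_le_L : 3 ≤ L := h.three_le_l.trans h.l_le_L

theorem le_sq_mul : N ≤ K * K * L := by
  rw [h.L_eq, ← mul_assoc]; exact h.le_cube

theorem L_le : L ≤ 8 * N := by
  refine le_trans ?_ h.cube_le
  rw [h.L_eq]
  have := h.one_le_K
  nlinarith [Nat.mul_le_mul this this, Nat.zero_le (K * l)]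

theorem end_le_cube : 3 * (2 * N + L) ≤ L * L * L := by
  have h1 : 9 * N ≤ L * L * L := by
    have h2 : L * L * L = (K * K * K * l) * (l * l) := by rw [h.L_eq]; ring
    have h3 : 9 ≤ l * l := Nat.mul_le_mul h.three_le_l h.three_le_l
    rw [h2]
    calc 9 * N ≤ (l * l) * (K * K * K * l) := Nat.mul_le_mul h3 h.le_cube
      _ = _ := by ring
  have h2 : 9 * L ≤ L * L * L := Nat.mul_le_mul_right _ (Nat.mul_le_mul h.three_le_L h.three_le_L)
  omega

theorem l_pow_le : l ^ 4 ≤ 96 * N := by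
  have key : ∀ j, (j + 3) ^ 4 ≤ 96 * 2 ^ (j + 1) := by
    intro j
    rcases Nat.lt_or_ge j 3 with hj | hj
    · interval_cases j <;> norm_num
    · induction j, hj using Nat.le_induction with
      | base => norm_num
      | succ j hj ih =>
        have h1 : (j + 1 + 3) ^ 4 ≤ 2 * (j + 3) ^ 4 := by
          obtain ⟨i, rfl⟩ := Nat.exists_eq_add_of_le hj
          ring_nf
          nlinarith [Nat.zero_le (i ^ 4), Nat.zero_le (i ^ 3), Nat.zero_le (i ^ 2)]
        rw [pow_succ 2 (j + 1)]
        omega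
  have h1 := key (l - 3)
  have h2 := h.three_le_l
  rw [show l - 3 + 3 = l by omega, show l - 3 + 1 = l - 2 by omega] at h1
  exact h1.trans (Nat.mul_le_mul_left _ h.pow_le)

theorem L_sq_le : L * L ≤ 20 * N := by
  have h1 : (L * L) ^ 3 ≤ (20 * N) ^ 3 := by
    calc (L * L) ^ 3 = (K * K * K * l) ^ 2 * l ^ 4 := by rw [h.L_eq]; ring
      _ ≤ (8 * N) ^ 2 * (96 * N) := Nat.mul_le_mul (Nat.pow_le_pow_left h.cube_le 2) h.l_pow_le
      _ ≤ (20 * N) ^ 3 := by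
        have : (20 * N) ^ 3 = (8 * N) ^ 2 * (96 * N) + 1856 * N ^ 3 := by ring
        omega
  exact (Nat.pow_le_pow_iff_left (by norm_num)).1 h1

end Par

/-! ### Large divisors: the candidates in a window -/

/-- If `m + r` has a multiple in the segment, then `r * k + s` is congruent modulo `m` to a small
number, where `k = A / m + 1` and `s = m - A % m`, so that `m * k = A + s`. Indeed, if
`x = (m + r) * k'` and `j = k - k'`, then `r * k + s = j * m + (x - A) + r * j`, and the error term
`r * j` is small because `r` is less than `m / K`. -/
theorem exists_small_residue {A L K m r x : ℕ} (hL : 3 ≤ L) (hK : 1 ≤ K) (hA : A ≤ 2 * (K * K * L))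
    (hm : m * m < A + L) (hLm : L ≤ m) (hr : r < m / K) (hd : m + r ∣ x) (hAx : A ≤ x)
    (hx : x < A + L) :
    ∃ j y, r * (A / m + 1) + (m - A % m) = j * m + y ∧ y < 5 * L := by
  obtain ⟨k', rfl⟩ := hd
  set k := A / m + 1 with hk
  set s := m - A % m with hs
  have hm0 : 0 < m := by omega
  have hmod := Nat.mod_lt A hm0
  have hAm : A = m * (A / m) + A % m := (Nat.div_add_mod A m).symm
  have hmk : m * k = A + s := by rw [hk, mul_add]; omega
  have hs1 : 1 ≤ s := by omega
  have hsm : s ≤ m := by omega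
  have hk' : k' ≤ k := by
    by_contra hcon
    have h1 : k + 1 ≤ k' := by omega
    have h2 : m * (k + 1) ≤ (m + r) * k' := Nat.mul_le_mul (by omega) h1
    rw [mul_add, hmk] at h2
    omega
  obtain ⟨j, hj⟩ := Nat.exists_eq_add_of_le hk'
  have e1 : (m + r) * k' + (m + r) * j = m * k + r * k := by rw [hj]; ring
  refine ⟨j, (m + r) * k' - A + r * j, ?_, ?_⟩
  · have : (m + r) * j = j * m + r * j := by ring
    omega
  · -- the rounding error `r * j` is at most `4 * L`
    have hrK : r * K ≤ m := by
      have := (Nat.le_div_iff_mul_le (by omega)).1 hr.le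
      exact this
    have hm3 : m ≤ K * K * L := by
      have h1 : m * L ≤ m * m := Nat.mul_le_mul_left _ hLm
      have h2 : L ≤ K * K * L := Nat.le_mul_of_pos_left _ (Nat.mul_pos hK hK)
      have h3 : m * L < 3 * (K * K) * L := by
        have : 3 * (K * K) * L = 3 * (K * K * L) := by ring
        omega
      have h4 : m < 3 * (K * K) := lt_of_mul_lt_mul_right h3 (Nat.zero_le _)
      have h5 : 3 * (K * K) ≤ L * (K * K) := Nat.mul_le_mul_right _ hL
      nlinarith
    have hrL : r ≤ L := by
      by_contra hcon
      have h1 : (L + 1) * K ≤ m := le_trans (Nat.mul_le_mul_right _ (by omega)) hrK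
      have h2 : ((L + 1) * K) * ((L + 1) * K) ≤ m * m := Nat.mul_le_mul h1 h1
      have h3 : L ≤ K * K * L := Nat.le_mul_of_pos_left _ (Nat.mul_pos hK hK)
      have h4 : ((L + 1) * K) * ((L + 1) * K) < 3 * L * (K * K) := by
        have : 3 * L * (K * K) = 3 * (K * K * L) := by ring
        omega
      have h5 : ((L + 1) * (L + 1)) * (K * K) < 3 * L * (K * K) := by
        have : ((L + 1) * K) * ((L + 1) * K) = ((L + 1) * (L + 1)) * (K * K) := by ring
        omega
      have h6 := lt_of_mul_lt_mul_right h5 (Nat.zero_le _)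
      nlinarith
    have hjm : j * m ≤ r * k + s := by
      have h0 : (m + r) * j = j * m + r * j := by ring
      omega
    have h1 : r * r * k ≤ 3 * L * m := by
      have h2 : (r * K) * (r * K) ≤ m * m := Nat.mul_le_mul hrK hrK
      have h3 : (r * r * k) * (K * K) ≤ (3 * L * m) * (K * K) := by
        calc (r * r * k) * (K * K) = ((r * K) * (r * K)) * k := by ring
          _ ≤ (m * m) * k := Nat.mul_le_mul_right _ h2
          _ = m * (A + s) := by rw [mul_assoc, hmk]
          _ ≤ m * (3 * (K * K * L)) := Nat.mul_le_mul_left _ (by omega)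
          _ = _ := by ring
      exact le_of_mul_le_mul_right h3 (Nat.mul_pos hK hK)
    have h2 : r * s ≤ L * m := Nat.mul_le_mul hrL hsm
    have h3 : (r * j) * m ≤ (4 * L) * m := by
      calc (r * j) * m = r * (j * m) := by ring
        _ ≤ r * (r * k + s) := Nat.mul_le_mul_left _ hjm
        _ = r * r * k + r * s := by ring
        _ ≤ (4 * L) * m := by linarith
    have h4 := le_of_mul_le_mul_right h3 hm0
    omega

/-- What the Euclidean algorithm on `(m, k % m)` maintains: consecutive denominators `q₀`, `q₁`
of convergents of `k / m` together with the errors `d₀`, `d₁`. -/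
def EuclidInv (m k q₀ q₁ d₀ d₁ : ℕ) : Prop :=
  q₁ * d₀ + q₀ * d₁ = m ∧ ∃ σ a₀ a₁ : ℤ, (σ = 1 ∨ σ = -1) ∧
    (q₁ : ℤ) * k - a₁ * m = σ * d₁ ∧ (q₀ : ℤ) * k - a₀ * m = -σ * d₀

theorem EuclidInv.init (m k : ℕ) : EuclidInv m k 0 1 m (k % m) := by
  refine ⟨by simp, 1, 1, k / m, .inl rfl, ?_, by simp⟩
  have := Nat.div_add_mod k m
  push_cast
  have h : (k : ℤ) = m * (k / m : ℕ) + (k % m : ℕ) := by exact_mod_cast this.symm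
  push_cast at h
  linarith

theorem EuclidInv.next {m k q₀ q₁ d₀ d₁ : ℕ} (h : EuclidInv m k q₀ q₁ d₀ d₁) :
    EuclidInv m k q₁ (d₀ / d₁ * q₁ + q₀) d₁ (d₀ - d₀ / d₁ * d₁) := by
  obtain ⟨h1, σ, a₀, a₁, hσ, h2, h3⟩ := h
  have h4 : d₀ / d₁ * d₁ ≤ d₀ := Nat.div_mul_le_self _ _
  set c := d₀ / d₁
  obtain ⟨d₂, hd₂⟩ := Nat.exists_eq_add_of_le h4
  refine ⟨?_, -σ, a₁, c * a₁ + a₀, by rcases hσ with rfl | rfl <;> simp, ?_, ?_⟩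
  · rw [hd₂, Nat.add_sub_cancel_left, ← h1, hd₂]; ring
  · have h5 : ((d₀ - c * d₁ : ℕ) : ℤ) = d₀ - c * d₁ := by push_cast [h4]; ring
    rw [h5]
    push_cast
    linear_combination c * h2 + h3
  · linear_combination h2

/-- When the denominators have become too large, the error is small. -/
theorem EuclidInv.error_lt {m k q₀ q₁ d₀ d₁ R : ℕ} (hm : 0 < m) (h : EuclidInv m k q₀ q₁ d₀ d₁)
    (hR : d₁ = 0 ∨ R < d₀ / d₁ * q₁ + q₀) : R * d₁ < m := by
  rcases Nat.eq_zero_or_pos d₁ with h0 | h0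
  · simpa [h0] using hm
  · have h1 := hR.resolve_left (by omega)
    have h4 : d₀ / d₁ * d₁ ≤ d₀ := Nat.div_mul_le_self _ _
    calc R * d₁ < (d₀ / d₁ * q₁ + q₀) * d₁ := Nat.mul_lt_mul_of_pos_right h1 h0
      _ = q₁ * (d₀ / d₁ * d₁) + q₀ * d₁ := by ring
      _ ≤ q₁ * d₀ + q₀ * d₁ := by gcongr
      _ = m := h.1

/-- The admissible `r` lie in few residue classes modulo the denominator `q₁`. Multiplication of
`r * k + s = j * m + y` by `q₁` allows one to replace `r * q₁ * k` by `r * a₁ * m`, up to an error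
of absolute value `r * d₁ < m`; hence the integer `v = r * a₁ - j * q₁` lies in an interval whose length is about `5 * L * q₁ / m`. Since
`q₀ * a₁ - q₁ * a₀` is `1` or `-1`, the number `v` determines `r` modulo `q₁` to be `q₀ * v` up to
the sign. -/
theorem EuclidInv.exists_class {m k q₀ q₁ d₀ d₁ R r s j y L : ℕ} (hm : 0 < m)
    (h : EuclidInv m k q₀ q₁ d₀ d₁) (hq : 1 ≤ q₁) (hR : R * d₁ < m) (hr : r < R) (hs : s ≤ m)
    (hj : r * k + s = j * m + y) (hy : y < 5 * L) :
    ∃ i < 5 * L * q₁ / m + 3,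
      r ≡ q₀ * (2 * q₁ - 1 - q₁ * s / m + i) [MOD q₁] ∨
      r + q₀ * (2 * q₁ - 1 - q₁ * s / m + i) ≡ 0 [MOD q₁] := by
  obtain ⟨h1, σ, a₀, a₁, hσ, h2, h3⟩ := h
  have hmZ : (0 : ℤ) < m := by exact_mod_cast hm
  have hdet : (q₀ : ℤ) * a₁ - q₁ * a₀ = -σ := by
    have h1' : (q₁ : ℤ) * d₀ + q₀ * d₁ = m := by exact_mod_cast h1
    have : ((q₀ : ℤ) * a₁ - q₁ * a₀) * m = -σ * m := by
      linear_combination (q₁ : ℤ) * h3 - q₀ * h2 - σ * h1'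
    exact mul_right_cancel₀ hmZ.ne' this
  have hjZ : (r : ℤ) * k + s = j * m + y := by exact_mod_cast hj
  set t := q₁ * s / m with ht
  have ht1 : t * m ≤ q₁ * s := Nat.div_mul_le_self _ _
  have ht2 : q₁ * s < (t + 1) * m := by
    have := Nat.lt_div_mul_add (a := q₁ * s) hm
    rw [← ht] at this
    linarith
  have htq : t ≤ q₁ := by
    rw [ht]; exact (Nat.div_le_div_right (Nat.mul_le_mul_left _ hs)).trans (by rw [Nat.mul_div_cancel _ hm])
  set u := 5 * L * q₁ / m with hu
  have hu2 : 5 * L * q₁ < (u + 1) * m := by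
    have := Nat.lt_div_mul_add (a := 5 * L * q₁) hm
    rw [← hu] at this
    linarith
  set v : ℤ := r * a₁ - j * q₁ with hv
  have hmv : m * v = q₁ * y - q₁ * s - r * (σ * d₁) := by
    rw [hv]; linear_combination (q₁ : ℤ) * hjZ - (r : ℤ) * h2
  have hrd : (r : ℤ) * d₁ < m := by
    have : r * d₁ ≤ R * d₁ := Nat.mul_le_mul_right _ hr.le
    exact_mod_cast this.trans_lt hR
  have hrd0 : (0 : ℤ) ≤ r * d₁ := by positivity
  have habs : -(m : ℤ) < r * (σ * d₁) ∧ r * (σ * d₁) < m := by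
    rcases hσ with rfl | rfl
    · rw [one_mul]; constructor <;> linarith
    · rw [neg_one_mul, mul_neg]; constructor <;> linarith
  have ht1Z : (t : ℤ) * m ≤ q₁ * s := by exact_mod_cast ht1
  have ht2Z : (q₁ : ℤ) * s < (t + 1) * m := by exact_mod_cast ht2
  have hu2Z : 5 * (L : ℤ) * q₁ < (u + 1) * m := by exact_mod_cast hu2
  have hqy : (0 : ℤ) ≤ q₁ * y := by positivity
  have hqy2 : (q₁ : ℤ) * y ≤ 5 * L * q₁ := by
    have : q₁ * y ≤ q₁ * (5 * L) := Nat.mul_le_mul_left _ hy.le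
    have h' : (q₁ : ℤ) * y ≤ q₁ * (5 * L) := by exact_mod_cast this
    linarith
  have hlow : -((t : ℤ) + 2) < v := by
    have : (m : ℤ) * (-((t : ℤ) + 2)) < m * v := by linarith
    exact lt_of_mul_lt_mul_left this hmZ.le
  have hhigh : v < (u : ℤ) + 2 - t := by
    have : (m : ℤ) * v < m * ((u : ℤ) + 2 - t) := by linarith
    exact lt_of_mul_lt_mul_left this hmZ.le
  -- the shift by `2 * q₁ - 1 - t` makes the representative of `v` modulo `q₁` a natural number
  refine ⟨(v + t + 1).toNat, by omega, ?_⟩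
  have hz : ((2 * q₁ - 1 - t + (v + t + 1).toNat : ℕ) : ℤ) = 2 * q₁ + v := by omega
  have hq0v : (q₁ : ℤ) ∣ q₀ * (2 * q₁ + v) + σ * r :=
    ⟨2 * q₀ + a₀ * r - q₀ * j, by rw [hv]; linear_combination (r : ℤ) * hdet⟩
  rcases hσ with rfl | rfl
  · right
    rw [← Int.natCast_modEq_iff, Nat.cast_add, Nat.cast_mul, hz]
    refine (Int.modEq_zero_iff_dvd.2 ?_)
    convert hq0v using 1; ring
  · left
    rw [← Int.natCast_modEq_iff, Nat.cast_mul, hz]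
    refine (Int.modEq_iff_dvd.2 ?_)
    convert hq0v using 1; ring

/-! ### Large divisors: the number of windows and of candidates -/

/-- The left end points of the windows: the window with index `i` is the set of the integers `d`
with `wm K L i ≤ d < wm K L i + wm K L i / K`. -/
def wm (K L : ℕ) : ℕ → ℕ
  | 0 => L
  | i + 1 => wm K L i + wm K L i / K

theorem L_le_wm (K L i : ℕ) : L ≤ wm K L i := by
  induction i with
  | zero => exact le_rfl
  | succ i ih => exact ih.trans (Nat.le_add_right _ _)

theorem wm_mono (K L : ℕ) : Monotone (wm K L) :=
  monotone_nat_of_le_succ fun _ => Nat.le_add_right _ _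

/-- The denominators `q ≤ R` of the good rational approximations of `k / m`. -/
def IsDenom (m k R q : ℕ) : Prop :=
  1 ≤ q ∧ q ≤ R ∧ ∃ a : ℤ, (R : ℤ) * |(q : ℤ) * k - a * m| < m

/-- The least denominator of a good rational approximation of `k / m` (and `0` if there is
none). -/
noncomputable def qmin (m k R : ℕ) : ℕ := sInf {q | IsDenom m k R q}

theorem div_le_div_qmin {m k R q : ℕ} (h : IsDenom m k R q) : R / q ≤ R / qmin m k R :=
  Nat.div_le_div_left (Nat.sInf_le h) (Nat.sInf_mem (s := {q | IsDenom m k R q}) ⟨q, h⟩).1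

theorem EuclidInv.isDenom {m k q₀ q₁ d₀ d₁ R : ℕ} (h : EuclidInv m k q₀ q₁ d₀ d₁) (hq : 1 ≤ q₁)
    (hqR : q₁ ≤ R) (hR : R * d₁ < m) : IsDenom m k R q₁ := by
  obtain ⟨-, σ, a₀, a₁, hσ, h2, h3⟩ := h
  refine ⟨hq, hqR, a₁, ?_⟩
  rw [h2, abs_mul]
  have : |σ| = 1 := by rcases hσ with rfl | rfl <;> simp
  rw [this, one_mul, Nat.abs_cast]
  exact_mod_cast hR

theorem lt_two_mul_div {m K : ℕ} (hK : 1 ≤ K) (h : K ≤ m) : m < 2 * K * (m / K) := by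
  have h1 := Nat.lt_div_mul_add (a := m) (b := K) hK
  have h2 : 1 ≤ m / K := Nat.div_pos h hK
  nlinarith

/-- A window with a good approximation `a / q` lies close to the place where `A / x ^ 2 = a / q`;
moreover `q * a` is small. -/
theorem window_facts {N K l L A m q : ℕ} {a : ℤ} (h : Par N K l L) (hA : A ≤ 2 * N)
    (hm : m * m < A + L) (hLm : L ≤ m) (hq : 1 ≤ q) (hqR : q ≤ m / K)
    (ha : ((m / K : ℕ) : ℤ) * |(q : ℤ) * (A / m + 1 : ℕ) - a * m| < m) :
    1 ≤ a ∧ |a * m ^ 2 - q * A| ≤ (2 * K + q) * m ∧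
      a * ((m / K : ℕ) : ℤ) ^ 2 ≤ 6 * q * L ∧ q * a ≤ 6 * L := by
  have hK := h.one_le_K
  have hL3 := h.three_le_L
  have hlow := lt_two_mul_div hK (h.K_le_L.trans hLm)
  have hRK : m / K * K ≤ m := Nat.div_mul_le_self _ _
  have hl : 3 ≤ m / K := by
    refine h.three_le_l.trans ((Nat.le_div_iff_mul_le hK).2 ?_)
    rw [mul_comm, ← h.L_eq]; exact hLm
  set R := m / K
  set k := A / m + 1 with hk
  have hmk : m * k = A + (m - A % m) := by
    have hmod := Nat.mod_lt A (show 0 < m by omega)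
    have hAm : A = m * (A / m) + A % m := (Nat.div_add_mod A m).symm
    rw [hk, mul_add]; omega
  have hs := Nat.sub_le m (A % m)
  set s := m - A % m
  have hkm : m ≤ k := by
    by_contra hcon
    have h1 : A / m + 2 ≤ m := by omega
    have h2 : A < m * (A / m + 1) := by
      have := Nat.lt_div_mul_add (a := A) (b := m) (by omega)
      linarith
    have h3 : m * (A / m + 2) ≤ m * m := Nat.mul_le_mul_left _ h1
    nlinarith
  have hm3 : m ≤ K * K * L := by
    have h0 := h.le_sq_mul
    have h1 : m * L ≤ m * m := Nat.mul_le_mul_left _ hLm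
    have h2 : L ≤ K * K * L := Nat.le_mul_of_pos_left _ (Nat.mul_pos hK hK)
    have h3 : m * L < 3 * (K * K) * L := by
      have : 3 * (K * K) * L = 3 * (K * K * L) := by ring
      omega
    have h4 : m < 3 * (K * K) := lt_of_mul_lt_mul_right h3 (Nat.zero_le _)
    have h5 : 3 * (K * K) ≤ L * (K * K) := Nat.mul_le_mul_right _ hL3
    linarith
  have h0 := h.le_sq_mul
  -- from here on everything is in `ℤ`
  obtain ⟨ε, hε⟩ : ∃ ε : ℤ, (q : ℤ) * k - a * m = ε := ⟨_, rfl⟩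
  rw [hε] at ha
  zify at hlow hRK hl hmk hs hkm hm3 hLm hL3 hA h0 hK hq hqR
  have hmpos : (0 : ℤ) < m := by linarith
  have habs := abs_nonneg ε
  have hε1 : |ε| ≤ 2 * K := by
    by_contra hcon
    have : 2 * (K : ℤ) * R < R * |ε| := by nlinarith
    linarith
  have hε2 : 2 * |ε| < m := by nlinarith
  have hε3 := neg_abs_le ε
  have hε4 := le_abs_self ε
  have hqk : (m : ℤ) ≤ q * k := by nlinarith
  have ha1 : 1 ≤ a := by
    have : 0 < a * m := by linarith
    have := (pos_iff_pos_of_mul_pos this).2 hmpos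
    omega
  have e1 : a * m ^ 2 - q * A = q * s - ε * m := by
    have : a * m = q * k - ε := by linarith
    calc a * m ^ 2 - q * A = (a * m) * m - q * A := by ring
      _ = (q * k - ε) * m - q * A := by rw [this]
      _ = q * (m * k) - ε * m - q * A := by ring
      _ = _ := by rw [hmk]; ring
  have hs0 : (0 : ℤ) ≤ s := by positivity
  have hqs : (q : ℤ) * s ≤ q * m := mul_le_mul_of_nonneg_left hs (by positivity)
  have hqs0 : (0 : ℤ) ≤ q * s := by positivity
  have hεm : |ε| * m ≤ 2 * K * m := mul_le_mul_of_nonneg_right hε1 hmpos.le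
  have hεm1 : ε * m ≤ |ε| * m := mul_le_mul_of_nonneg_right hε4 hmpos.le
  have hεm2 : -(|ε| * m) ≤ ε * m := by
    have := mul_le_mul_of_nonneg_right hε3 hmpos.le
    linarith
  have hqm : (0 : ℤ) ≤ q * m := by positivity
  have h2 : |a * m ^ 2 - q * A| ≤ (2 * K + q) * m := by
    rw [e1, abs_le]
    constructor <;> linarith
  have h3 : a * (R : ℤ) ^ 2 ≤ 6 * q * L := by
    have h4 : a * m ≤ 2 * (q * k) := by linarith
    have h5 : (a * (R : ℤ) ^ 2) * (K * K) ≤ (6 * q * L) * (K * K) := by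
      calc (a * (R : ℤ) ^ 2) * (K * K) = a * ((R * K) * (R * K)) := by ring
        _ ≤ a * (m * m) := by gcongr
        _ = (a * m) * m := by ring
        _ ≤ (2 * (q * k)) * m := by gcongr
        _ = 2 * q * (A + s) := by rw [← hmk]; ring
        _ ≤ 2 * q * (3 * (K * K * L)) := by gcongr; linarith
        _ = _ := by ring
    exact le_of_mul_le_mul_right h5 (by positivity)
  refine ⟨ha1, h2, h3, ?_⟩
  have h6 : q * (q * a) ≤ q * (6 * (L : ℤ)) := by
    calc q * (q * a) = a * (q : ℤ) ^ 2 := by ring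
      _ ≤ a * (R : ℤ) ^ 2 := by gcongr
      _ ≤ _ := by linarith
  exact le_of_mul_le_mul_left h6 (by linarith)

theorem sum_Ico_wm (K L : ℕ) {a b : ℕ} (h : a ≤ b) :
    wm K L a + ∑ i ∈ Finset.Ico a b, wm K L i / K = wm K L b := by
  induction b, h using Nat.le_induction with
  | base => simp
  | succ b hb ih => rw [Finset.sum_Ico_succ_top hb, ← add_assoc, ih]; rfl

/-- The windows with the same approximation `a / q` are close together, so that they contribute
little. -/
theorem sum_group_le {N K l L A q a : ℕ} (h : Par N K l L) (hA : A ≤ 2 * N) (F : Finset ℕ)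
    (hm : ∀ i ∈ F, wm K L i * wm K L i < A + L)
    (hF : ∀ i ∈ F, 1 ≤ q ∧ q ≤ wm K L i / K ∧ ((wm K L i / K : ℕ) : ℤ) *
      |(q : ℤ) * (A / wm K L i + 1 : ℕ) - (a : ℤ) * wm K L i| < wm K L i) :
    ∑ i ∈ F, ((wm K L i / K : ℕ) : ℝ) / q ≤ 2 * K / (q * a) + 2 * √(6 * L / (q * a)) := by
  rcases F.eq_empty_or_nonempty with rfl | hne
  · simp only [Finset.sum_empty]; positivity
  obtain ⟨i₀, hi₀, hmin⟩ := F.exists_min_image id hne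
  obtain ⟨i₁, hi₁, hmax⟩ := F.exists_max_image id hne
  simp only [id] at hmin hmax
  obtain ⟨hq, hqR, hF0⟩ := hF i₀ hi₀
  obtain ⟨ha, h1, -, -⟩ := window_facts h hA (hm _ hi₀) (L_le_wm _ _ _) hq hqR hF0
  obtain ⟨hq', hqR', hF1⟩ := hF i₁ hi₁
  obtain ⟨-, h2, h3, h4⟩ := window_facts h hA (hm _ hi₁) (L_le_wm _ _ _) hq' hqR' hF1
  have h01 : i₀ ≤ i₁ := hmin _ hi₁
  have hmm : wm K L i₀ ≤ wm K L i₁ := wm_mono K L h01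
  have hm0 : 0 < wm K L i₀ := lt_of_lt_of_le (by have := h.three_le_L; omega) (L_le_wm K L i₀)
  -- the sum of the lengths of the windows
  have hsum : ∑ i ∈ F, wm K L i / K + wm K L i₀ ≤ wm K L i₁ + wm K L i₁ / K := by
    have := sum_Ico_wm K L (show i₀ ≤ i₁ + 1 by omega)
    have h5 : ∑ i ∈ F, wm K L i / K ≤ ∑ i ∈ Finset.Ico i₀ (i₁ + 1), wm K L i / K := by
      apply Finset.sum_le_sum_of_subset
      intro i hi
      rw [Finset.mem_Ico]
      exact ⟨hmin i hi, Nat.lt_succ_of_le (hmax i hi)⟩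
    have h6 : wm K L (i₁ + 1) = wm K L i₁ + wm K L i₁ / K := rfl
    omega
  set R := wm K L i₁ / K
  set m := wm K L i₀
  set m' := wm K L i₁
  have hdiff : (a : ℝ) * (m' - m) ≤ 2 * K + q := by
    have h5 := (abs_le.1 h1).1
    have h6 := (abs_le.1 h2).2
    have h7 : (a : ℤ) * (m' - m) * (m + m') ≤ (2 * K + q) * (m + m') := by nlinarith
    have h8 : (0 : ℤ) < m + m' := by exact_mod_cast (show 0 < m + m' by omega)
    have h9 := le_of_mul_le_mul_right h7 h8
    exact_mod_cast h9
  have haR : (1 : ℝ) ≤ a := by exact_mod_cast ha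
  have hqR : (1 : ℝ) ≤ q := by exact_mod_cast hq
  have hqa : (0 : ℝ) < q * a := by positivity
  have hlast : (R : ℝ) ≤ q * √(6 * L / (q * a)) := by
    have h3' : (a : ℝ) * R ^ 2 ≤ 6 * q * L := by exact_mod_cast h3
    have e : (q : ℝ) * √(6 * L / (q * a)) = √(6 * q * L / a) := by
      rw [show (6 * q * L / a : ℝ) = q ^ 2 * (6 * L / (q * a)) by field_simp,
        Real.sqrt_mul (by positivity), Real.sqrt_sq (by positivity)]
    rw [e]
    apply Real.le_sqrt_of_sq_le
    rw [le_div_iff₀ (by positivity)]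
    linarith
  have hone : (1 : ℝ) ≤ √(6 * L / (q * a)) := by
    apply Real.le_sqrt_of_sq_le
    rw [le_div_iff₀ hqa]
    have : (q : ℝ) * a ≤ 6 * L := by exact_mod_cast h4
    linarith
  have hsumR : ∑ i ∈ F, ((wm K L i / K : ℕ) : ℝ) + m ≤ m' + R := by exact_mod_cast hsum
  rw [← Finset.sum_div, div_le_iff₀ (by positivity)]
  have h5 : (m' : ℝ) - m ≤ (2 * K + q) / a := by
    rw [le_div_iff₀ (by positivity)]; linarith
  have h6 : (2 * (K : ℝ) + q) / a ≤ 2 * K / a + q := by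
    rw [add_div]
    gcongr
    exact div_le_self (by positivity) haR
  have h7 : (2 * (K : ℝ) / (q * a) + 2 * √(6 * L / (q * a))) * q =
      2 * K / a + 2 * (q * √(6 * L / (q * a))) := by
    field_simp
  rw [h7]
  have h8 : (q : ℝ) ≤ q * √(6 * L / (q * a)) := le_mul_of_one_le_right (by positivity) hone
  linarith

theorem sum_inv_sqrt_le (n : ℕ) : ∑ a ∈ Finset.Icc 1 n, 1 / √(a : ℝ) ≤ 2 * √n := by
  induction n with
  | zero => simp
  | succ n ih =>
    rw [Finset.sum_Icc_succ_top (by omega)]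
    have h1 : (0 : ℝ) < √((n + 1 : ℕ) : ℝ) := Real.sqrt_pos.2 (by positivity)
    have h2 : √(n : ℝ) ^ 2 = n := Real.sq_sqrt (by positivity)
    have h3 : √((n + 1 : ℕ) : ℝ) ^ 2 = n + 1 := by rw [Real.sq_sqrt (by positivity)]; push_cast; ring
    have h4 := Real.sqrt_nonneg (n : ℝ)
    have h5 : 1 / √((n + 1 : ℕ) : ℝ) ≤ 2 * √((n + 1 : ℕ) : ℝ) - 2 * √n := by
      rw [div_le_iff₀ h1]
      nlinarith [sq_nonneg (√((n + 1 : ℕ) : ℝ) - √n)]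
    linarith

theorem sum_inv_le (n : ℕ) : ∑ a ∈ Finset.Icc 1 n, 1 / (a : ℝ) ≤ 1 + Real.log n := by
  have h1 := harmonic_le_one_add_log n
  rw [harmonic_eq_sum_Icc] at h1
  push_cast at h1
  simpa using h1

/-- A sum over the lattice points below a hyperbola. -/
theorem sum_hyperbola_le (Z K : ℕ) :
    ∑ p ∈ (Finset.Icc 1 Z ×ˢ Finset.Icc 1 Z).filter (fun p => p.1 * p.2 ≤ Z),
      (2 * (K : ℝ) / (p.1 * p.2) + 2 * √(Z / (p.1 * p.2))) ≤
    2 * K * (1 + Real.log Z) ^ 2 + 4 * Z * (1 + Real.log Z) := by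
  rw [Finset.sum_add_distrib]
  have hH := sum_inv_le Z
  have hH0 : 0 ≤ ∑ a ∈ Finset.Icc 1 Z, 1 / (a : ℝ) := Finset.sum_nonneg fun _ _ => by positivity
  apply add_le_add
  · calc ∑ p ∈ (Finset.Icc 1 Z ×ˢ Finset.Icc 1 Z).filter (fun p => p.1 * p.2 ≤ Z),
          (2 * (K : ℝ) / (p.1 * p.2))
        ≤ ∑ p ∈ (Finset.Icc 1 Z ×ˢ Finset.Icc 1 Z), (2 * (K : ℝ) / (p.1 * p.2)) :=
          Finset.sum_le_sum_of_subset_of_nonneg (Finset.filter_subset _ _)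
            fun _ _ _ => by positivity
      _ = 2 * K * ((∑ a ∈ Finset.Icc 1 Z, 1 / (a : ℝ)) * ∑ a ∈ Finset.Icc 1 Z, 1 / (a : ℝ)) := by
          rw [Finset.sum_mul_sum, Finset.sum_product, Finset.mul_sum]
          refine Finset.sum_congr rfl fun q _ => ?_
          rw [Finset.mul_sum]
          refine Finset.sum_congr rfl fun a _ => ?_
          rw [div_mul_div_comm, one_mul, mul_one_div]
      _ ≤ _ := by rw [← sq]; gcongr
  · calc ∑ p ∈ (Finset.Icc 1 Z ×ˢ Finset.Icc 1 Z).filter (fun p => p.1 * p.2 ≤ Z),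
          (2 * √((Z : ℝ) / (p.1 * p.2)))
        = ∑ q ∈ Finset.Icc 1 Z, ∑ a ∈ (Finset.Icc 1 Z).filter (fun a => q * a ≤ Z),
            2 * √((Z : ℝ) / (q * a)) := by
          rw [Finset.sum_filter, Finset.sum_product]
          exact Finset.sum_congr rfl fun q _ => (Finset.sum_filter _ _).symm
      _ ≤ ∑ q ∈ Finset.Icc 1 Z, 4 * Z * (1 / (q : ℝ)) := by
          refine Finset.sum_le_sum fun q hq => ?_
          have hq1 : 1 ≤ q := (Finset.mem_Icc.1 hq).1
          have e : (Finset.Icc 1 Z).filter (fun a => q * a ≤ Z) = Finset.Icc 1 (Z / q) := by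
            ext a
            simp only [Finset.mem_filter, Finset.mem_Icc, Nat.le_div_iff_mul_le hq1, mul_comm a q]
            constructor
            · rintro ⟨⟨h1, -⟩, h2⟩; exact ⟨h1, h2⟩
            · rintro ⟨h1, h2⟩; exact ⟨⟨h1, le_trans (Nat.le_mul_of_pos_left _ hq1) h2⟩, h2⟩
          rw [e]
          have h1 : ∀ a : ℕ, 2 * √((Z : ℝ) / (q * a)) = 2 * √((Z : ℝ) / q) * (1 / √(a : ℝ)) := by
            intro a
            rw [← div_div, Real.sqrt_div (by positivity)]; ring
          simp_rw [h1]
          rw [← Finset.mul_sum]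
          have h2 : √((Z / q : ℕ) : ℝ) ≤ √((Z : ℝ) / q) := Real.sqrt_le_sqrt Nat.cast_div_le
          have h3 : √((Z : ℝ) / q) * √((Z : ℝ) / q) = Z / q := Real.mul_self_sqrt (by positivity)
          calc 2 * √((Z : ℝ) / q) * ∑ a ∈ Finset.Icc 1 (Z / q), 1 / √(a : ℝ)
              ≤ 2 * √((Z : ℝ) / q) * (2 * √((Z : ℝ) / q)) := by
                gcongr
                exact (sum_inv_sqrt_le _).trans (by linarith)
            _ = 4 * (√((Z : ℝ) / q) * √((Z : ℝ) / q)) := by ring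
            _ = 4 * Z * (1 / (q : ℝ)) := by rw [h3]; ring
      _ ≤ _ := by rw [← Finset.mul_sum]; gcongr

/-- The total number of candidates, up to a term that is regular in the windows. -/
theorem sum_div_qmin_le {N K l L A : ℕ} (h : Par N K l L) (hA : A ≤ 2 * N) (n : ℕ)
    (hm : ∀ i < n, wm K L i * wm K L i < A + L) :
    ∑ i ∈ Finset.range n, ((wm K L i / K / qmin (wm K L i) (A / wm K L i + 1) (wm K L i / K) : ℕ) : ℝ)
      ≤ 2 * K * (1 + Real.log (6 * L)) ^ 2 + 24 * L * (1 + Real.log (6 * L)) := by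
  classical
  set m := wm K L
  set q : ℕ → ℕ := fun i => qmin (m i) (A / m i + 1) (m i / K) with hq
  set G := (Finset.range n).filter fun i => q i ≠ 0 with hG
  have hden : ∀ i ∈ G, IsDenom (m i) (A / m i + 1) (m i / K) (q i) := by
    intro i hi
    have h1 : q i ≠ 0 := (Finset.mem_filter.1 hi).2
    by_cases hne : {q | IsDenom (m i) (A / m i + 1) (m i / K) q}.Nonempty
    · exact Nat.sInf_mem hne
    · rw [Set.not_nonempty_iff_eq_empty] at hne
      exact absurd (by simp only [hq, qmin, hne, Nat.sInf_empty]) h1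
  have hch : ∀ i, ∃ a : ℤ, i ∈ G →
      ((m i / K : ℕ) : ℤ) * |(q i : ℤ) * (A / m i + 1 : ℕ) - a * m i| < m i := by
    intro i
    by_cases hi : i ∈ G
    · obtain ⟨-, -, a, ha⟩ := hden i hi
      exact ⟨a, fun _ => ha⟩
    · exact ⟨0, fun h => absurd h hi⟩
  choose a ha using hch
  have hmG : ∀ i ∈ G, m i * m i < A + L := fun i hi =>
    hm i (Finset.mem_range.1 (Finset.mem_filter.1 hi).1)
  have hfacts : ∀ i ∈ G, 1 ≤ a i ∧ (q i : ℤ) * a i ≤ 6 * L := fun i hi => by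
    obtain ⟨h1, -, -, h4⟩ := window_facts h hA (hmG i hi) (L_le_wm _ _ _) (hden i hi).1
      (hden i hi).2.1 (ha i hi)
    exact ⟨h1, h4⟩
  have hcast : ∀ i ∈ G, ((a i).toNat : ℤ) = a i := fun i hi =>
    Int.toNat_of_nonneg (by linarith [(hfacts i hi).1])
  set P := (Finset.Icc 1 (6 * L) ×ˢ Finset.Icc 1 (6 * L)).filter fun p => p.1 * p.2 ≤ 6 * L
  have hmaps : ∀ i ∈ G, (q i, (a i).toNat) ∈ P := by
    intro i hi
    have h1 : 1 ≤ q i := (hden i hi).1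
    have h2 : 1 ≤ (a i).toNat := by have := (hfacts i hi).1; omega
    have h3 : q i * (a i).toNat ≤ 6 * L := by
      have := (hfacts i hi).2
      rw [← hcast i hi] at this
      exact_mod_cast this
    simp only [P, Finset.mem_filter, Finset.mem_product, Finset.mem_Icc]
    exact ⟨⟨⟨h1, le_trans (Nat.le_mul_of_pos_right _ h2) h3⟩, h2,
      le_trans (Nat.le_mul_of_pos_left _ h1) h3⟩, h3⟩
  have key := sum_hyperbola_le (6 * L) K
  push_cast at key
  calc ∑ i ∈ Finset.range n, ((m i / K / q i : ℕ) : ℝ)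
      ≤ ∑ i ∈ Finset.range n, ((m i / K : ℕ) : ℝ) / q i :=
        Finset.sum_le_sum fun _ _ => Nat.cast_div_le
    _ = ∑ i ∈ G, ((m i / K : ℕ) : ℝ) / q i := by
        symm
        apply Finset.sum_filter_of_ne
        intro i _ hne h0
        rw [h0] at hne
        simp at hne
    _ = ∑ p ∈ P, ∑ i ∈ G with (q i, (a i).toNat) = p, ((m i / K : ℕ) : ℝ) / q i :=
        (Finset.sum_fiberwise_of_maps_to hmaps _).symm
    _ ≤ ∑ p ∈ P, (2 * (K : ℝ) / (p.1 * p.2) + 2 * √(6 * L / (p.1 * p.2))) := by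
        refine Finset.sum_le_sum fun p _ => ?_
        have hp : ∀ i ∈ G.filter (fun i => (q i, (a i).toNat) = p), i ∈ G ∧ q i = p.1 ∧
            a i = p.2 := by
          intro i hi
          obtain ⟨h1, rfl⟩ := Finset.mem_filter.1 hi
          exact ⟨h1, rfl, (hcast i h1).symm⟩
        have := sum_group_le (q := p.1) (a := p.2) h hA
          (G.filter (fun i => (q i, (a i).toNat) = p)) (fun i hi => hmG i (hp i hi).1)
          (fun i hi => by
            obtain ⟨h1, h2, h3⟩ := hp i hi
            rw [← h2, ← h3]
            exact ⟨(hden i h1).1, (hden i h1).2.1, ha i h1⟩)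
        refine le_trans (le_of_eq ?_) this
        refine Finset.sum_congr rfl fun i hi => ?_
        rw [(hp i hi).2.1]
    _ ≤ _ := by
        refine key.trans (le_of_eq ?_)
        ring

theorem Par.log_le {N K l L : ℕ} (h : Par N K l L) {x : ℕ} (hx0 : 0 < x) (hx : x ≤ 64 * N) :
    1 + Real.log x ≤ 3 * l := by
  have h1 : x ≤ 2 ^ (l + 5) := by
    have := h.lt_pow
    have h2 : l + 5 = (l - 1) + 6 := by have := h.three_le_l; omega
    rw [h2, pow_add]
    omega
  have h2 : Real.log x ≤ (l + 5) * Real.log 2 := by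
    calc Real.log x ≤ Real.log ((2 : ℝ) ^ (l + 5)) :=
          Real.log_le_log (by exact_mod_cast hx0) (by exact_mod_cast h1)
      _ = _ := by rw [Real.log_pow]; push_cast; ring
  have h3 := Real.log_two_lt_d9
  have h4 : (3 : ℝ) ≤ l := by exact_mod_cast h.three_le_l
  have h5 : ((l : ℝ) + 5) * Real.log 2 ≤ (l + 5) * 1 := by gcongr; linarith
  linarith

theorem wm_le {N K l L A : ℕ} (h : Par N K l L) (hA : A ≤ 2 * N) (n : ℕ)
    (hm : ∀ i < n, wm K L i * wm K L i < A + L) : wm K L n ≤ 20 * N := by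
  have hL := h.L_le
  cases n with
  | zero => simp only [wm]; omega
  | succ n =>
    have h1 := hm n (by omega)
    have h2 : wm K L n ≤ wm K L n * wm K L n := Nat.le_mul_self _
    have h3 : wm K L n / K ≤ wm K L n := Nat.div_le_self _ _
    simp only [wm]
    omega

/-- The lengths of the windows relative to their positions add up to a logarithm. -/
theorem sum_div_wm_le {N K l L A : ℕ} (h : Par N K l L) (hA : A ≤ 2 * N) (n : ℕ)
    (hm : ∀ i < n, wm K L i * wm K L i < A + L) :
    ∑ i ∈ Finset.range n, ((wm K L i / K : ℕ) : ℝ) / wm K L i ≤ 6 * l := by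
  have hpos : ∀ i, 0 < wm K L i := fun i =>
    lt_of_lt_of_le (by have := h.three_le_L; omega) (L_le_wm K L i)
  have h1 : ∑ i ∈ Finset.range n, ((wm K L i / K : ℕ) : ℝ) / wm K L i ≤
      ∑ i ∈ Finset.range n, 2 * (Real.log (wm K L (i + 1)) - Real.log (wm K L i)) := by
    refine Finset.sum_le_sum fun i _ => ?_
    have hp : (0 : ℝ) < wm K L i := by exact_mod_cast hpos i
    have hp' : (0 : ℝ) < wm K L (i + 1) := by exact_mod_cast hpos (i + 1)
    rw [← Real.log_div hp'.ne' hp.ne']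
    have h2 := Real.one_sub_inv_le_log_of_pos (div_pos hp' hp)
    have h3 : (wm K L (i + 1) : ℝ) = wm K L i + (wm K L i / K : ℕ) := by
      rw [← Nat.cast_add]; rfl
    have h4 : ((wm K L i / K : ℕ) : ℝ) ≤ wm K L i := by exact_mod_cast Nat.div_le_self _ _
    have h5 : ((wm K L i / K : ℕ) : ℝ) / wm K L i ≤
        2 * (1 - ((wm K L (i + 1) : ℝ) / wm K L i)⁻¹) := by
      rw [inv_div, h3, one_sub_div (by positivity), add_sub_cancel_left, ← mul_div_assoc,
        div_le_div_iff₀ hp (by positivity)]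
      nlinarith [Nat.cast_nonneg (α := ℝ) (wm K L i / K)]
    linarith
  rw [← Finset.mul_sum, Finset.sum_range_sub (fun i => Real.log (wm K L i))] at h1
  have h2 := h.log_le (hpos n) ((wm_le h hA n hm).trans (by omega))
  have h3 : 0 ≤ Real.log (wm K L 0) := Real.log_natCast_nonneg _
  linarith

/-- There are `O(K * l)` windows, because the left end points grow by a factor of about `1 + 1 / K`
from each window to the next. -/
theorem number_windows_le {N K l L A : ℕ} (h : Par N K l L) (hA : A ≤ 2 * N) (n : ℕ)
    (hm : ∀ i < n, wm K L i * wm K L i < A + L) : n ≤ 12 * (K * l) := by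
  have h1 := sum_div_wm_le h hA n hm
  have h2 : (n : ℝ) * (1 / (2 * K)) ≤
      ∑ i ∈ Finset.range n, ((wm K L i / K : ℕ) : ℝ) / wm K L i := by
    have h3 := Finset.card_nsmul_le_sum (Finset.range n)
      (fun i => ((wm K L i / K : ℕ) : ℝ) / wm K L i) (1 / (2 * K)) ?_
    · simpa using h3
    intro i _
    have hL := L_le_wm K L i
    have h4 := lt_two_mul_div h.one_le_K (h.K_le_L.trans hL)
    have h5 : (0 : ℝ) < wm K L i := by
      exact_mod_cast lt_of_lt_of_le (by have := h.three_le_L; omega) hL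
    have h6 : (0 : ℝ) < K := by exact_mod_cast h.one_le_K
    rw [div_le_div_iff₀ (by positivity) h5]
    have h7 : (wm K L i : ℝ) < 2 * K * (wm K L i / K : ℕ) := by exact_mod_cast h4
    linarith
  have h6 : (0 : ℝ) < K := by exact_mod_cast h.one_le_K
  have h7 : (n : ℝ) ≤ 12 * (K * l) := by
    have := h2.trans h1
    rw [mul_one_div, div_le_iff₀ (by positivity)] at this
    linarith
  exact_mod_cast h7

/-- The bound for the time that the windows take altogether: `l` for the Euclidean algorithm in
each window, and a multiple of the number of candidates. -/
theorem sum_window_cost_le {N K l L A : ℕ} (h : Par N K l L) (hA : A ≤ 2 * N) (n : ℕ)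
    (hm : ∀ i < n, wm K L i * wm K L i < A + L) :
    ∑ i ∈ Finset.range n, (l + L * (wm K L i / K) / wm K L i +
      wm K L i / K / qmin (wm K L i) (A / wm K L i + 1) (wm K L i / K)) ≤ 108 * (L * l) := by
  have h1 := sum_div_qmin_le h hA n hm
  have h2 := sum_div_wm_le h hA n hm
  have h3 := number_windows_le h hA n hm
  have hL := h.L_le
  have h4 := h.log_le (x := 6 * L) (by have := h.three_le_L; omega) (by omega)
  push_cast at h4
  have h0 : 0 ≤ Real.log (6 * L) := by
    have := Real.log_natCast_nonneg (6 * L)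
    exact_mod_cast this
  have h5 : 2 * (K : ℝ) * (1 + Real.log (6 * L)) ^ 2 + 24 * L * (1 + Real.log (6 * L)) ≤
      90 * ((L : ℝ) * l) := by
    have hLe : (L : ℝ) = K * l := by exact_mod_cast h.L_eq
    calc 2 * (K : ℝ) * (1 + Real.log (6 * L)) ^ 2 + 24 * L * (1 + Real.log (6 * L))
        ≤ 2 * (K : ℝ) * (3 * (l : ℝ)) ^ 2 + 24 * (L : ℝ) * (3 * (l : ℝ)) := by gcongr
      _ = 90 * ((L : ℝ) * l) := by rw [hLe]; ring
  have h6 : ∑ i ∈ Finset.range n, ((L * (wm K L i / K) / wm K L i : ℕ) : ℝ) ≤ 6 * (L * l) := by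
    calc ∑ i ∈ Finset.range n, ((L * (wm K L i / K) / wm K L i : ℕ) : ℝ)
        ≤ ∑ i ∈ Finset.range n, L * (((wm K L i / K : ℕ) : ℝ) / wm K L i) := by
          refine Finset.sum_le_sum fun i _ => Nat.cast_div_le.trans (le_of_eq ?_)
          push_cast; ring
      _ ≤ L * (6 * l) := by rw [← Finset.mul_sum]; gcongr
      _ = _ := by ring
  have h7 : (n : ℝ) * l ≤ 12 * (L * l) := by
    have : n * l ≤ 12 * (L * l) := by rw [h.L_eq, ← mul_assoc]; exact Nat.mul_le_mul_right _ h3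
    exact_mod_cast this
  have h8 : ((∑ i ∈ Finset.range n, (l + L * (wm K L i / K) / wm K L i +
      wm K L i / K / qmin (wm K L i) (A / wm K L i + 1) (wm K L i / K)) : ℕ) : ℝ) ≤
      ((108 * (L * l) : ℕ) : ℝ) := by
    push_cast [Finset.sum_add_distrib]
    simp only [Finset.sum_const, Finset.card_range, nsmul_eq_mul]
    linarith
  exact_mod_cast h8

/-! ### Symbolic execution -/

section symbolic
variable {V : Env} {Q : Post} {σ : St} {t : ℕ}

@[simp] theorem wp_skip : wp V .skip Q σ t = Q σ t := rfl

@[simp] theorem wp_op (i : Op) : wp V (.op i) Q σ t = (i.safe V σ ∧ Q (i.eval σ) (t + 1)) := rfl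

@[simp] theorem wp_seq_eq (s₁ s₂ : Stmt) : wp V (s₁ ;; s₂) Q = wp V s₁ (wp V s₂ Q) := rfl

@[simp] theorem wp_ite (a b : Reg) (s₁ s₂ : Stmt) : wp V (.ite a b s₁ s₂) Q σ t =
    if σ.r a < σ.r b then wp V s₁ Q σ (t + 1)
    else wp V s₂ (fun σ' t' => Q σ' (t' + 1)) σ (t + 1) := rfl

attribute [simp] Op.eval Op.safe ArithOp.eval

end symbolic

/-! ### The registers during the treatment of a segment -/

/-- The registers that are fixed while a segment is treated. -/
def ctxRegs : List Reg := [.zero, .one, .two, .l, .K, .L, .W5, .cap, .A, .E, .Bc, .Bb, .Bn, .Bs, .hi]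

/-- The contents of the registers that are fixed while the segment `[A, A + L)` is treated.

The register `Bc` points to the `L` cells for the marks of the numbers of the segment or for their
cofactors. The next `L` cells, at `Bb`, are for large divisors of these numbers. The factorizations
are recorded for blocks of `K` numbers: the `K` cells at `Bn` are for the lengths of the lists, and
the lists themselves, with `cap = 4 * l` cells for each, are at `Bs`. -/
structure Ctx (K l L A : ℕ) (σ : St) : Prop where
  hzero : σ.r .zero = 0
  hone : σ.r .one = 1
  htwo : σ.r .two = 2
  hl : σ.r .l = l
  hK : σ.r .K = K
  hL : σ.r .L = L
  hW5 : σ.r .W5 = 5 * L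
  hcap : σ.r .cap = 4 * l
  hA : σ.r .A = A
  hE : σ.r .E = A + L
  hBc : σ.r .Bc = base
  hBb : σ.r .Bb = base + L
  hBn : σ.r .Bn = base + 2 * L
  hBs : σ.r .Bs = base + 2 * L + K

theorem Ctx.of_eq {K l L A : ℕ} {σ σ' : St} (h : Ctx K l L A σ)
    (h' : ∀ x ∈ ctxRegs, σ'.r x = σ.r x) : Ctx K l L A σ' := by
  simp only [ctxRegs, List.forall_mem_cons, List.not_mem_nil, false_implies, implies_true,
    and_true] at h'
  obtain ⟨h1, h2, h3, h4, h5, h6, h7, h8, h9, h10, h11, h12, h13, h14, -⟩ := h'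
  constructor
  · rw [h1, h.hzero]
  · rw [h2, h.hone]
  · rw [h3, h.htwo]
  · rw [h4, h.hl]
  · rw [h5, h.hK]
  · rw [h6, h.hL]
  · rw [h7, h.hW5]
  · rw [h8, h.hcap]
  · rw [h9, h.hA]
  · rw [h10, h.hE]
  · rw [h11, h.hBc]
  · rw [h12, h.hBb]
  · rw [h13, h.hBn]
  · rw [h14, h.hBs]

/-- The program does not change the registers in `ctxRegs`. -/
abbrev Stmt.Keeps (s : Stmt) : Prop := ∀ x ∈ ctxRegs, s.wr x = false

theorem Ctx.frame {K l L A : ℕ} {σ σ' : St} {s : Stmt} (h : Ctx K l L A σ) (hf : Frame s σ σ')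
    (hs : s.Keeps) : Ctx K l L A σ' :=
  h.of_eq fun x hx => hf.reg x (hs x hx)

/-! ### The Euclidean algorithm -/

open Stmt in
/-- Find a good approximation of `k / m` with a denominator `q1 ≤ R`. -/
def euclid : Stmt :=
  cst .q0 0 ;; add .d0 .m .zero ;; cst .q1 1 ;; mod .d1 .k .m ;; cst .go 1 ;;
  loop .zero .go
    (cst .go 0 ;;
     ite .zero .d1
      (div .c .d0 .d1 ;; mul .q2 .c .q1 ;; add .q2 .q2 .q0 ;;
       ite .R .q2 skip
        (mul .t .c .d1 ;; sub .t .d0 .t ;; add .d0 .d1 .zero ;; add .d1 .t .zero ;;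
         add .q0 .q1 .zero ;; add .q1 .q2 .zero ;; cst .go 1))
      skip)

theorem euclid_spec {V : Env} {K l L A N m R k t : ℕ} {σ : St} (h : Par N K l L)
    (hW : 1000 * N ≤ V.W) (hc : Ctx K l L A σ) (hA : A ≤ 2 * N) (hm : σ.r .m = m)
    (hR : σ.r .R = R) (hk : σ.r .k = k) (hmm : m * m < A + L) (hm0 : 0 < m) (hR1 : 1 ≤ R)
    (hRm : R ≤ m) :
    wp V euclid (fun σ' t' => ∃ q₀ q₁ d₀ d₁, σ'.r .q0 = q₀ ∧ σ'.r .q1 = q₁ ∧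
      EuclidInv m k q₀ q₁ d₀ d₁ ∧ 1 ≤ q₁ ∧ q₁ ≤ R ∧ q₀ ≤ q₁ ∧ R * d₁ < m ∧
      t' ≤ t + 100 * l) σ t := by
  have hN := h.two_le
  have hL8 := h.L_le
  have hl := h.three_le_l
  have hmW : m ≤ 10 * N := by have := Nat.le_mul_self m; omega
  have hlog : ∀ i q₀ q₁, q₀ ≤ R → q₁ ≤ R → (i = 0 ∨ 2 ^ i ≤ 2 * (q₀ * q₁)) → i ≤ l + 4 := by
    intro i q₀ q₁ h0 h1 hi
    rcases hi with rfl | hi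
    · omega
    have h2 : q₀ * q₁ ≤ m * m := Nat.mul_le_mul (h0.trans hRm) (h1.trans hRm)
    have h3 : 2 ^ i < 2 ^ (l + 4) := by
      have h4 := h.lt_pow
      have h5 : l + 4 = (l - 1) + 5 := by omega
      rw [h5, pow_add]
      omega
    exact ((Nat.pow_lt_pow_iff_right (by norm_num)).1 h3).le
  simp only [euclid, wp_seq_eq, wp_op, Op.safe, Op.eval, ArithOp.eval, St.set_r, reduceCtorEq,
    if_false, hm, hk, hc.hzero, true_and, Nat.add_zero]
  refine ⟨by omega, by omega, by omega, by omega, ?_⟩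
  refine wp_loop (fun τ t' => ∃ i q₀ q₁ d₀ d₁, τ.r .q0 = q₀ ∧ τ.r .q1 = q₁ ∧ τ.r .d0 = d₀ ∧
      τ.r .d1 = d₁ ∧ EuclidInv m k q₀ q₁ d₀ d₁ ∧ 1 ≤ q₁ ∧ q₁ ≤ R ∧ q₀ ≤ q₁ ∧ d₁ < d₀ ∧
      (i = 0 ∨ 2 ^ i ≤ 2 * (q₀ * q₁)) ∧
      ((τ.r .go = 1 ∧ t' ≤ t + 5 + 20 * i) ∨ (τ.r .go = 0 ∧ R * d₁ < m ∧ t' ≤ t + 25 + 20 * i)))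
    (fun τ => τ.r .d1 + τ.r .go) ?_ ?_ ?_
  · exact ⟨0, 0, 1, m, k % m, by simp, by simp, by simp, by simp, .init m k, le_rfl, hR1, by simp,
      Nat.mod_lt _ hm0, .inl rfl, .inl ⟨by simp, by omega⟩⟩
  · rintro τ t' hf ⟨i, q₀, q₁, d₀, d₁, e0, e1, e2, e3, hI, h1, h2, h3, h4, h5, h6⟩ hgo
    have hzero : τ.r .zero = 0 := by rw [hf.reg .zero rfl]; simp [hc.hzero]
    have hRr : τ.r .R = R := by rw [hf.reg .R rfl]; simp [hR]
    rw [hzero] at hgo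
    obtain ⟨hg, ht⟩ := h6.resolve_right (by omega)
    simp only [wp_seq_eq, wp_op, wp_ite, wp_skip, Op.safe, Op.eval, ArithOp.eval, St.set_r,
      reduceCtorEq, if_false, if_true, e0, e1, e2, e3, hzero, hRr, hg, true_and, Nat.add_zero]
    refine ⟨by omega, ?_⟩
    split_ifs with hd hq
    · have hc1 : d₀ / d₁ * q₁ ≤ q₁ * d₀ := by
        rw [mul_comm]; exact Nat.mul_le_mul_left _ (Nat.div_le_self _ _)
      have hc2 : q₀ ≤ q₀ * d₁ := Nat.le_mul_of_pos_right _ hd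
      have hc3 := hI.1
      refine ⟨by omega, by omega, ⟨i, q₀, q₁, d₀, d₁, by simp, by simp, by simp, by simp, hI, h1, h2, h3, h4, h5, .inr ⟨?_, by omega⟩⟩, by omega⟩
      exact hI.error_lt hm0 (.inr hq)
    · have hc1 : d₀ / d₁ * q₁ ≤ q₁ * d₀ := by
        rw [mul_comm]; exact Nat.mul_le_mul_left _ (Nat.div_le_self _ _)
      have hc2 : q₀ ≤ q₀ * d₁ := Nat.le_mul_of_pos_right _ hd
      have hc3 := hI.1
      have hc4 : d₀ / d₁ * d₁ ≤ d₀ := Nat.div_mul_le_self _ _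
      have hc5 : d₀ ≤ q₁ * d₀ := Nat.le_mul_of_pos_left _ h1
      have hc6 : d₀ - d₀ / d₁ * d₁ < d₁ := by
        have := Nat.lt_div_mul_add (a := d₀) hd
        omega
      have hc7 : 1 ≤ d₀ / d₁ := Nat.div_pos h4.le hd
      have hc8 : q₁ ≤ d₀ / d₁ * q₁ := Nat.le_mul_of_pos_left _ hc7
      refine ⟨by omega, by omega, by omega, by omega, by omega, by omega, by omega, by omega,
        ⟨i + 1, q₁, d₀ / d₁ * q₁ + q₀, d₁, d₀ - d₀ / d₁ * d₁, by simp, by simp, by simp, by simp,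
        hI.next, by omega, by omega, by omega, hc6, .inr ?_, .inl (by omega)⟩, by omega⟩
      have hc9 : 2 * (q₁ * q₀) ≤ q₁ * (d₀ / d₁ * q₁ + q₀) := by
        have : q₁ * (2 * q₀) ≤ q₁ * (d₀ / d₁ * q₁ + q₀) := Nat.mul_le_mul_left _ (by omega)
        linarith
      rcases h5 with rfl | h5
      · have : 1 ≤ q₁ * (d₀ / d₁ * q₁ + q₀) := Nat.mul_pos h1 (by omega)
        omega
      · rw [pow_succ]
        have : q₀ * q₁ = q₁ * q₀ := mul_comm _ _
        omega
    · refine ⟨⟨i, q₀, q₁, d₀, d₁, by simp, by simp, by simp, by simp, hI, h1, h2, h3, h4, h5, .inr ⟨?_, by omega⟩⟩, by omega⟩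
      exact hI.error_lt hm0 (.inl (by omega))
  · rintro τ t' hf ⟨i, q₀, q₁, d₀, d₁, e0, e1, e2, e3, hI, h1, h2, h3, h4, h5, h6⟩ hgo
    have hzero : τ.r .zero = 0 := by rw [hf.reg .zero rfl]; simp [hc.hzero]
    rw [hzero] at hgo
    have hi := hlog i q₀ q₁ (by omega) h2 h5
    obtain ⟨-, h7, h8⟩ := h6.resolve_left (by omega)
    exact ⟨q₀, q₁, d₀, d₁, e0, e1, hI, h1, h2, h3, h7, by omega⟩

/-! ### Sieving by the large divisors -/

/-- The least multiple of `d` that is at least `a`. -/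
def firstMul (a d : ℕ) : ℕ := (a + d - 1) / d * d

theorem dvd_firstMul (a d : ℕ) : d ∣ firstMul a d := Nat.dvd_mul_left _ _

theorem le_firstMul {a d : ℕ} (hd : 0 < d) : a ≤ firstMul a d := by
  have := Nat.lt_div_mul_add (a := a + d - 1) hd
  unfold firstMul; omega

theorem firstMul_lt {a d : ℕ} (hd : 0 < d) : firstMul a d < a + d := by
  have := Nat.div_mul_le_self (a + d - 1) d
  unfold firstMul; omega

theorem firstMul_le {a d x : ℕ} (hd : 0 < d) (hx : d ∣ x) (h : a ≤ x) : firstMul a d ≤ x := by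
  obtain ⟨k, rfl⟩ := hx
  unfold firstMul
  rw [mul_comm d k]
  refine Nat.mul_le_mul_right _ (Nat.lt_succ_iff.1 ((Nat.div_lt_iff_lt_mul hd).2 ?_))
  rw [Nat.succ_mul, mul_comm k d]; omega

/-- `h'` has the properties `Done d x` that `h` has. -/
def Ext (Done : ℕ → ℕ → (ℕ → ℕ) → Prop) (h h' : ℕ → ℕ) : Prop := ∀ d x, Done d x h → Done d x h'

/-- The specification of the program `visit` that is executed for a divisor `d` of a number `x`
of the segment: it preserves the property `Inv` of the heap, achieves `Done d x`, and destroys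
nothing that has been achieved for other pairs. -/
structure VisitSpec (V : Env) (K l L A : ℕ) (visit : Stmt) (Inv : (ℕ → ℕ) → Prop)
    (Done : ℕ → ℕ → (ℕ → ℕ) → Prop) : Prop where
  wr : ∀ y, y ≠ .p → y ≠ .f → visit.wr y = false
  run : ∀ σ t d x, Ctx K l L A σ → σ.r .d = d → σ.r .x = x → L ≤ d → d * d ≤ 4 * (A + L) →
    d ∣ x → A ≤ x → x < A + L → Inv σ.h →
    wp V visit (fun σ' t' => Inv σ'.h ∧ Done d x σ'.h ∧ Ext Done σ.h σ'.h ∧ t' ≤ t + 12) σ t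

open Stmt in
/-- Try the divisors `m + r` for `r = r₀, r₀ + q₁, r₀ + 2 * q₁, …` below `R`. -/
def sweep (visit : Stmt) : Stmt :=
  loop .r .R
    (add .d .m .r ;; add .x .A .d ;; sub .x .x .one ;; div .x .x .d ;; mul .x .x .d ;;
     ite .x .E visit skip ;;
     add .r .r .q1)

theorem sweep_wr {visit : Stmt} (hv : ∀ y, y ≠ .p → y ≠ .f → visit.wr y = false) (y : Reg)
    (h : [Reg.d, .x, .r, .p, .f].all (fun z => decide (z ≠ y)) = true) :
    (sweep visit).wr y = false := by
  simp only [List.all_cons, List.all_nil, Bool.and_true, Bool.and_eq_true, decide_eq_true_eq] at h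
  obtain ⟨h1, h2, h3, h4, h5⟩ := h
  simp [sweep, Stmt.wr, hv y h4.symm h5.symm, h1.symm, h2.symm, h3.symm]

theorem sweep_spec {V : Env} {K l L A N m R q r₀ t : ℕ} {σ : St} {visit : Stmt}
    {Inv : (ℕ → ℕ) → Prop} {Done : ℕ → ℕ → (ℕ → ℕ) → Prop} (h : Par N K l L)
    (hW : 1000 * N ≤ V.W) (hv : VisitSpec V K l L A visit Inv Done) (hc : Ctx K l L A σ)
    (hA : A ≤ 2 * N) (hm : σ.r .m = m) (hR : σ.r .R = R) (hq : σ.r .q1 = q) (hr : σ.r .r = r₀)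
    (hmm : m * m < A + L) (hLm : L ≤ m) (hRm : R ≤ m) (hq1 : 1 ≤ q) (hqR : q ≤ R)
    (hI : Inv σ.h) :
    wp V (sweep visit) (fun σ' t' => Inv σ'.h ∧ Ext Done σ.h σ'.h ∧
      (∀ i x, r₀ + i * q < R → m + (r₀ + i * q) ∣ x → A ≤ x → x < A + L →
        Done (m + (r₀ + i * q)) x σ'.h) ∧ t' ≤ t + 24 * (R / q + 1) + 2) σ t := by
  have hN := h.two_le
  have hL8 := h.L_le
  have hL3 := h.three_le_L
  have hmW : m ≤ 10 * N := by have := Nat.le_mul_self m; omega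
  refine wp_loop (fun τ t' => Inv τ.h ∧ Ext Done σ.h τ.h ∧ ∃ n, τ.r .r = r₀ + n * q ∧
      t' ≤ t + 24 * n ∧ (∀ i < n, r₀ + i * q < R) ∧
      (∀ i < n, ∀ x, m + (r₀ + i * q) ∣ x → A ≤ x → x < A + L → Done (m + (r₀ + i * q)) x τ.h))
    (fun τ => R - τ.r .r) ?_ ?_ ?_
  · exact ⟨hI, fun _ _ h => h, 0, by simp [hr], by omega, by simp, by simp⟩
  · rintro τ t' hf ⟨h1, h2, n, h3, h4, h5, h6⟩ hlt
    have hwr : ∀ y, [Reg.d, .x, .r, .p, .f].all (fun z => decide (z ≠ y)) = true →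
        τ.r y = σ.r y := fun y hy => hf.reg y (sweep_wr hv.wr y hy)
    have hcτ : Ctx K l L A τ := hc.of_eq fun x hx => hwr x (by revert x; decide)
    have em : τ.r .m = m := by rw [hwr .m rfl, hm]
    have eR : τ.r .R = R := by rw [hwr .R rfl, hR]
    have eq : τ.r .q1 = q := by rw [hwr .q1 rfl, hq]
    rw [eR, h3] at hlt
    set r := r₀ + n * q with hrdef
    have hd0 : 0 < m + r := by omega
    have hx2 := firstMul_lt (a := A) hd0
    have hx1 := le_firstMul (a := A) hd0
    have hdiv : (A + (m + r) - 1) / (m + r) * (m + r) = firstMul A (m + r) := rfl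
    have hnext : r₀ + (n + 1) * q = r + q := by rw [hrdef]; ring
    have h5' : ∀ i < n + 1, r₀ + i * q < R := by
      intro i hi
      rcases Nat.lt_succ_iff_lt_or_eq.1 hi with hi | rfl
      · exact h5 i hi
      · exact hlt
    simp only [wp_seq_eq, wp_op, wp_ite, wp_skip, Op.safe, Op.eval, ArithOp.eval, St.set_r,
      reduceCtorEq, if_false, if_true, em, h3, hcτ.hA, hcτ.hone, hcτ.hE, true_and]
    rw [hdiv]
    refine ⟨by omega, by omega, by omega, ?_⟩
    split_ifs with hxE
    · have hdd : (m + r) * (m + r) ≤ 4 * (A + L) := by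
        have : (m + r) * (m + r) ≤ (2 * m) * (2 * m) := Nat.mul_le_mul (by omega) (by omega)
        have e : (2 * m) * (2 * m) = 4 * (m * m) := by ring
        omega
      refine wp_conseq (wp_frame (hv.run _ _ (m + r) (firstMul A (m + r)) ?_ (by simp) (by simp)
        (by omega) hdd (dvd_firstMul _ _) hx1 hxE h1)) ?_
      · exact hcτ.of_eq (by simp [ctxRegs])
      · rintro τ' t'' ⟨⟨g1, g2, g3, g4⟩, gf⟩
        have er : τ'.r .r = r := by rw [gf.reg .r (hv.wr _ (by simp) (by simp))]; simp [h3]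
        have eq' : τ'.r .q1 = q := by rw [gf.reg .q1 (hv.wr _ (by simp) (by simp))]; simp [eq]
        simp only [wp_op, Op.safe, Op.eval, ArithOp.eval, St.set_r, St.set_h, if_true, er, eq']
        refine ⟨by omega, ⟨g1, fun d x hd => g3 d x (h2 d x hd), n + 1, by omega, by omega, h5', ?_⟩,
          by omega⟩
        intro i hi x hx hAx hxE'
        rcases Nat.lt_succ_iff_lt_or_eq.1 hi with hi | rfl
        · exact g3 _ _ (h6 i hi x hx hAx hxE')
        · -- the segment contains at most one multiple of `m + r`
          rw [← hrdef] at hx ⊢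
          have hle := firstMul_le hd0 hx hAx
          have : x = firstMul A (m + r) := by
            have h7 := (Nat.dvd_sub hx (dvd_firstMul A (m + r)))
            have h8 := Nat.eq_zero_of_dvd_of_lt h7 (by omega)
            omega
          rw [this]; exact g2
    · simp only [eq]
      refine ⟨by omega, ⟨h1, h2, n + 1, by omega, by omega, h5', ?_⟩, by omega⟩
      intro i hi x hx hAx hxE'
      rcases Nat.lt_succ_iff_lt_or_eq.1 hi with hi | rfl
      · exact h6 i hi x hx hAx hxE'
      · rw [← hrdef] at hx
        have hle := firstMul_le hd0 hx hAx
        omega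
  · rintro τ t' hf ⟨h1, h2, n, h3, h4, h5, h6⟩ hlt
    rw [hf.reg .R (sweep_wr hv.wr .R rfl), hR, h3] at hlt
    refine ⟨h1, h2, ?_, ?_⟩
    · intro i x hi
      have : i < n := by
        by_contra hcon
        have : n * q ≤ i * q := Nat.mul_le_mul_right _ (by omega)
        omega
      exact h6 i this x
    · have : n ≤ R / q + 1 := by
        cases n with
        | zero => exact Nat.zero_le _
        | succ n =>
          have := h5 n (by omega)
          have : n ≤ R / q := (Nat.le_div_iff_mul_le hq1).2 (by omega)
          omega
      omega

open Stmt in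
/-- Try the divisors `m + r` with `r < R` and `r` congruent modulo `q1` to `q0 * z` or to
`-q0 * z`, for all `z` between `z` and `ze`. -/
def classes (visit : Stmt) : Stmt :=
  loop .z .ze
    (mul .r .q0 .z ;; mod .r .r .q1 ;; sub .w .q1 .r ;; sweep visit ;;
     add .r .w .zero ;; sweep visit ;; add .z .z .one)

open Stmt in
/-- Try the divisors `d` of numbers of the segment with `m ≤ d < m + R`. -/
def window (visit : Stmt) : Stmt :=
  euclid ;;
  (mul .t .q1 .s ;; div .t .t .m ;; add .z .q1 .q1 ;; sub .z .z .one ;; sub .z .z .t ;;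
   mul .ze .W5 .q1 ;; div .ze .ze .m ;; add .ze .ze .two ;; add .ze .ze .one ;; add .ze .ze .z ;;
   classes visit)

open Stmt in
/-- Visit all pairs `(d, x)` for which `L ≤ d`, `d * d < E`, and `x` is a multiple of `d` in the
segment. -/
def large (visit : Stmt) : Stmt :=
  add .m .L .zero ;; mul .mm .m .m ;;
  loop .mm .E
    (div .R .m .K ;; div .k .A .m ;; add .k .k .one ;; mod .s .A .m ;; sub .s .m .s ;;
     window visit ;;
     (add .m .m .R ;; mul .mm .m .m))

section
variable {V : Env} {K l L A N : ℕ} {visit : Stmt} {Inv : (ℕ → ℕ) → Prop}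
  {Done : ℕ → ℕ → (ℕ → ℕ) → Prop}

theorem classes_wr (hv : ∀ y, y ≠ .p → y ≠ .f → visit.wr y = false) (y : Reg)
    (h : [Reg.z, .w, .d, .x, .r, .p, .f].all (fun z => decide (z ≠ y)) = true) :
    (classes visit).wr y = false := by
  have h' := sweep_wr hv y
  simp only [List.all_cons, List.all_nil, Bool.and_true, Bool.and_eq_true, decide_eq_true_eq]
    at h h'
  obtain ⟨h1, h2, h3, h4, h5, h6, h7⟩ := h
  simp [classes, Stmt.wr, h' ⟨h3, h4, h5, h6, h7⟩, h1.symm, h2.symm, h5.symm]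

theorem classes_spec {m R q₀ q z₀ J t : ℕ} {σ : St} (h : Par N K l L)
    (hW : 1000 * N ≤ V.W) (hv : VisitSpec V K l L A visit Inv Done) (hc : Ctx K l L A σ)
    (hA : A ≤ 2 * N) (hm : σ.r .m = m) (hR : σ.r .R = R) (hq0 : σ.r .q0 = q₀) (hq : σ.r .q1 = q)
    (hz : σ.r .z = z₀) (hze : σ.r .ze = z₀ + J)
    (hmm : m * m < A + L) (hLm : L ≤ m) (hRm : R ≤ m) (hq1 : 1 ≤ q) (hqR : q ≤ R)
    (hqW : q₀ * (z₀ + J) ≤ 500 * N) (hzW : z₀ + J ≤ 500 * N) (hI : Inv σ.h) :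
    wp V (classes visit) (fun σ' t' => Inv σ'.h ∧ Ext Done σ.h σ'.h ∧
      (∀ r < R, (∃ i < J, r ≡ q₀ * (z₀ + i) [MOD q] ∨ r + q₀ * (z₀ + i) ≡ 0 [MOD q]) →
        ∀ x, m + r ∣ x → A ≤ x → x < A + L → Done (m + r) x σ'.h) ∧
      t' ≤ t + J * (48 * (R / q + 1) + 11) + 2) σ t := by
  have hN := h.two_le
  have hL8 := h.L_le
  have hmW : m ≤ 10 * N := by have := Nat.le_mul_self m; omega
  refine wp_loop_count J (fun n τ t' => Inv τ.h ∧ Ext Done σ.h τ.h ∧ τ.r .z = z₀ + n ∧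
      t' ≤ t + n * (48 * (R / q + 1) + 11) ∧
      (∀ r < R, (∃ i < n, r ≡ q₀ * (z₀ + i) [MOD q] ∨ r + q₀ * (z₀ + i) ≡ 0 [MOD q]) →
        ∀ x, m + r ∣ x → A ≤ x → x < A + L → Done (m + r) x τ.h)) ?_ ?_ ?_
  · exact ⟨hI, fun _ _ h => h, by simp [hz], by omega, by simp⟩
  · rintro n hn τ t' hf ⟨h1, h2, h3, h4, h5⟩
    have hwr : ∀ y, [Reg.z, .w, .d, .x, .r, .p, .f].all (fun z => decide (z ≠ y)) = true →
        τ.r y = σ.r y := fun y hy => hf.reg y (classes_wr hv.wr y hy)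
    have hcτ : Ctx K l L A τ := hc.of_eq fun x hx => hwr x (by revert x; decide)
    have em : τ.r .m = m := by rw [hwr .m rfl, hm]
    have eR : τ.r .R = R := by rw [hwr .R rfl, hR]
    have eq0 : τ.r .q0 = q₀ := by rw [hwr .q0 rfl, hq0]
    have eq : τ.r .q1 = q := by rw [hwr .q1 rfl, hq]
    have eze : τ.r .ze = z₀ + J := by rw [hwr .ze rfl, hze]
    have hle : q₀ * (z₀ + n) ≤ q₀ * (z₀ + J) := Nat.mul_le_mul_left _ (by omega)
    refine ⟨by omega, ?_⟩
    rw [wp_seq_eq, wp_seq_eq, wp_seq_eq, wp_seq_eq]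
    simp only [wp_op, Op.safe, Op.eval, ArithOp.eval, St.set_r, reduceCtorEq, if_false, if_true,
      eq0, h3, eq, true_and]
    refine ⟨by omega, ?_⟩
    refine wp_conseq (wp_frame (sweep_spec (r₀ := q₀ * (z₀ + n) % q) h hW hv
      (hcτ.of_eq (by simp [ctxRegs])) hA
      (m := m) (R := R) (q := q) (by simp [em]) (by simp [eR]) (by simp [eq]) (by simp) hmm hLm
      hRm hq1 hqR h1)) ?_
    rintro τ₁ t₁ ⟨⟨g1, g2, g3, g4⟩, gf⟩
    have hwr1 : ∀ y, [Reg.d, .x, .r, .p, .f].all (fun z => decide (z ≠ y)) = true →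
        τ₁.r y = _ := fun y hy => gf.reg y (sweep_wr hv.wr y hy)
    have ew : τ₁.r .w = q - q₀ * (z₀ + n) % q := by rw [hwr1 .w rfl]; simp
    have hc1 : Ctx K l L A τ₁ := (hcτ.of_eq (by simp [ctxRegs])).of_eq
      fun x hx => hwr1 x (by revert x; decide)
    have hmodlt := Nat.mod_lt (q₀ * (z₀ + n)) hq1
    simp only [wp_seq_eq, wp_op, Op.safe, Op.eval, ArithOp.eval, ew, hc1.hzero, Nat.add_zero]
    refine ⟨by omega, ?_⟩
    refine wp_conseq (wp_frame (sweep_spec (r₀ := q - q₀ * (z₀ + n) % q) h hW hv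
      (hc1.of_eq (by simp [ctxRegs])) hA
      (m := m) (R := R) (q := q) (by simp [hwr1 .m rfl, em]) (by simp [hwr1 .R rfl, eR])
      (by simp [hwr1 .q1 rfl, eq]) (by simp) hmm hLm hRm hq1 hqR g1)) ?_
    rintro τ₂ t₂ ⟨⟨f1, f2, f3, f4⟩, ff⟩
    have hwr2 : ∀ y, [Reg.d, .x, .r, .p, .f].all (fun z => decide (z ≠ y)) = true →
        τ₂.r y = _ := fun y hy => ff.reg y (sweep_wr hv.wr y hy)
    have ez : τ₂.r .z = z₀ + n := by rw [hwr2 .z rfl]; simp [hwr1 .z rfl, h3]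
    have eone : τ₂.r .one = 1 := by rw [hwr2 .one rfl]; simp [hc1.hone]
    simp only [wp_op, Op.safe, Op.eval, ArithOp.eval, St.set_r, St.set_h, if_true, ez, eone]
    have e2 : (n + 1) * (48 * (R / q + 1) + 11) =
      n * (48 * (R / q + 1) + 11) + (48 * (R / q + 1) + 11) := by ring
    refine ⟨by omega, f1, fun d x hd => f2 d x (g2 d x (h2 d x hd)), by omega, by omega, ?_⟩
    rintro r hr ⟨i, hi, hir⟩ x hx hAx hxE
    rcases Nat.lt_succ_iff_lt_or_eq.1 hi with hi | rfl
    · exact f2 _ _ (g2 _ _ (h5 r hr ⟨i, hi, hir⟩ x hx hAx hxE))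
    · rcases hir with hir | hir
      · have h6 : q₀ * (z₀ + i) % q + r / q * q = r := by
          rw [← hir]; exact Nat.mod_add_div' r q
        have := g3 (r / q) x
        rw [h6] at this
        exact f2 _ _ (this hr hx hAx hxE)
      · set u := q₀ * (z₀ + i) with hu
        have hdvd : q ∣ r + u % q := by
          rw [← Nat.modEq_zero_iff_dvd]
          exact ((Nat.ModEq.refl r).add (Nat.mod_modEq u q)).trans hir
        rcases Nat.eq_zero_or_pos (u % q) with h0 | h0
        · rw [h0, Nat.add_zero] at hdvd
          have h6 : u % q + r / q * q = r := by rw [h0, zero_add, Nat.div_mul_cancel hdvd]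
          have := g3 (r / q) x
          rw [h6] at this
          exact f2 _ _ (this hr hx hAx hxE)
        · obtain ⟨c, hc'⟩ := hdvd
          obtain ⟨c, rfl⟩ : ∃ c', c = c' + 1 :=
            Nat.exists_eq_succ_of_ne_zero (by rintro rfl; omega)
          have h6 : q - u % q + c * q = r := by
            have : q * (c + 1) = c * q + q := by ring
            omega
          have := f3 c x
          rw [h6] at this
          exact this hr hx hAx hxE
  · rintro τ t' hf ⟨h1, h2, h3, h4, h5⟩
    rw [hf.reg .ze (classes_wr hv.wr .ze rfl), hze, h3]
    exact ⟨by omega, h1, h2, h5, by omega⟩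

/-- The time for the residue classes in a window. -/
theorem candidates_le {m q : ℕ} (R : ℕ) (hm : 0 < m) (hq : 1 ≤ q) (hqR : q ≤ R) :
    (5 * L * q / m + 3) * (48 * (R / q + 1) + 11) ≤ 535 * (L * R / m) + 321 * (R / q) + 535 := by
  have h1 : 1 ≤ R / q := Nat.div_pos hqR hq
  have h2 : 5 * L * q / m * (R / q) ≤ 5 * (L * R / m) + 5 := by
    calc 5 * L * q / m * (R / q) ≤ 5 * L * q * (R / q) / m := by
          rw [mul_comm, mul_comm (5 * L * q)]; exact Nat.mul_div_le_mul_div_assoc _ _ _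
      _ ≤ 5 * (L * R) / m := by
          refine Nat.div_le_div_right ?_
          have := Nat.mul_div_le R q
          calc 5 * L * q * (R / q) = 5 * L * (q * (R / q)) := by ring
            _ ≤ 5 * L * R := Nat.mul_le_mul_left _ this
            _ = _ := by ring
      _ ≤ 5 * (L * R / m) + 5 := by
          have := Nat.lt_div_mul_add (a := L * R) hm
          refine (Nat.div_lt_iff_lt_mul hm).2 ?_ |>.le
          linarith
  have h3 : 48 * (R / q + 1) + 11 ≤ 107 * (R / q) := by omega
  calc (5 * L * q / m + 3) * (48 * (R / q + 1) + 11)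
      ≤ (5 * L * q / m + 3) * (107 * (R / q)) := Nat.mul_le_mul_left _ h3
    _ = 107 * (5 * L * q / m * (R / q)) + 321 * (R / q) := by ring
    _ ≤ _ := by omega

theorem window_wr (hv : ∀ y, y ≠ .p → y ≠ .f → visit.wr y = false) (y : Reg)
    (h : [Reg.z, .w, .d, .x, .r, .p, .f, .q0, .q1, .q2, .d0, .d1, .go, .c, .t, .ze].all
      (fun z => decide (z ≠ y)) = true) :
    (window visit).wr y = false := by
  have h' := classes_wr hv y
  simp only [List.all_cons, List.all_nil, Bool.and_true, Bool.and_eq_true, decide_eq_true_eq]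
    at h h'
  obtain ⟨h1, h2, h3, h4, h5, h6, h7, h8, h9, h10, h11, h12, h13, h14, h15, h16⟩ := h
  simp [window, euclid, Stmt.wr, h' ⟨h1, h2, h3, h4, h5, h6, h7⟩, h1.symm, h8.symm, h9.symm,
    h10.symm, h11.symm, h12.symm, h13.symm, h14.symm, h15.symm, h16.symm]

theorem window_spec {m t : ℕ} {σ : St} (h : Par N K l L)
    (hW : 1000 * N ≤ V.W) (hv : VisitSpec V K l L A visit Inv Done) (hc : Ctx K l L A σ)
    (hA : A ≤ 2 * N) (hm : σ.r .m = m) (hR : σ.r .R = m / K) (hk : σ.r .k = A / m + 1)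
    (hs : σ.r .s = m - A % m) (hmm : m * m < A + L) (hLm : L ≤ m) (hI : Inv σ.h) :
    wp V (window visit) (fun σ' t' => Inv σ'.h ∧ Ext Done σ.h σ'.h ∧
      (∀ r < m / K, ∀ x, m + r ∣ x → A ≤ x → x < A + L → Done (m + r) x σ'.h) ∧
      t' ≤ t + 600 * (l + L * (m / K) / m + m / K / qmin m (A / m + 1) (m / K))) σ t := by
  have hN := h.two_le
  have hL8 := h.L_le
  have hL3 := h.three_le_L
  have hl3 := h.three_le_l
  have hmW : m ≤ 10 * N := by have := Nat.le_mul_self m; omega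
  have hm0 : 0 < m := by omega
  have hRm : m / K ≤ m := Nat.div_le_self _ _
  have hR1 : 1 ≤ m / K := Nat.div_pos (h.K_le_L.trans hLm) h.one_le_K
  rw [window]
  refine wp_seq (euclid_spec h hW hc hA hm hR hk hmm hm0 hR1 hRm) ?_
  rintro τ t₁ ⟨q₀, q, d₀, d₁, e0, e1, hE, hq1, hqR, hq0, hRd, ht1⟩ hf
  have hcτ := hc.frame hf (by decide : euclid.Keeps)
  have em : τ.r .m = m := by rw [hf.reg .m rfl, hm]
  have eR : τ.r .R = m / K := by rw [hf.reg .R rfl, hR]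
  have es : τ.r .s = m - A % m := by rw [hf.reg .s rfl, hs]
  have hqm : q ≤ m := hqR.trans hRm
  have hqqm : q * q ≤ m * m := Nat.mul_le_mul hqm hqm
  set s := m - A % m with hs'
  have hsm : s ≤ m := Nat.sub_le _ _
  have hqs : q * s ≤ m * m := Nat.mul_le_mul hqm hsm
  have h5L : 5 * L * q ≤ 5 * (m * m) := by
    calc 5 * L * q ≤ 5 * m * m := by gcongr
      _ = _ := by ring
  have hJ : 5 * L * q / m ≤ 5 * q := by
    rw [Nat.div_le_iff_le_mul_add_pred hm0]
    calc 5 * L * q ≤ 5 * m * q := by gcongr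
      _ = m * (5 * q) := by ring
      _ ≤ _ := Nat.le_add_right _ _
  simp only [wp_seq_eq, wp_op, Op.safe, Op.eval, ArithOp.eval, St.set_r, reduceCtorEq, if_false,
    if_true, e1, es, em, hcτ.hone, hcτ.htwo, hcτ.hW5, true_and]
  have hcl := candidates_le (L := L) (m / K) hm0 hq1 hqR
  have hcov : ∀ r < m / K, ∀ x, m + r ∣ x → A ≤ x → x < A + L → ∃ i < 5 * L * q / m + 3,
      r ≡ q₀ * (2 * q - 1 - q * s / m + i) [MOD q] ∨
      r + q₀ * (2 * q - 1 - q * s / m + i) ≡ 0 [MOD q] := fun r hr x hx hAx hxE => by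
    obtain ⟨j, y, hjy, hy⟩ := exists_small_residue hL3 h.one_le_K
      (hA.trans (Nat.mul_le_mul_left 2 h.le_sq_mul)) hmm hLm hr hx hAx hxE
    exact hE.exists_class hm0 hq1 hRd hr hsm hjy hy
  have hden := div_le_div_qmin (hE.isDenom hq1 hqR hRd)
  -- natural numbers instead of quotients, for linear arithmetic
  generalize 5 * L * q / m = J' at *
  generalize q * s / m = u at *
  generalize L * (m / K) / m = v at *
  generalize m / K / qmin m (A / m + 1) (m / K) = v' at *
  generalize hv'' : m / K / q = v'' at *
  refine ⟨by omega, by omega, by omega, by omega, by omega, by omega, ?_⟩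
  set J := J' + 3 with hJd
  set z₀ := q + q - 1 - u with hz₀
  have hz₀' : 2 * q - 1 - u = z₀ := by omega
  have hqz : q₀ * (z₀ + J) ≤ 500 * N := by
    have h1 : q₀ * (z₀ + J) ≤ q * (10 * q) := Nat.mul_le_mul hq0 (by omega)
    have h2 : q * (10 * q) = 10 * (q * q) := by ring
    omega
  refine wp_conseq (classes_spec (q₀ := q₀) (z₀ := z₀) (J := J) h hW hv
    (hcτ.of_eq (by simp [ctxRegs])) hA (m := m) (R := m / K) (q := q) (by simp [em])
    (by simp [eR]) (by simp [e0]) (by simp [e1]) (by simp [hz₀])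
    (by simp only [St.set_r, reduceCtorEq, if_true]; omega) hmm hLm hRm hq1 hqR hqz
    (by omega) (by simpa [hf.heap rfl] using hI)) ?_
  rintro τ' t' ⟨g1, g2, g3, g4⟩
  rw [hv''] at g4
  refine ⟨g1, ?_, ?_, ?_⟩
  · simpa [hf.heap rfl] using g2
  · intro r hr x hx hAx hxE
    have := hcov r hr x hx hAx hxE
    rw [hz₀'] at this
    exact g3 r hr this x hx hAx hxE
  · omega

/-- Every pair of a large divisor and a multiple of it in the segment is visited, in time
`O(L * l)`. The windows overshoot the last `d` with `d * d < A + L`, which is harmless. -/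
theorem large_spec {t : ℕ} {σ : St} (h : Par N K l L)
    (hW : 1000 * N ≤ V.W) (hv : VisitSpec V K l L A visit Inv Done) (hc : Ctx K l L A σ)
    (hA : A ≤ 2 * N) (hI : Inv σ.h) :
    wp V (large visit) (fun σ' t' => Inv σ'.h ∧
      (∀ d x, L ≤ d → d * d < A + L → d ∣ x → A ≤ x → x < A + L → Done d x σ'.h) ∧
      t' ≤ t + 70000 * (L * l)) σ t := by
  have hN := h.two_le
  have hL8 := h.L_le
  have hL3 := h.three_le_L
  have hl3 := h.three_le_l
  have hK := h.one_le_K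
  have hLl : L ≤ L * l := Nat.le_mul_of_pos_right _ (by omega)
  have hLW := h.L_sq_le
  have hwr : ∀ y, [Reg.z, .w, .d, .x, .r, .p, .f, .q0, .q1, .q2, .d0, .d1, .go, .c, .t, .ze].all
      (fun z => decide (z ≠ y)) = true → (window visit).wr y = false := window_wr hv.wr
  simp only [large, wp_seq_eq, wp_op, Op.safe, Op.eval, ArithOp.eval, St.set_r,
    if_true, hc.hL, hc.hzero, Nat.add_zero]
  refine ⟨by omega, by omega, ?_⟩
  let cost : ℕ → ℕ := fun j => l + L * (wm K L j / K) / wm K L j +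
    wm K L j / K / qmin (wm K L j) (A / wm K L j + 1) (wm K L j / K)
  refine wp_loop (fun τ t' => Ctx K l L A τ ∧ Inv τ.h ∧ ∃ i, τ.r .m = wm K L i ∧
      τ.r .mm = wm K L i * wm K L i ∧ (∀ j < i, wm K L j * wm K L j < A + L) ∧
      (∀ d x, L ≤ d → d < wm K L i → d ∣ x → A ≤ x → x < A + L → Done d x τ.h) ∧
      t' ≤ t + 2 + 610 * ∑ j ∈ Finset.range i, cost j)
    (fun τ => A + L - τ.r .m) ?_ ?_ ?_
  · exact ⟨hc.of_eq (by simp [ctxRegs]), hI, 0, by simp [wm], by simp [wm], by simp,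
      fun d x h1 h2 => absurd h2 (by simp [wm]; omega), by simp⟩
  · rintro τ t' - ⟨hcτ, hIτ, i, h1, h2, h3, h4, h5⟩ hlt
    have h3' : ∀ j < i + 1, wm K L j * wm K L j < A + L := by
      intro j hj
      rcases Nat.lt_succ_iff_lt_or_eq.1 hj with hj | rfl
      · exact h3 j hj
      · rwa [h2, hcτ.hE] at hlt
    have hLm := L_le_wm K L i
    have hwm : wm K L (i + 1) = wm K L i + wm K L i / K := rfl
    have hcost : cost i = l + L * (wm K L i / K) / wm K L i +
      wm K L i / K / qmin (wm K L i) (A / wm K L i + 1) (wm K L i / K) := rfl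
    have hmm := h3' i (by omega)
    generalize wm K L i = m at *
    have hmself := Nat.le_mul_self m
    have hR1 : 1 ≤ m / K := Nat.div_pos (h.K_le_L.trans hLm) hK
    have hRm : m / K ≤ m := Nat.div_le_self _ _
    have hAm : A / m ≤ A := Nat.div_le_self _ _
    simp only [wp_seq_eq, wp_op, Op.safe, Op.eval, ArithOp.eval, St.set_r, reduceCtorEq, if_false,
      if_true, h1, hcτ.hK, hcτ.hA, hcτ.hone, true_and]
    refine ⟨by omega, ?_⟩
    refine wp_conseq (wp_frame (window_spec (m := m) h hW hv (hcτ.of_eq (by simp [ctxRegs])) hA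
      (by simp [h1]) (by simp) (by simp) (by simp) hmm hLm hIτ)) ?_
    rintro τ₁ t₁ ⟨⟨g1, g2, g3, g4⟩, gf⟩
    have hc1 : Ctx K l L A τ₁ := by
      refine (hcτ.of_eq (by simp [ctxRegs])).of_eq fun x hx => gf.reg x (hwr x ?_)
      revert x; decide
    have em : τ₁.r .m = m := by rw [gf.reg .m (hwr _ rfl)]; simp [h1]
    have eR : τ₁.r .R = m / K := by rw [gf.reg .R (hwr _ rfl)]; simp
    simp only [wp_op, Op.safe, Op.eval, ArithOp.eval, St.set_r, St.set_h, reduceCtorEq, if_false,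
      if_true, em, eR]
    have hsq : (m + m / K) * (m + m / K) ≤ 4 * (m * m) := by
      calc (m + m / K) * (m + m / K) ≤ (2 * m) * (2 * m) := Nat.mul_le_mul (by omega) (by omega)
        _ = _ := by ring
    refine ⟨by omega, by omega, ⟨hc1.of_eq (by simp [ctxRegs]), g1, i + 1, by simp [hwm],
      by simp [hwm], h3', ?_, ?_⟩, by omega⟩
    · intro d x hLd hd hdx hAx hxE
      rw [hwm] at hd
      rcases lt_or_ge d m with hdm | hdm
      · exact g2 _ _ (h4 d x hLd hdm hdx hAx hxE)
      · obtain ⟨r, rfl⟩ := Nat.exists_eq_add_of_le hdm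
        exact g3 r (by omega) x hdx hAx hxE
    · rw [Finset.sum_range_succ, hcost, mul_add]
      generalize L * (m / K) / m = v at *
      generalize m / K / qmin m (A / m + 1) (m / K) = v' at *
      omega
  · rintro τ t' - ⟨hcτ, hIτ, i, h1, h2, h3, h4, h5⟩ hlt
    rw [h2, hcτ.hE] at hlt
    refine ⟨hIτ, fun d x hLd hd => h4 d x hLd ?_, ?_⟩
    · by_contra hcon
      have : wm K L i * wm K L i ≤ d * d := Nat.mul_le_mul (by omega) (by omega)
      omega
    · have := sum_window_cost_le h hA i h3
      have h6 : 610 * ∑ j ∈ Finset.range i, cost j ≤ 610 * (108 * (L * l)) :=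
        Nat.mul_le_mul_left _ this
      omega

end

/-! ### Parameters and segments -/

open Stmt in
/-- Compute the parameters of the sieve: `l` exceeds the number of binary digits of `N` by `1`, and
`K` is the least positive integer with `N ≤ K * K * K * l`; then set up the heap. -/
def prelude : Stmt :=
  (cst .zero 0 ;; cst .one 1 ;; cst .two 2 ;; cst .l 2 ;; add .x .N .zero ;;
    loop .one .x (div .x .x .two ;; add .l .l .one)) ;;
  (cst .K 1 ;; add .y .l .zero ;;
    loop .y .N (add .K .K .one ;; mul .y .K .K ;; mul .y .y .K ;; mul .y .y .l)) ;;
  mul .L .K .l ;; add .W5 .L .L ;; add .W5 .W5 .W5 ;; add .W5 .W5 .L ;;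
  add .cap .l .l ;; add .cap .cap .cap ;;
  cst .Bc base ;; add .Bb .Bc .L ;; add .Bn .Bb .L ;; add .Bs .Bn .K

theorem prelude_spec {V : Env} {N t : ℕ} {σ : St} (hN : 2 ≤ N) (hW : 1000 * N ≤ V.W)
    (hσ : σ.r .N = N) :
    wp V prelude (fun σ' t' => ∃ K l L, Par N K l L ∧
      (∀ A, Ctx K l L A ((σ'.set .A A).set .E (A + L))) ∧ t' ≤ t + 50 * L) σ t := by
  rw [prelude]
  refine wp_seq (Q₁ := fun τ t' => ∃ l, τ.r .l = l ∧ 3 ≤ l ∧ 2 ^ (l - 2) ≤ N ∧ N < 2 ^ (l - 1) ∧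
    τ.r .zero = 0 ∧ τ.r .one = 1 ∧ τ.r .two = 2 ∧ t' ≤ t + 4 * l + 7) ?_ ?_
  · simp only [wp_seq_eq, wp_op, Op.safe, Op.eval, ArithOp.eval, St.set_r, reduceCtorEq,
      if_false, if_true, hσ, Nat.add_zero]
    refine ⟨by omega, by omega, by omega, by omega, by omega, ?_⟩
    refine wp_loop (fun τ t' => ∃ i, τ.r .x = N / 2 ^ i ∧ τ.r .l = i + 2 ∧ 1 ≤ N / 2 ^ i ∧
      t' ≤ t + 5 + 4 * i) (fun τ => τ.r .x) ?_ ?_ ?_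
    · exact ⟨0, by simp, by simp, by simp; omega, by omega⟩
    · rintro τ t' hf ⟨i, h1, h2, h3, h4⟩ hlt
      have e1 : τ.r .one = 1 := by rw [hf.reg .one rfl]; simp
      have e2 : τ.r .two = 2 := by rw [hf.reg .two rfl]; simp
      rw [h1, e1] at hlt
      have hi : i < N := by
        by_contra hcon
        have h5 : N < 2 ^ i := Nat.lt_two_pow_self.trans_le (Nat.pow_le_pow_right (by norm_num) (by omega))
        rw [Nat.div_eq_of_lt h5] at h3
        omega
      simp only [wp_seq_eq, wp_op, Op.safe, Op.eval, ArithOp.eval, St.set_r, reduceCtorEq,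
        if_false, if_true, h1, h2, e1, e2, true_and]
      refine ⟨by omega, ⟨i + 1, ?_, by omega, ?_, by omega⟩, ?_⟩
      · rw [pow_succ, Nat.div_div_eq_div_mul]
      · rw [pow_succ, ← Nat.div_div_eq_div_mul]; omega
      · omega
    · rintro τ t' hf ⟨i, h1, h2, h3, h4⟩ hlt
      have e0 : τ.r .zero = 0 := by rw [hf.reg .zero rfl]; simp
      have e1 : τ.r .one = 1 := by rw [hf.reg .one rfl]; simp
      have e2 : τ.r .two = 2 := by rw [hf.reg .two rfl]; simp
      rw [h1, e1] at hlt
      have h5 : N / 2 ^ i = 1 := by omega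
      have h6 : 2 ^ i ≤ N := by
        by_contra hcon
        rw [Nat.div_eq_of_lt (by omega)] at h5
        omega
      have h7 : N < 2 ^ (i + 1) := by
        have := Nat.lt_div_mul_add (a := N) (b := 2 ^ i) (by positivity)
        rw [h5] at this
        rw [pow_succ]; omega
      have hi : 1 ≤ i := by
        by_contra hcon
        obtain rfl : i = 0 := by omega
        simp at h5; omega
      refine ⟨i + 2, h2, by omega, h6, h7, e0, e1, e2, by omega⟩
  rintro τ t₁ ⟨l, el, hl3, hl1, hl2, e0, e1, e2, ht₁⟩ hf
  have hN' : τ.r .N = N := by rw [hf.reg .N rfl, hσ]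
  have hlN : l ≤ N + 1 := by
    have h1 : l - 2 < 2 ^ (l - 2) := Nat.lt_two_pow_self
    omega
  refine wp_seq (Q₁ := fun τ' t' => ∃ K, τ'.r .K = K ∧ 1 ≤ K ∧ N ≤ K * K * K * l ∧
    K * K * K * l ≤ 8 * N ∧ t' ≤ t₁ + 6 * K + 4) ?_ ?_
  · simp only [wp_seq_eq, wp_op, Op.safe, Op.eval, ArithOp.eval, St.set_r, reduceCtorEq,
      if_false, el, e0, Nat.add_zero]
    refine ⟨by omega, by omega, ?_⟩
    refine wp_loop (fun τ' t' => ∃ K, τ'.r .K = K ∧ 1 ≤ K ∧ τ'.r .y = K * K * K * l ∧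
      K * K * K * l ≤ 8 * N ∧ t' ≤ t₁ + 6 * K) (fun τ' => N - τ'.r .y) ?_ ?_ ?_
    · exact ⟨1, by simp, le_rfl, by simp, by omega, by omega⟩
    · rintro τ' t' hf' ⟨K, h1, h2, h3, h4, h5⟩ hlt
      have e1' : τ'.r .one = 1 := by rw [hf'.reg .one rfl]; simp [e1]
      have el' : τ'.r .l = l := by rw [hf'.reg .l rfl]; simp [el]
      have eN' : τ'.r .N = N := by rw [hf'.reg .N rfl]; simp [hN']
      rw [h3, eN'] at hlt
      have hcube : (K + 1) * (K + 1) * (K + 1) * l ≤ 8 * (K * K * K * l) := by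
        calc (K + 1) * (K + 1) * (K + 1) * l ≤ (2 * K) * (2 * K) * (2 * K) * l := by
              gcongr <;> omega
          _ = _ := by ring
      have hl1' : (K + 1) * (K + 1) * (K + 1) ≤ (K + 1) * (K + 1) * (K + 1) * l :=
        Nat.le_mul_of_pos_right _ (by omega)
      have hl2' : (K + 1) * (K + 1) ≤ (K + 1) * (K + 1) * (K + 1) :=
        Nat.le_mul_of_pos_right _ (by omega)
      have hl3' : K + 1 ≤ (K + 1) * (K + 1) := Nat.le_mul_of_pos_right _ (by omega)
      have hgrow : K * K * K * l < (K + 1) * (K + 1) * (K + 1) * l := by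
        gcongr <;> omega
      simp only [wp_seq_eq, wp_op, Op.safe, Op.eval, ArithOp.eval, St.set_r, reduceCtorEq,
        if_false, if_true, h1, h3, e1', el']
      refine ⟨by omega, by omega, by omega, by omega, ⟨K + 1, rfl, by omega, rfl, by omega, by omega⟩,
        by omega⟩
    · rintro τ' t' hf' ⟨K, h1, h2, h3, h4, h5⟩ hlt
      rw [h3, hf'.reg .N rfl] at hlt
      simp only [St.set_r, reduceCtorEq, if_false, hN', not_lt] at hlt
      exact ⟨K, h1, h2, hlt, h4, by omega⟩
  rintro τ' t₂ ⟨K, eK, hK1, hK2, hK3, ht₂⟩ hf'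
  have hPar : Par N K l (K * l) := ⟨hN, hl3, hK1, rfl, hK2, hK3, hl1, hl2⟩
  have hL8 := hPar.L_le
  have hKL := hPar.K_le_L
  have hlL := hPar.l_le_L
  have hb := base_eq
  have el' : τ'.r .l = l := by rw [hf'.reg .l rfl, el]
  have e0' : τ'.r .zero = 0 := by rw [hf'.reg .zero rfl, e0]
  have e1' : τ'.r .one = 1 := by rw [hf'.reg .one rfl, e1]
  have e2' : τ'.r .two = 2 := by rw [hf'.reg .two rfl, e2]
  simp only [wp_seq_eq, wp_op, Op.safe, Op.eval, ArithOp.eval, St.set_r, reduceCtorEq,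
    if_false, if_true, el', eK]
  refine ⟨by omega, by omega, by omega, by omega, by omega, by omega, by omega, by omega, by omega,
    by omega, ?_⟩
  refine ⟨K, l, K * l, hPar, ?_, by omega⟩
  intro A
  constructor <;> simp [e0', e1', e2', el', eK] <;> omega

/-- The specification of a program for the segment that starts at `A`: it produces the output
`g n` for each `n` in the segment that is less than `hi`. -/
structure SegSpec (V : Env) (N K l L lo hi : ℕ) (body : Stmt) (g : ℕ → List ℕ) (c : ℕ) : Prop where
  keeps : body.Keeps
  run : ∀ A σ t, Ctx K l L A σ → σ.r .hi = hi → lo ≤ A → A ≤ 2 * N → A < hi →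
    wp V body (fun σ' t' => σ'.o = σ.o ++ (List.range' A (min (A + L) hi - A)).flatMap g ∧
      t' ≤ t + c * (L * l)) σ t

open Stmt in
/-- Treat the numbers from `A` to `hi - 1` in segments. -/
def segments (body : Stmt) : Stmt :=
  loop .A .hi (add .E .A .L ;; body ;; add .A .A .L)

theorem segments_spec {V : Env} {N K l L lo hi c t : ℕ} {σ : St} {body : Stmt} {g : ℕ → List ℕ}
    (h : Par N K l L) (hW : 1000 * N ≤ V.W) (hb : SegSpec V N K l L lo hi body g c)
    (hc : ∀ A, Ctx K l L A ((σ.set .A A).set .E (A + L))) (hlo : σ.r .A = lo)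
    (hhi : σ.r .hi = hi) (hhiN : hi ≤ 2 * N + 1) :
    wp V (segments body) (fun σ' t' => σ'.o = σ.o ++ (List.range' lo (hi - lo)).flatMap g ∧
      t' ≤ t + (c + 4) * ((hi - lo + L) * l) + 2) σ t := by
  have hN := h.two_le
  have hL8 := h.L_le
  have hL3 := h.three_le_L
  have hl3 := h.three_le_l
  refine wp_loop (fun τ t' => (∀ A, Ctx K l L A ((τ.set .A A).set .E (A + L))) ∧ τ.r .hi = hi ∧
      ∃ i, τ.r .A = lo + i * L ∧
      τ.o = σ.o ++ (List.range' lo (min (lo + i * L) hi - lo)).flatMap g ∧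
      (i = 0 ∨ lo + i * L < hi + L) ∧
      t' ≤ t + (c + 4) * ((i * L) * l)) (fun τ => hi - τ.r .A) ?_ ?_ ?_
  · exact ⟨hc, hhi, 0, by simp [hlo], by simp, .inl rfl, by simp⟩
  · rintro τ t' - ⟨hcτ, ehi, i, h1, h2, -, h3⟩ hlt
    rw [h1, ehi] at hlt
    have hset : ∀ v, (τ.set .E v).r .A = lo + i * L := by simp [h1]
    have hctx : Ctx K l L (lo + i * L) (τ.set .E (lo + i * L + L)) := by
      have := hcτ (lo + i * L)
      refine this.of_eq fun x _ => ?_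
      simp only [St.set_r]
      split_ifs with h1' h2'
      · rfl
      · rw [h2', h1]
      · rfl
    have eL : τ.r .L = L := by have := (hcτ 0).hL; simpa using this
    set A := lo + i * L with hAdef
    simp only [wp_seq_eq, wp_op, Op.safe, Op.eval, ArithOp.eval, h1, eL]
    refine ⟨by omega, ?_⟩
    refine wp_conseq (wp_frame (hb.run A _ _ hctx (by simp [ehi]) (by omega) (by omega) hlt)) ?_
    rintro τ₁ t₁ ⟨⟨g1, g2⟩, gf⟩
    have hc1 := hctx.frame gf hb.keeps
    have ehi1 : τ₁.r .hi = hi := by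
      rw [gf.reg .hi (hb.keeps _ (by simp [ctxRegs]))]; simp [ehi]
    have hnext : lo + (i + 1) * L = A + L := by rw [hAdef]; ring
    simp only [wp_op, Op.safe, Op.eval, ArithOp.eval, St.set_r, St.set_o, if_true, reduceCtorEq,
      if_false, hc1.hA, hc1.hL, ehi1]
    refine ⟨by omega, ⟨?_, trivial, i + 1, by omega, ?_, .inr (by omega), ?_⟩, by omega⟩
    · intro A'
      refine Ctx.of_eq (σ := (τ₁.set .A A').set .E (A' + L)) ?_ ?_
      · have h4 : ∀ x ∈ ctxRegs, x ≠ .A → x ≠ .E → τ₁.r x = τ.r x := by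
          intro x hx _ hxE
          rw [gf.reg x (hb.keeps x hx)]
          simp [hxE]
        refine (hcτ A').of_eq fun x hx => ?_
        simp only [St.set_r]
        split_ifs with h5 h6
        · rfl
        · rfl
        · exact h4 x hx h6 h5
      · intro x _
        simp only [St.set_r]
        split_ifs <;> rfl
    · rw [g1, St.set_o, h2, List.append_assoc, ← List.flatMap_append, hnext]
      congr 2
      have e1 : min A hi - lo = A - lo := by omega
      have e2 : min (A + L) hi - lo = (A - lo) + (min (A + L) hi - A) := by omega
      rw [e1, e2, ← List.range'_append_1]
      congr 2
      omega
    · have e : (c + 4) * ((i + 1) * L * l) = (c + 4) * (i * L * l) + c * (L * l) + 4 * (L * l) := by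
        ring
      have : 1 ≤ L * l := Nat.mul_pos (by omega) (by omega)
      omega
  · rintro τ t' - ⟨hcτ, ehi, i, h1, h2, h4, h3⟩ hlt
    rw [h1, ehi] at hlt
    refine ⟨?_, ?_⟩
    · rw [h2]
      congr 4
      omega
    · have h5 : i * L ≤ hi - lo + L := by
        rcases h4 with rfl | h4
        · simp
        · omega
      have : (c + 4) * ((i * L) * l) ≤ (c + 4) * ((hi - lo + L) * l) := by gcongr
      omega

theorem Par.sum_div_le {N K l L : ℕ} (h : Par N K l L) (X : ℕ) :
    ∑ d ∈ Finset.range L, X / d ≤ 3 * (X * l) := by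
  have h1 := h.log_le (x := L) (by have := h.three_le_L; omega) (by have := h.L_le; omega)
  have h2 : ((∑ d ∈ Finset.range L, X / d : ℕ) : ℝ) ≤ ((3 * (X * l) : ℕ) : ℝ) := by
    push_cast
    calc ∑ d ∈ Finset.range L, ((X / d : ℕ) : ℝ) ≤ ∑ d ∈ Finset.range L, (X : ℝ) * (1 / (d : ℝ)) :=
          Finset.sum_le_sum fun d _ => Nat.cast_div_le.trans (by rw [mul_one_div])
      _ ≤ ∑ d ∈ Finset.range (L + 1), (X : ℝ) * (1 / (d : ℝ)) :=
          Finset.sum_le_sum_of_subset_of_nonneg (Finset.range_mono (by omega))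
            fun _ _ _ => by positivity
      _ = X * ∑ d ∈ Finset.Icc 1 L, 1 / (d : ℝ) := by
          rw [← Finset.mul_sum, Finset.range_eq_Ico, Finset.sum_eq_sum_Ico_succ_bot (by omega)]
          simp [Finset.Ico_add_one_right_eq_Icc]
      _ ≤ X * (3 * l) := by gcongr; exact (sum_inv_le L).trans h1
      _ = _ := by ring
  exact_mod_cast h2

/-! ### Sieving for primes -/

open Stmt in
/-- Mark a proper multiple `x` of `d`. -/
def visitP : Stmt := ite .d .x (sub .p .x .A ;; add .p .p .Bc ;; store .p .one) skip

open Stmt in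
/-- Clear the marks. -/
def clearP : Stmt :=
  add .x .Bc .zero ;; add .w .Bc .L ;; loop .x .w (store .x .zero ;; add .x .x .one)

open Stmt in
/-- Mark the proper multiples of the small divisors. -/
def smallP : Stmt :=
  add .d .two .zero ;;
  loop .d .L
    (add .x .A .d ;; sub .x .x .one ;; div .x .x .d ;; ite .x .two (add .x .two .zero) skip ;;
     mul .x .x .d ;;
     loop .x .E (sub .p .x .A ;; add .p .p .Bc ;; store .p .one ;; add .x .x .d) ;;
     add .d .d .one)

open Stmt in
/-- Execute `yes` for the primes of the segment, and `no` for the other numbers. -/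
def outP (yes no : Stmt) : Stmt :=
  add .x .A .zero ;; ite .hi .E (add .ye .hi .zero) (add .ye .E .zero) ;;
  loop .x .ye
    (sub .p .x .A ;; add .p .p .Bc ;; load .f .p ;; ite .f .one (ite .one .x yes no) no ;;
     add .x .x .one)

/-- The treatment of a segment when one sieves for primes. -/
def primesBody (yes no : Stmt) : Stmt := clearP ;; smallP ;; large visitP ;; outP yes no

/-- The state of the marks when the divisors `< D` have been treated. -/
def Flags (A L D : ℕ) (h : ℕ → ℕ) : Prop :=
  ∀ i < L, h (base + i) ≤ 1 ∧ (h (base + i) = 1 → ¬ (A + i).Prime) ∧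
    ∀ d, 2 ≤ d → d < D → d ∣ A + i → d < A + i → h (base + i) = 1

theorem Flags.update {A L D x : ℕ} {h : ℕ → ℕ} (hF : Flags A L D h) (hx : ¬ x.Prime) (hA : A ≤ x) :
    Flags A L D (Function.update h (base + (x - A)) 1) := by
  intro i hi
  by_cases h1 : i = x - A
  · subst h1
    simp [hA, hx]
  · have : base + i ≠ base + (x - A) := by omega
    simp only [Function.update_of_ne this]
    exact hF i hi

/-- The pair `(d, x)` has been treated. -/
def MarkDone (A : ℕ) (d x : ℕ) (h : ℕ → ℕ) : Prop := d < x → h (base + (x - A)) = 1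

section
variable {V : Env} {K l L A N : ℕ}

theorem visitP_spec (h : Par N K l L) (hW : 1000 * N ≤ V.W) (hA : A ≤ 2 * N)
    (hT : base + L ≤ V.T) (hH : 1 ≤ V.H) :
    VisitSpec V K l L A visitP (Flags A L L) (MarkDone A) := by
  refine ⟨?_, ?_⟩
  · intro y h1 h2; simp [visitP, Stmt.wr, h1]
  · intro σ t d x hc hd hx hLd _ hdx hAx hxE hI
    have hb := base_eq
    have hL8 := h.L_le
    have hL3 := h.three_le_L
    have hN := h.two_le
    simp only [visitP, wp_seq_eq, wp_op, wp_ite, wp_skip, Op.safe, Op.eval, ArithOp.eval, St.set_r,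
      reduceCtorEq, if_false, if_true, St.put_h, St.set_h, hd, hx, hc.hA, hc.hBc, hc.hone, true_and]
    rw [add_comm (x - A)]
    split_ifs with hlt
    · refine ⟨by omega, ⟨by omega, by omega, hH⟩, hI.update ?_ hAx, ?_, ?_, by omega⟩
      · exact Nat.not_prime_of_dvd_of_lt hdx (by omega) hlt
      · intro _; simp
      · intro d' x' hd' h'
        simp only [Function.update_apply]
        split_ifs
        · rfl
        · exact hd' h'
    · exact ⟨hI, fun h => absurd h hlt, fun _ _ h => h, by omega⟩

theorem clearP_spec {t : ℕ} {σ : St} (h : Par N K l L) (hW : 1000 * N ≤ V.W)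
    (hc : Ctx K l L A σ) (hT : base + L ≤ V.T) :
    wp V clearP (fun σ' t' => Flags A L 0 σ'.h ∧ t' ≤ t + 4 * L + 4) σ t := by
  have hb := base_eq
  have hL8 := h.L_le
  have hN := h.two_le
  simp only [clearP, wp_seq_eq, wp_op, Op.safe, Op.eval, ArithOp.eval, St.set_r, reduceCtorEq,
    if_false, hc.hBc, hc.hzero, hc.hL, Nat.add_zero]
  refine ⟨by omega, by omega, ?_⟩
  refine wp_loop_count L (fun n τ t' => τ.r .x = base + n ∧ (∀ i < n, τ.h (base + i) = 0) ∧
    t' ≤ t + 2 + 4 * n) ?_ ?_ ?_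
  · exact ⟨by simp, by simp, by omega⟩
  · rintro n hn τ t' hf ⟨h1, h2, h3⟩
    have e0 : τ.r .zero = 0 := by rw [hf.reg .zero rfl]; simp [hc.hzero]
    have e1 : τ.r .one = 1 := by rw [hf.reg .one rfl]; simp [hc.hone]
    have ew : τ.r .w = base + L := by rw [hf.reg .w rfl]; simp
    rw [h1, ew]
    simp only [wp_seq_eq, wp_op, Op.safe, Op.eval, ArithOp.eval, St.set_r, St.put_r, St.put_h,
      St.set_h, if_true, h1, e0, e1]
    refine ⟨by omega, ⟨by omega, by omega, by omega⟩, by omega, by omega, ?_, by omega⟩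
    intro i hi
    simp only [Function.update_apply]
    split_ifs
    · rfl
    · exact h2 i (by omega)
  · rintro τ t' hf ⟨h1, h2, h3⟩
    have ew : τ.r .w = base + L := by rw [hf.reg .w rfl]; simp
    rw [h1, ew]
    refine ⟨by omega, ?_, by omega⟩
    intro i hi
    rw [h2 i hi]
    exact ⟨by omega, by omega, by omega⟩

theorem smallP_spec {t : ℕ} {σ : St} (h : Par N K l L) (hW : 1000 * N ≤ V.W)
    (hc : Ctx K l L A σ) (hA : A ≤ 2 * N) (hT : base + L ≤ V.T) (hH : 1 ≤ V.H)
    (hF : Flags A L 0 σ.h) :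
    wp V smallP (fun σ' t' => Flags A L L σ'.h ∧ t' ≤ t + 50 * (L * l)) σ t := by
  have hb := base_eq
  have hL8 := h.L_le
  have hL3 := h.three_le_L
  have hN := h.two_le
  have hl3 := h.three_le_l
  simp only [smallP, wp_seq_eq, wp_op, Op.safe, Op.eval, ArithOp.eval,
    hc.htwo, hc.hzero, Nat.add_zero]
  refine ⟨by omega, ?_⟩
  refine wp_loop_count (L - 2) (fun n τ t' => τ.r .d = 2 + n ∧ Flags A L (2 + n) τ.h ∧
    t' ≤ t + 1 + ∑ d ∈ Finset.range (2 + n), (22 + 6 * (L / d))) ?_ ?_ ?_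
  · refine ⟨by simp, ?_, by omega⟩
    intro i hi
    exact ⟨(hF i hi).1, (hF i hi).2.1, fun d h1 h2 => by omega⟩
  · rintro n hn τ t' hf ⟨h1, h2, h3⟩
    have hcτ : Ctx K l L A τ := (hc.of_eq (by simp [ctxRegs])).frame hf (by decide)
    set d := 2 + n with hd
    have hdiv : (A + d - 1) / d ≤ A + d - 1 := Nat.div_le_self _ _
    have hmul : (A + d - 1) / d * d ≤ A + d - 1 := Nat.div_mul_le_self _ _
    have hup : ∀ c, c < (A + d - 1) / d → c * d < A := by
      intro c hc
      have h5 : (c + 1) * d ≤ (A + d - 1) / d * d := Nat.mul_le_mul_right _ hc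
      have : (c + 1) * d = c * d + d := by ring
      omega
    have hlow : A ≤ (A + d - 1) / d * d := le_firstMul (by omega)
    -- the first multiple to be marked is `c₀ * d`
    obtain ⟨c₀, hc₀⟩ : ∃ c₀, c₀ = max 2 ((A + d - 1) / d) := ⟨_, rfl⟩
    have hc₀A : A ≤ c₀ * d := hlow.trans (Nat.mul_le_mul_right _ (by omega))
    have hc₀W : c₀ * d ≤ A + 2 * d := by
      rcases le_total 2 ((A + d - 1) / d) with h5 | h5
      · rw [hc₀, max_eq_right h5]; omega
      · rw [hc₀, max_eq_left h5]; omega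
    have key : ∀ τ₀ t₀, Ctx K l L A τ₀ → τ₀.r .d = d → τ₀.h = τ.h → τ₀.r .x = c₀ →
        t₀ ≤ t' + 6 →
        wp V (Stmt.mul .x .x .d ;; .loop .x .E (Stmt.sub .p .x .A ;; Stmt.add .p .p .Bc ;;
          Stmt.store .p .one ;; Stmt.add .x .x .d) ;; Stmt.add .d .d .one)
        (fun τ' t'' => τ'.r .d = 2 + (n + 1) ∧ Flags A L (2 + (n + 1)) τ'.h ∧
          t'' + 1 ≤ t + 1 + ∑ d ∈ Finset.range (2 + (n + 1)), (22 + 6 * (L / d))) τ₀ t₀ := by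
      intro τ₀ t₀ hcc ed eh ex ht₀
      simp only [wp_seq_eq, wp_op, Op.safe, Op.eval, ArithOp.eval, ed, ex]
      refine ⟨by omega, ?_⟩
      refine wp_loop (fun τ' t'' => ∃ k, τ'.r .x = (c₀ + k) * d ∧ Flags A L d τ'.h ∧
        (∀ j < k, (c₀ + j) * d < A + L ∧ τ'.h (base + ((c₀ + j) * d - A)) = 1) ∧
        t'' ≤ t' + 7 + 6 * k) (fun τ' => A + L - τ'.r .x) ?_ ?_ ?_
      · exact ⟨0, by simp, by simpa [eh] using h2, by simp, by omega⟩
      · rintro τ₁ t₁ hf₁ ⟨k, g1, g2, g3, g4⟩ hlt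
        have hc1 : Ctx K l L A τ₁ := (hcc.of_eq (by simp [ctxRegs])).frame hf₁ (by decide)
        have ed1 : τ₁.r .d = d := by rw [hf₁.reg .d rfl]; simp [ed]
        rw [g1, hc1.hE] at hlt
        have hle : c₀ * d ≤ (c₀ + k) * d := Nat.mul_le_mul_right _ (by omega)
        have hnext : (c₀ + (k + 1)) * d = (c₀ + k) * d + d := by ring
        simp only [wp_seq_eq, wp_op, Op.safe, Op.eval, ArithOp.eval, St.set_r, St.put_r, St.put_h,
          St.set_h, reduceCtorEq, if_false, if_true, g1, ed1, hc1.hA, hc1.hBc, hc1.hone]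
        rw [add_comm _ base]
        refine ⟨trivial, by omega, ⟨by omega, by omega, hH⟩, by omega, ⟨k + 1, by omega, ?_, ?_,
          by omega⟩, by omega⟩
        · exact g2.update (Nat.not_prime_mul (by omega) (by omega)) (by omega)
        · intro j hj
          simp only [Function.update_apply]
          rcases Nat.lt_succ_iff_lt_or_eq.1 hj with hj | rfl
          · refine ⟨(g3 j hj).1, ?_⟩
            split_ifs
            · rfl
            · exact (g3 j hj).2
          · exact ⟨hlt, if_pos rfl⟩
      · rintro τ₁ t₁ hf₁ ⟨k, g1, g2, g3, g4⟩ hlt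
        have hc1 : Ctx K l L A τ₁ := (hcc.of_eq (by simp [ctxRegs])).frame hf₁ (by decide)
        have ed1 : τ₁.r .d = d := by rw [hf₁.reg .d rfl]; simp [ed]
        rw [g1, hc1.hE] at hlt
        simp only [wp_op, Op.safe, Op.eval, ArithOp.eval, St.set_r, St.set_h, if_true, ed1, hc1.hone]
        refine ⟨by omega, by omega, ?_, ?_⟩
        · intro i hi
          refine ⟨(g2 i hi).1, (g2 i hi).2.1, fun d' h5 h6 h7 h8 => ?_⟩
          rcases Nat.lt_or_ge d' d with h9 | h9
          · exact (g2 i hi).2.2 d' h5 h9 h7 h8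
          · rw [show d' = d by omega] at h7
            obtain ⟨c, hc'⟩ := h7
            have hcc0 : c₀ ≤ c := by
              rw [hc₀, max_le_iff]
              constructor
              · by_contra hcon
                have : d * c ≤ d * 1 := Nat.mul_le_mul_left _ (by omega)
                omega
              · by_contra hcon
                have := hup c (by omega)
                have e : c * d = d * c := mul_comm _ _
                omega
            obtain ⟨j, rfl⟩ := Nat.exists_eq_add_of_le hcc0
            have hj : j < k := by
              by_contra hcon
              have : (c₀ + k) * d ≤ (c₀ + j) * d := Nat.mul_le_mul_right _ (by omega)
              have e : (c₀ + j) * d = d * (c₀ + j) := mul_comm _ _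
              omega
            have := (g3 j hj).2
            rwa [mul_comm, ← hc', Nat.add_sub_cancel_left] at this
        · have hk : k ≤ L / d + 1 := by
            cases k with
            | zero => exact Nat.zero_le _
            | succ k =>
              have h5 := (g3 k (by omega)).1
              have e : (c₀ + k) * d = c₀ * d + k * d := by ring
              have : k ≤ L / d := (Nat.le_div_iff_mul_le (by omega)).2 (by omega)
              omega
          rw [← add_assoc, ← hd, Finset.sum_range_succ]
          generalize L / d = u at *
          omega
    refine ⟨by rw [h1, hcτ.hL]; omega, ?_⟩
    generalize (Stmt.mul .x .x .d ;; _) = rest at key ⊢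
    simp only [wp_seq_eq, wp_op, wp_ite, wp_skip, Op.safe, Op.eval, ArithOp.eval, St.set_r,
      reduceCtorEq, if_false, if_true, h1, hcτ.hA, hcτ.hone, hcτ.htwo, hcτ.hzero, true_and]
    refine ⟨by omega, ?_⟩
    split_ifs with h5
    · refine ⟨by omega, key _ _ (hcτ.of_eq (by simp [ctxRegs])) (by simp [h1]) rfl ?_ (by omega)⟩
      simp only [St.set_r, if_true]; omega
    · refine key _ _ (hcτ.of_eq (by simp [ctxRegs])) (by simp [h1]) rfl ?_ (by omega)
      simp only [St.set_r, if_true]; omega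
  · rintro τ t' hf ⟨h1, h2, h3⟩
    rw [hf.reg .L rfl, h1]
    have e : 2 + (L - 2) = L := by omega
    rw [e] at h2 h3 ⊢
    refine ⟨by simp [hc.hL], h2, ?_⟩
    have h4 := h.sum_div_le L
    have h5 : L * 3 ≤ L * l := Nat.mul_le_mul_left _ hl3
    rw [Finset.sum_add_distrib, ← Finset.mul_sum] at h3
    simp only [Finset.sum_const, Finset.card_range, smul_eq_mul] at h3
    omega

/-- A program that outputs `val n`, where `n` is the content of the register `x`. -/
structure EmitSpec (V : Env) (K l L : ℕ) (s : Stmt) (val : ℕ → List ℕ) : Prop where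
  run : ∀ {σ t A}, Ctx K l L A σ → wp V s (fun σ' t' => σ' = σ.emit (val (σ.r .x)) ∧ t' ≤ t + 1) σ t
  wr : ∀ x, s.wr x = false

theorem outP_spec {t : ℕ} {σ : St} {yes no : Stmt} {vy vn : ℕ → List ℕ}
    (h : Par N K l L) (hW : 1000 * N ≤ V.W)
    (hc : Ctx K l L A σ) (hA : A ≤ 2 * N) (hT : base + L ≤ V.T) {hi : ℕ} (hhi : σ.r .hi = hi)
    (hhN : hi ≤ 2 * N + 1)
    (hy : EmitSpec V K l L yes vy) (hn : EmitSpec V K l L no vn)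
    (hF : ∀ i < L, 2 ≤ A + i → (σ.h (base + i) < 1 ↔ (A + i).Prime)) :
    wp V (outP yes no) (fun σ' t' => σ'.o = σ.o ++ (List.range' A (min (A + L) hi - A)).flatMap
      (fun n => if n.Prime then vy n else vn n) ∧ t' ≤ t + 13 * L + 10) σ t := by
  have hb := base_eq
  have hL8 := h.L_le
  have hN := h.two_le
  have key : ∀ τ₀ t₀, Ctx K l L A τ₀ → τ₀.h = σ.h → τ₀.o = σ.o → τ₀.r .x = A →
      τ₀.r .ye = min (A + L) hi → t₀ ≤ t + 4 →
      wp V (Stmt.loop .x .ye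
        (Stmt.sub .p .x .A ;; Stmt.add .p .p .Bc ;; Stmt.load .f .p ;;
          Stmt.ite .f .one (Stmt.ite .one .x yes no) no ;; Stmt.add .x .x .one))
        (fun σ' t' => σ'.o = σ.o ++ (List.range' A (min (A + L) hi - A)).flatMap
          (fun n => if n.Prime then vy n else vn n) ∧ t' ≤ t + 13 * L + 10) τ₀ t₀ := by
    intro τ₀ t₀ hc₀ eh eo ex eye ht₀
    refine wp_loop_count (min (A + L) hi - A) (fun n τ t' => τ.r .x = A + n ∧
      τ.h = σ.h ∧ τ.o = σ.o ++ (List.range' A n).flatMap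
      (fun n => if n.Prime then vy n else vn n) ∧ t' ≤ t + 4 + 13 * n) ?_ ?_ ?_
    · exact ⟨by simp [ex], eh, by simp [eo], by omega⟩
    · rintro n hlt τ t' hf ⟨h1, h2, h3, h4⟩
      have hfr : ∀ x, x ≠ .p → x ≠ .f → x ≠ .x → τ.r x = τ₀.r x := by
        intro x h5 h6 h7
        exact hf.reg x (by simp [Stmt.wr, hy.wr, hn.wr, h5, h6, h7])
      have hcτ : Ctx K l L A τ := hc₀.of_eq (by
        intro x hx; exact hfr x (by rintro rfl; revert hx; decide) (by rintro rfl; revert hx; decide)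
          (by rintro rfl; revert hx; decide))
      have eyeτ : τ.r .ye = min (A + L) hi := by rw [hfr .ye (by decide) (by decide) (by decide), eye]
      refine ⟨by omega, ?_⟩
      have fin : ∀ τ₁ s val (t₁ : ℕ), (∀ x, x ≠ .p → x ≠ .f → τ₁.r x = τ.r x) →
          τ₁.h = τ.h → τ₁.o = τ.o → t₁ ≤ t' + 6 → EmitSpec V K l L s val →
          val (A + n) = (if (A + n).Prime then vy (A + n) else vn (A + n)) →
          ∀ Q : Post, (∀ σ' t'', σ'.r .x = A + n → σ'.r .one = 1 → σ'.h = σ.h →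
            σ'.o = σ.o ++ (List.range' A (n + 1)).flatMap
              (fun n => if n.Prime then vy n else vn n) → t'' ≤ t' + 7 → Q σ' t'') →
          wp V s Q τ₁ t₁ := by
        intro τ₁ s val t₁ er eh₁ eo₁ ht₁ hs hval Q hQ
        have hc₁ : Ctx K l L A τ₁ := hcτ.of_eq fun x hx => er x
          (by rintro rfl; revert hx; decide) (by rintro rfl; revert hx; decide)
        refine wp_conseq (hs.run hc₁) fun σ' t'' => ?_
        rintro ⟨rfl, ht''⟩
        have ex₁ : τ₁.r .x = A + n := by rw [er _ (by decide) (by decide), h1]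
        refine hQ _ _ ex₁ hc₁.hone (eh₁.trans h2) ?_ (by omega)
        rw [St.emit_o, eo₁, h3, ex₁, hval, List.range'_1_concat, List.flatMap_append,
          List.append_assoc]
        simp
      have e1 : A + n - A + base = base + n := by omega
      simp only [wp_seq_eq, wp_op, wp_ite, Op.safe, Op.eval, ArithOp.eval, St.set_r,
        reduceCtorEq, if_false, if_true, St.set_h, h1, hcτ.hA, hcτ.hBc, hcτ.hone, e1, h2, true_and]
      refine ⟨by omega, ⟨by omega, by omega⟩, ?_⟩
      have hFn := hF n (by omega)
      split_ifs with h5 h6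
      · refine fin _ yes vy _ ?_ ?_ ?_ ?_ hy
          (by rw [if_pos ((hFn (by omega)).1 h5)]) _
          fun σ' t'' g1 g2 g3 g4 g5 => ?_
        · intro x g1 g2; simp [g1, g2]
        · rfl
        · rfl
        · omega
        simp only [wp_op, Op.safe, Op.eval, ArithOp.eval, St.set_r, St.set_h, St.set_o, if_true,
          g1, g2]
        exact ⟨by omega, by omega, g3, g4, by omega⟩
      · refine fin _ no vn _ ?_ ?_ ?_ ?_ hn
          (by rw [if_neg (fun hp => h6 (by have := hp.two_le; omega))]) _
          fun σ' t'' g1 g2 g3 g4 g5 => ?_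
        · intro x g1 g2; simp [g1, g2]
        · rfl
        · rfl
        · omega
        simp only [St.set_o, g1, g2]
        exact ⟨by omega, by omega, g3, g4, by omega⟩
      · refine fin _ no vn _ ?_ ?_ ?_ ?_ hn
          (by rw [if_neg (fun hp => h5 ((hFn hp.two_le).2 hp))]) _
          fun σ' t'' g1 g2 g3 g4 g5 => ?_
        · intro x g1 g2; simp [g1, g2]
        · rfl
        · rfl
        · omega
        simp only [St.set_o, g1, g2]
        exact ⟨by omega, by omega, g3, g4, by omega⟩
    · rintro τ t' hf ⟨h1, h2, h3, h4⟩
      have eyeτ : τ.r .ye = min (A + L) hi := by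
        rw [hf.reg .ye (by simp [Stmt.wr, hy.wr, hn.wr]), eye]
      exact ⟨by omega, h3, by omega⟩
  unfold outP
  generalize (Stmt.loop .x .ye _) = rest at key ⊢
  simp only [wp_seq_eq, wp_op, wp_ite, Op.safe, Op.eval, ArithOp.eval, St.set_r,
    reduceCtorEq, if_false, hhi, hc.hA, hc.hzero, hc.hE, Nat.add_zero]
  refine ⟨by omega, ?_⟩
  split_ifs with h5
  · exact ⟨by omega, key _ _ (hc.of_eq (by simp [ctxRegs])) rfl rfl (by simp) (by simp; omega)
      (by omega)⟩
  · exact ⟨by omega, key _ _ (hc.of_eq (by simp [ctxRegs])) rfl rfl (by simp) (by simp; omega)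
      (by omega)⟩

theorem primesBody_spec {yes no : Stmt} {vy vn : ℕ → List ℕ} {lo hi : ℕ} (h : Par N K l L)
    (hW : 1000 * N ≤ V.W) (hT : base + L ≤ V.T) (hH : 1 ≤ V.H) (hhN : hi ≤ 2 * N + 1)
    (hy : EmitSpec V K l L yes vy) (hn : EmitSpec V K l L no vn) :
    SegSpec V N K l L lo hi (primesBody yes no) (fun n => if n.Prime then vy n else vn n)
      70100 := by
  have hl3 := h.three_le_l
  have hL3 := h.three_le_L
  have hv : ∀ A ≤ 2 * N, VisitSpec V K l L A visitP (Flags A L L) (MarkDone A) := fun A hA =>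
    visitP_spec h hW hA hT hH
  have hk1 : (clearP ;; smallP ;; large visitP).Keeps := by decide
  refine ⟨?_, fun A σ t hc hhi _ hA _ => ?_⟩
  · intro x hx
    have h1 := hk1 x hx
    have h2 : (outP .skip .skip).Keeps := by decide
    have h2 := h2 x hx
    simp only [Stmt.wr, Bool.or_eq_false_iff, primesBody, outP, hy.wr, hn.wr] at h1 h2 ⊢
    simp only [h1, h2, and_self]
  have hLl : L * 3 ≤ L * l := Nat.mul_le_mul_left _ hl3
  refine wp_seq (clearP_spec h hW hc hT) ?_
  rintro σ₁ t₁ ⟨f1, ht₁⟩ hf₁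
  have hc₁ := hc.frame hf₁ (by decide)
  refine wp_seq (smallP_spec h hW hc₁ hA hT hH f1) ?_
  rintro σ₂ t₂ ⟨f2, ht₂⟩ hf₂
  have hc₂ := hc₁.frame hf₂ (by decide)
  refine wp_seq (large_spec h hW (hv A hA) hc₂ hA f2) ?_
  rintro σ₃ t₃ ⟨f3, f4, ht₃⟩ hf₃
  have hc₃ := hc₂.frame hf₃ (by decide)
  have ehi : σ₃.r .hi = hi := by
    rw [hf₃.reg .hi (by decide), hf₂.reg .hi (by decide), hf₁.reg .hi (by decide), hhi]
  refine wp_conseq (outP_spec h hW hc₃ hA hT ehi hhN hy hn ?_) ?_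
  · intro i hi h2
    refine ⟨fun h0 => ?_, fun hp => ?_⟩
    · by_contra hp
      have hd := Nat.minFac_dvd (A + i)
      have hd2 := (Nat.minFac_prime (by omega : A + i ≠ 1)).two_le
      have hsq : (A + i).minFac * (A + i).minFac ≤ A + i := by
        rw [← sq]; exact Nat.minFac_sq_le_self (by omega) hp
      have hlt : (A + i).minFac < A + i := by nlinarith
      rcases lt_or_ge (A + i).minFac L with h5 | h5
      · have := (f3 i hi).2.2 _ hd2 h5 hd hlt
        omega
      · have := f4 _ _ h5 (by omega) hd (by omega) (by omega) hlt
        rw [Nat.add_sub_cancel_left] at this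
        omega
    · have := (f3 i hi).1
      have h4 := (f3 i hi).2.1
      by_contra h0
      exact h4 (by omega) hp
  · rintro σ₄ t₄ ⟨g1, g2⟩
    refine ⟨?_, by omega⟩
    rw [g1, hf₃.out (by decide), hf₂.out (by decide), hf₁.out (by decide)]

end

/-! ### Stripping off small primes -/

/-- The number `x` without its prime factors `< D`. -/
def cofac : ℕ → ℕ → ℕ
  | 0, x => x
  | D + 1, x => ordCompl[D] (cofac D x)

/-- The primes `p < D` that divide `x`, in increasing order, each with its exponent in `x`. -/
def facs (D x : ℕ) : List (ℕ × ℕ) :=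
  ((List.range D).filter fun p => p.Prime ∧ p ∣ x).map fun p => (p, x.factorization p)

/-- The encoding of a list of pairs as a list of numbers. -/
def flat (F : List (ℕ × ℕ)) : List ℕ := F.flatMap fun pk => [pk.1, pk.2]

theorem cofac_dvd (D x : ℕ) : cofac D x ∣ x := by
  induction D with
  | zero => exact dvd_rfl
  | succ D ih => exact (Nat.ordCompl_dvd _ _).trans ih

theorem cofac_pos {x : ℕ} (hx : 0 < x) (D : ℕ) : 0 < cofac D x :=
  Nat.pos_of_dvd_of_pos (cofac_dvd D x) hx

theorem cofac_le {x : ℕ} (hx : 0 < x) (D : ℕ) : cofac D x ≤ x := Nat.le_of_dvd hx (cofac_dvd D x)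

theorem factorization_cofac (D x q : ℕ) :
    (cofac D x).factorization q = if D ≤ q then x.factorization q else 0 := by
  induction D with
  | zero => simp [cofac]
  | succ D ih =>
    rw [cofac, Nat.factorization_ordCompl, Finsupp.erase_apply, ih]
    split_ifs <;> first | rfl | omega

theorem le_of_prime_dvd_cofac {D x q : ℕ} (hx : 0 < x) (hq : q.Prime) (h : q ∣ cofac D x) :
    D ≤ q := by
  have h1 := (hq.dvd_iff_one_le_factorization (cofac_pos hx D).ne').1 h
  rw [factorization_cofac] at h1
  by_contra h2
  simp [h2] at h1

theorem dvd_cofac_iff {D x : ℕ} (hx : 0 < x) (hD : 2 ≤ D) :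
    D ∣ cofac D x ↔ D.Prime ∧ D ∣ x := by
  constructor
  · intro h
    refine ⟨?_, h.trans (cofac_dvd D x)⟩
    have hp := Nat.minFac_prime (show D ≠ 1 by omega)
    have h1 := le_of_prime_dvd_cofac hx hp ((Nat.minFac_dvd D).trans h)
    have h2 := Nat.minFac_le (show 0 < D by omega)
    rwa [le_antisymm h2 h1] at hp
  · rintro ⟨hp, h⟩
    rw [hp.dvd_iff_one_le_factorization (cofac_pos hx D).ne', factorization_cofac, if_pos le_rfl]
    exact (hp.dvd_iff_one_le_factorization hx.ne').1 h

theorem cofac_succ_of_not {D x : ℕ} (h : ¬ (D.Prime ∧ D ∣ x)) : cofac (D + 1) x = cofac D x := by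
  have : (cofac D x).factorization D = 0 := by
    rw [factorization_cofac, if_pos le_rfl]
    by_cases hp : D.Prime
    · exact Nat.factorization_eq_zero_of_not_dvd fun h1 => h ⟨hp, h1⟩
    · exact Nat.factorization_eq_zero_of_not_prime _ hp
  rw [cofac, this]
  simp

theorem facs_succ_of_not {D x : ℕ} (h : ¬ (D.Prime ∧ D ∣ x)) : facs (D + 1) x = facs D x := by
  simp [facs, List.range_succ, List.filter_append, h]

theorem facs_succ {D x : ℕ} (h : D.Prime ∧ D ∣ x) :
    facs (D + 1) x = facs D x ++ [(D, x.factorization D)] := by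
  simp [facs, List.range_succ, List.filter_append, h]

theorem mem_facs {D x p k : ℕ} :
    (p, k) ∈ facs D x ↔ p < D ∧ p.Prime ∧ p ∣ x ∧ k = x.factorization p := by
  simp only [facs, List.mem_map, List.mem_filter, List.mem_range, decide_eq_true_eq, Prod.mk.injEq]
  constructor
  · rintro ⟨q, ⟨h1, h2, h3⟩, rfl, rfl⟩
    exact ⟨h1, h2, h3, rfl⟩
  · rintro ⟨h1, h2, h3, rfl⟩
    exact ⟨p, ⟨h1, h2, h3⟩, rfl, rfl⟩

theorem nodup_facs (D x : ℕ) : (facs D x).Nodup := by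
  refine List.Nodup.map ?_ (List.nodup_range.filter _)
  intro a b h
  exact (Prod.mk.inj h).1

/-- The result of dividing by a prime as often as possible. -/
theorem cofac_eq_of_mul_pow {D x c e : ℕ} (hx : 0 < x) (hp : D.Prime)
    (h : c * D ^ e = cofac D x) (hc : ¬ D ∣ c) : e = x.factorization D ∧ c = cofac (D + 1) x := by
  have hpos := cofac_pos hx D
  have hc0 : c ≠ 0 := by rintro rfl; simp at h; omega
  have h1 : (cofac D x).factorization D = e := by
    rw [← h, Nat.factorization_mul hc0 (pow_ne_zero _ hp.ne_zero)]
    simp [Nat.factorization_eq_zero_of_not_dvd hc, hp.factorization_self]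
  refine ⟨by rw [← h1, factorization_cofac, if_pos le_rfl], ?_⟩
  rw [cofac, h1, ← h, Nat.mul_div_cancel _ (pow_pos hp.pos _)]

/-- Bounds for the number of divisions and for the number of prime factors. -/
theorem two_pow_sum_factorization_mul_cofac_le (x D : ℕ) :
    2 ^ (∑ d ∈ Finset.range D, x.factorization d) * cofac D x ≤ x := by
  induction D with
  | zero => simp [cofac]
  | succ D ih =>
    refine le_trans ?_ ih
    rw [Finset.sum_range_succ, pow_add, mul_assoc]
    refine Nat.mul_le_mul_left _ ?_
    have h1 : (cofac D x).factorization D = x.factorization D := by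
      rw [factorization_cofac, if_pos le_rfl]
    have h2 := Nat.ordProj_mul_ordCompl_eq_self (cofac D x) D
    rw [cofac]
    nth_rw 3 [← h2]
    refine Nat.mul_le_mul_right _ ?_
    rw [h1]
    by_cases hp : D.Prime
    · exact Nat.pow_le_pow_left hp.two_le _
    · simp [Nat.factorization_eq_zero_of_not_prime _ hp]

theorem two_pow_sum_factorization_le {x : ℕ} (hx : 0 < x) (D : ℕ) :
    2 ^ (∑ d ∈ Finset.range D, x.factorization d) ≤ x :=
  (Nat.le_mul_of_pos_right _ (cofac_pos hx D)).trans (two_pow_sum_factorization_mul_cofac_le x D)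

theorem length_facs_le (D x : ℕ) (hx : 0 < x) :
    (facs D x).length ≤ ∑ d ∈ Finset.range D, x.factorization d := by
  induction D with
  | zero => simp [facs]
  | succ D ih =>
    rw [Finset.sum_range_succ]
    by_cases h : D.Prime ∧ D ∣ x
    · rw [facs_succ h, List.length_append]
      have := (h.1.dvd_iff_one_le_factorization hx.ne').1 h.2
      simp; omega
    · rw [facs_succ_of_not h]; omega

theorem length_flat (F : List (ℕ × ℕ)) : (flat F).length = 2 * F.length := by
  induction F with
  | nil => rfl
  | cons a F ih => simp [flat] at ih ⊢; omega

theorem flat_append (F G : List (ℕ × ℕ)) : flat (F ++ G) = flat F ++ flat G := by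
  simp [flat]

/-! ### Numbers without small prime factors -/

/-- All prime factors of `n` are `≥ L`. -/
def Rough (L n : ℕ) : Prop := ∀ q, q.Prime → q ∣ n → L ≤ q

theorem rough_cofac {x : ℕ} (hx : 0 < x) (L : ℕ) : Rough L (cofac L x) :=
  fun _ hq h => le_of_prime_dvd_cofac hx hq h

theorem Rough.of_dvd {L n m : ℕ} (h : Rough L n) (hm : m ∣ n) : Rough L m :=
  fun q hq hd => h q hq (hd.trans hm)

theorem Rough.prime {L n : ℕ} (h : Rough L n) (hn : 1 < n) (hL : n < L * L) : n.Prime := by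
  by_contra hp
  have h1 := h _ (Nat.minFac_prime hn.ne') (Nat.minFac_dvd n)
  have h2 := Nat.minFac_sq_le_self (by omega) hp
  have h3 : L * L ≤ n.minFac * n.minFac := Nat.mul_le_mul h1 h1
  rw [sq] at h2
  omega

/-- The factorization, as a list, of a number with at most two prime factors. -/
def facsTwo (c : ℕ) : List (ℕ × ℕ) :=
  if c ≤ 1 then [] else if c.Prime then [(c, 1)] else
    if c = c.minFac * c.minFac then [(c.minFac, 2)] else [(c.minFac, 1), (c / c.minFac, 1)]

theorem facsTwo_prime {p : ℕ} (hp : p.Prime) : facsTwo p = [(p, 1)] := by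
  have := hp.two_le
  simp [facsTwo, hp, show ¬ p ≤ 1 by omega]

theorem minFac_mul_of_le {p q : ℕ} (hp : p.Prime) (hq : q.Prime) (h : p ≤ q) :
    (p * q).minFac = p := by
  have h1 : p * q ≠ 1 := by have := hp.two_le; have := hq.two_le; nlinarith
  have h2 := Nat.minFac_prime h1
  have h3 := Nat.minFac_le_of_dvd hp.two_le (Dvd.intro q rfl)
  rcases (h2.dvd_mul).1 (Nat.minFac_dvd (p * q)) with h4 | h4
  · exact (Nat.prime_dvd_prime_iff_eq h2 hp).1 h4
  · have := (Nat.prime_dvd_prime_iff_eq h2 hq).1 h4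
    omega

theorem facsTwo_mul_self {p : ℕ} (hp : p.Prime) : facsTwo (p * p) = [(p, 2)] := by
  have h1 := hp.two_le
  have h2 : ¬ p * p ≤ 1 := by nlinarith
  simp only [facsTwo, h2, Nat.not_prime_mul hp.ne_one hp.ne_one, minFac_mul_of_le hp hp le_rfl,
    if_false, if_true]

theorem facsTwo_mul {p q : ℕ} (hp : p.Prime) (hq : q.Prime) (h : p < q) :
    facsTwo (p * q) = [(p, 1), (q, 1)] := by
  have h1 := hp.two_le
  have h2 : ¬ p * q ≤ 1 := by nlinarith
  have h3 : p * q ≠ p * p := fun h4 => by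
    have := Nat.eq_of_mul_eq_mul_left hp.pos h4
    omega
  simp only [facsTwo, h2, Nat.not_prime_mul hp.ne_one hq.ne_one, minFac_mul_of_le hp hq h.le,
    if_false, h3, Nat.mul_div_cancel_left _ hp.pos]

theorem Rough.isFactorization {L c : ℕ} (h : Rough L c) (hc : 0 < c) (hL : c < L * L * L) :
    IsFactorization c (facsTwo c) := by
  simp only [IsFactorization]
  rcases Nat.lt_or_ge 1 c with h1 | h1
  swap
  · obtain rfl : c = 1 := by omega
    simp only [facsTwo, le_rfl, if_true, List.nodup_nil, List.not_mem_nil, false_iff, true_and]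
    rintro p k ⟨h2, h3, -⟩
    exact h2.one_lt.ne' (Nat.dvd_one.1 h3)
  by_cases hp : c.Prime
  · rw [facsTwo_prime hp]
    refine ⟨by simp, fun p k => ?_⟩
    simp only [List.mem_singleton, Prod.mk.injEq]
    constructor
    · rintro ⟨rfl, rfl⟩
      have := Fact.mk hp
      exact ⟨hp, dvd_rfl, by simp⟩
    · rintro ⟨h2, h3, rfl⟩
      obtain rfl := (Nat.prime_dvd_prime_iff_eq h2 hp).1 h3
      have := Fact.mk hp
      exact ⟨rfl, by simp⟩
  have hq := Nat.minFac_prime h1.ne'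
  obtain ⟨r, hr⟩ := Nat.minFac_dvd c
  have hLq := h _ hq (Nat.minFac_dvd c)
  have hqsq := Nat.minFac_sq_le_self hc hp
  generalize c.minFac = q at *
  subst hr
  have hqr : q ≤ r := Nat.le_of_mul_le_mul_left (by rw [← sq]; exact hqsq) hq.pos
  have hrp : r.Prime := by
    refine (h.of_dvd (Dvd.intro_left q rfl)).prime (hq.one_lt.trans_le hqr) ?_
    by_contra h2
    have : L * (L * L) ≤ q * r := Nat.mul_le_mul hLq (by omega)
    have e : L * (L * L) = L * L * L := by ring
    omega
  have := Fact.mk hq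
  have := Fact.mk hrp
  rcases hqr.eq_or_lt with rfl | hlt
  · rw [facsTwo_mul_self hq]
    have e2 : padicValNat q (q * q) = 2 := by
      rw [padicValNat.mul hq.ne_zero hq.ne_zero]; simp
    refine ⟨by simp, fun p k => ?_⟩
    simp only [List.mem_singleton, Prod.mk.injEq]
    constructor
    · rintro ⟨rfl, rfl⟩
      exact ⟨hq, Dvd.intro _ rfl, e2.symm⟩
    · rintro ⟨h2, h3, rfl⟩
      have h4 : p ∣ q := by rcases h2.dvd_mul.1 h3 with h | h <;> exact h
      obtain rfl := (Nat.prime_dvd_prime_iff_eq h2 hq).1 h4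
      exact ⟨rfl, e2⟩
  · rw [facsTwo_mul hq hrp hlt]
    have e1 : padicValNat q (q * r) = 1 := by
      rw [padicValNat.mul hq.ne_zero hrp.ne_zero, padicValNat_primes hlt.ne]; simp
    have e2 : padicValNat r (q * r) = 1 := by
      rw [padicValNat.mul hq.ne_zero hrp.ne_zero, padicValNat_primes hlt.ne']; simp
    refine ⟨by simp; omega, fun p k => ?_⟩
    simp only [List.mem_cons, List.not_mem_nil, or_false, Prod.mk.injEq]
    constructor
    · rintro (⟨rfl, rfl⟩ | ⟨rfl, rfl⟩)
      · exact ⟨hq, Dvd.intro _ rfl, e1.symm⟩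
      · exact ⟨hrp, Dvd.intro_left _ rfl, e2.symm⟩
    · rintro ⟨h2, h3, rfl⟩
      rcases h2.dvd_mul.1 h3 with h4 | h4
      · obtain rfl := (Nat.prime_dvd_prime_iff_eq h2 hq).1 h4
        exact .inl ⟨rfl, e1⟩
      · obtain rfl := (Nat.prime_dvd_prime_iff_eq h2 hrp).1 h4
        exact .inr ⟨rfl, e2⟩

/-- The list of prime factors `< L`, followed by the one of the prime factors `≥ L`. -/
def facsAll (L x : ℕ) : List (ℕ × ℕ) := facs L x ++ facsTwo (cofac L x)

theorem isFactorization_facsAll {L x : ℕ} (hx : 0 < x) (hL : x < L * L * L) :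
    IsFactorization x (facsAll L x) := by
  have hr := rough_cofac hx L
  have hle := cofac_le hx L
  obtain ⟨h1, h2⟩ := hr.isFactorization (cofac_pos hx L) (by omega)
  refine ⟨?_, fun p k => ?_⟩
  · refine (nodup_facs L x).append h1 ?_
    rintro ⟨p, k⟩ h3 h4
    have h5 := (mem_facs.1 h3).1
    obtain ⟨h6, h7, -⟩ := (h2 p k).1 h4
    have := hr p h6 h7
    omega
  · rw [facsAll, List.mem_append, mem_facs, h2]
    by_cases hp : p.Prime
    swap
    · simp [hp]
    have := factorization_cofac L x p
    rw [Nat.factorization_def _ hp, Nat.factorization_def _ hp] at this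
    rw [Nat.factorization_def _ hp]
    rcases lt_or_ge p L with h3 | h3
    · have h4 : ¬ p ∣ cofac L x := fun h4 => by have := hr p hp h4; omega
      simp [h3, h4]
    · have h4 : p ∣ cofac L x ↔ p ∣ x := by
        rw [hp.dvd_iff_one_le_factorization (cofac_pos hx L).ne', factorization_cofac, if_pos h3,
          ← hp.dvd_iff_one_le_factorization hx.ne']
      rw [if_pos h3] at this
      simp [h4, this, hp]

/-! ### Factorization: the small divisors -/

open Stmt in
/-- Divide `c` by `d` as often as possible, and count the divisions in `e`. -/
def strip : Stmt :=
  loop .f .one (div .c .c .d ;; add .e .e .one ;; mod .f .c .d)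

open Stmt in
/-- Remove the divisor `d` from the cofactor of its multiple `x`, and record it. -/
def visitS : Stmt :=
  sub .p .x .A ;; add .p .p .Bc ;; load .c .p ;; mod .f .c .d ;;
  ite .f .one
    (cst .e 0 ;; strip ;; store .p .c ;;
     sub .p .x .y ;; mul .g .p .cap ;; add .p .p .Bn ;; load .n .p ;; add .g .g .n ;;
     add .g .g .Bs ;; store .g .d ;; add .g .g .one ;; store .g .e ;; add .n .n .two ;;
     store .p .n)
    skip

open Stmt in
/-- Set up the cells for a block. -/
def initB : Stmt :=
  add .x .y .zero ;;
  loop .x .ye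
    (sub .p .x .A ;; add .p .p .Bc ;; store .p .x ;; sub .p .x .y ;; add .p .p .Bn ;;
     store .p .zero ;; add .x .x .one)

open Stmt in
/-- Treat the multiples of `d` in a block. -/
def sweepS : Stmt :=
  add .x .y .d ;; sub .x .x .one ;; div .x .x .d ;; mul .x .x .d ;;
  loop .x .ye (visitS ;; add .x .x .d)

open Stmt in
/-- Treat all small divisors in a block. -/
def smallB : Stmt :=
  initB ;; add .d .two .zero ;; loop .d .L (sweepS ;; add .d .d .one)

/-- The state of the cells that belong to `x` when the divisors `< D` have been treated: the cell
for the cofactor, and the list of the prime factors with its length. -/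
structure Cell (A K l L y D x : ℕ) (h : ℕ → ℕ) : Prop where
  cof : h (base + (x - A)) = cofac D x
  fac : (List.range (h (base + 2 * L + (x - y)))).map
    (fun i => h (base + 2 * L + K + (x - y) * (4 * l) + i)) = flat (facs D x)

/-- The addresses of the cells that belong to `x`. -/
def Own (A K l L y x a : ℕ) : Prop :=
  a = base + (x - A) ∨ a = base + 2 * L + (x - y) ∨
    base + 2 * L + K + (x - y) * (4 * l) ≤ a ∧ a < base + 2 * L + K + (x - y) * (4 * l) + 4 * l

/-- The situation for the treatment of the block `[y, y + K)` of the segment `[A, A + L)`. -/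
structure Blk (V : Env) (N K l L A y : ℕ) : Prop where
  par : Par N K l L
  hW : 1000 * N ≤ V.W
  hT : base + 7 * L ≤ V.T
  hH : 1000 * N ≤ V.H
  one_le : 1 ≤ A
  le : A ≤ 2 * N
  hy : A ≤ y
  hye : y + K ≤ A + L

section
variable {V : Env} {N K l L A y : ℕ}

theorem Blk.slot_le (hB : Blk V N K l L A y) {x : ℕ} (hx : x < y + K) (hyx : y ≤ x) :
    (x - y) * (4 * l) + 4 * l ≤ 4 * L := by
  have h1 : (x - y + 1) * (4 * l) ≤ K * (4 * l) := Nat.mul_le_mul_right _ (by omega)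
  have h2 : K * (4 * l) = 4 * L := by rw [hB.par.L_eq]; ring
  have h3 : (x - y + 1) * (4 * l) = (x - y) * (4 * l) + 4 * l := by ring
  omega

theorem Own.disjoint (hB : Blk V N K l L A y) {x x' a : ℕ} (hx : x < y + K) (hyx : y ≤ x)
    (hx' : x' < y + K) (hyx' : y ≤ x') (h : Own A K l L y x a) (h' : Own A K l L y x' a) :
    x = x' := by
  have hy := hB.hy
  have hye := hB.hye
  have h1 := hB.par.K_le_L
  rcases lt_trichotomy x x' with hlt | rfl | hlt
  · have h2 : (x - y + 1) * (4 * l) ≤ (x' - y) * (4 * l) := Nat.mul_le_mul_right _ (by omega)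
    have h3 : (x - y + 1) * (4 * l) = (x - y) * (4 * l) + 4 * l := by ring
    unfold Own at h h'
    omega
  · rfl
  · have h2 : (x' - y + 1) * (4 * l) ≤ (x - y) * (4 * l) := Nat.mul_le_mul_right _ (by omega)
    have h3 : (x' - y + 1) * (4 * l) = (x' - y) * (4 * l) + 4 * l := by ring
    unfold Own at h h'
    omega

/-- The numbers of a segment have few prime factors, so that their lists fit into `4 * l` cells. -/
theorem sum_factorization_lt (h : Par N K l L) (hA : A ≤ 2 * N) {x : ℕ} (hx0 : 0 < x)
    (hx : x < A + L) (D : ℕ) : ∑ d ∈ Finset.range D, x.factorization d < l + 3 := by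
  have h1 := two_pow_sum_factorization_le hx0 D
  have h2 := h.lt_pow
  have h3 := h.L_le
  have h4 := h.three_le_l
  refine (Nat.pow_lt_pow_iff_right (a := 2) (by norm_num)).1 (h1.trans_lt ?_)
  have h5 : l + 3 = (l - 1) + 4 := by omega
  rw [h5, pow_add]
  omega

theorem length_flat_facs_lt (h : Par N K l L) (hA : A ≤ 2 * N) {x : ℕ} (hx0 : 0 < x)
    (hx : x < A + L) (D : ℕ) : (flat (facs D x)).length + 2 ≤ 4 * l := by
  have h1 := length_facs_le D x hx0
  have h2 := sum_factorization_lt h hA hx0 hx D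
  have h4 := h.three_le_l
  rw [length_flat]
  omega

theorem Cell.length {D x : ℕ} {h : ℕ → ℕ} (hc : Cell A K l L y D x h) :
    h (base + 2 * L + (x - y)) = (flat (facs D x)).length := by
  have := congrArg List.length hc.fac
  simpa using this

theorem Cell.congr (hB : Blk V N K l L A y) {D x : ℕ} {h h' : ℕ → ℕ} (hx : x < y + K)
    (hyx : y ≤ x) (hc : Cell A K l L y D x h) (heq : ∀ a, Own A K l L y x a → h' a = h a) :
    Cell A K l L y D x h' := by
  have h1 := length_flat_facs_lt hB.par hB.le (x := x)
    (by have := hB.hy; have := hB.one_le; omega) (by have := hB.hye; omega) D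
  refine ⟨(heq _ (.inl rfl)).trans hc.cof, ?_⟩
  rw [heq _ (.inr (.inl rfl)), ← hc.fac]
  refine List.map_congr_left fun i hi => heq _ (.inr (.inr ?_))
  rw [hc.length, List.mem_range] at hi
  omega

theorem Cell.succ {D x : ℕ} {h : ℕ → ℕ} (hc : Cell A K l L y D x h) (hD : ¬ (D.Prime ∧ D ∣ x)) :
    Cell A K l L y (D + 1) x h := by
  obtain ⟨h1, h2⟩ := hc
  exact ⟨by rw [cofac_succ_of_not hD, h1], by rw [facs_succ_of_not hD, h2]⟩

theorem strip_spec {t C D : ℕ} {σ : St} (hW : C ≤ V.W) (hC : 0 < C) (hD : 2 ≤ D)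
    (h1 : σ.r .one = 1) (hc : σ.r .c = C) (hd : σ.r .d = D) (he : σ.r .e = 0)
    (hf : σ.r .f = C % D) :
    wp V strip (fun σ' t' => ∃ c e, σ'.r .c = c ∧ σ'.r .e = e ∧ c * D ^ e = C ∧ ¬ D ∣ c ∧
      t' ≤ t + 5 * e + 2) σ t := by
  refine wp_loop (fun τ t' => ∃ c e, τ.r .c = c ∧ τ.r .e = e ∧ τ.r .f = c % D ∧ c * D ^ e = C ∧
    t' ≤ t + 5 * e) (fun τ => τ.r .c) ?_ ?_ ?_
  · exact ⟨C, 0, hc, he, hf, by simp, by omega⟩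
  · rintro τ t' hf ⟨c, e, h2, h3, h4, h5, h6⟩ hlt
    have e1 : τ.r .one = 1 := by rw [hf.reg .one rfl, h1]
    have e2 : τ.r .d = D := by rw [hf.reg .d rfl, hd]
    rw [h4, e1] at hlt
    obtain ⟨c', rfl⟩ : D ∣ c := Nat.dvd_of_mod_eq_zero (by omega)
    have hc' : 0 < c' := Nat.pos_of_ne_zero (by rintro rfl; simp at h5; omega)
    have h7 : c' * D ^ (e + 1) = C := by rw [← h5]; ring
    have h8 : e + 1 < D ^ (e + 1) := Nat.lt_pow_self (by omega)
    have h9 : D ^ (e + 1) ≤ c' * D ^ (e + 1) := Nat.le_mul_of_pos_left _ hc'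
    have h10 : D * c' / D = c' := Nat.mul_div_cancel_left _ (by omega)
    have h11 : 2 * c' ≤ D * c' := Nat.mul_le_mul_right _ hD
    simp only [wp_seq_eq, wp_op, Op.safe, Op.eval, ArithOp.eval, St.set_r, reduceCtorEq, if_false,
      if_true, h2, h3, e1, e2, h10, true_and]
    exact ⟨by omega, ⟨c', e + 1, rfl, rfl, rfl, h7, by omega⟩, by omega⟩
  · rintro τ t' hf ⟨c, e, h2, h3, h4, h5, h6⟩ hlt
    have e1 : τ.r .one = 1 := by rw [hf.reg .one rfl, h1]
    rw [h4, e1] at hlt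
    refine ⟨c, e, h2, h3, h5, fun hd => hlt ?_, by omega⟩
    rw [Nat.mod_eq_zero_of_dvd hd]
    exact Nat.one_pos

theorem visitS_spec {t d x : ℕ} {σ : St} (hB : Blk V N K l L A y) (hc : Ctx K l L A σ)
    (hy : σ.r .y = y) (hd : σ.r .d = d) (hx : σ.r .x = x) (hd2 : 2 ≤ d) (hdL : d < L)
    (hyx : y ≤ x) (hxy : x < y + K) (hI : Cell A K l L y d x σ.h) :
    wp V visitS (fun σ' t' => Cell A K l L y (d + 1) x σ'.h ∧
      (∀ a, ¬ Own A K l L y x a → σ'.h a = σ.h a) ∧ t' ≤ t + 22 + 5 * x.factorization d) σ t := by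
  have hb := base_eq
  have h1 := hB.hy
  have h2 := hB.hye
  have h3 := hB.one_le
  have h4 := hB.le
  have h5 := hB.hT
  have h6 := hB.hW
  have h6' := hB.hH
  have h7 := hB.par.L_le
  have h8 := hB.par.K_le_L
  have h9 := hB.slot_le hxy hyx
  have h10 := length_flat_facs_lt hB.par h4 (x := x) (by omega) (by omega) d
  have h11 := hB.par.l_le_L
  have h12 := hB.par.two_le
  have hlen := hI.length
  have hcof := hI.cof
  have hfac := hI.fac
  have hdvd := dvd_cofac_iff (x := x) (D := d) (by omega) hd2
  have hcle := cofac_le (x := x) (by omega) d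
  have hcpos := cofac_pos (x := x) (by omega) d
  have e1 : x - A + base = base + (x - A) := add_comm _ _
  have e2 : x - y + (base + 2 * L) = base + 2 * L + (x - y) := add_comm _ _
  generalize hS : (x - y) * (4 * l) = S at *
  generalize hn : (flat (facs d x)).length = n at *
  have e3 : S + n + (base + 2 * L + K) = base + 2 * L + K + S + n := by ring
  unfold visitS
  generalize hrest : (Stmt.store .p .c ;; _) = rest
  simp only [wp_seq_eq, wp_op, wp_ite, wp_skip, Op.safe, Op.eval, ArithOp.eval, St.set_r, St.set_h,
    reduceCtorEq, if_false, if_true, hx, hd, hc.hA, hc.hBc, hc.hone, true_and, e1, hcof]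
  refine ⟨by omega, ⟨by omega, by omega⟩, ?_⟩
  split_ifs with hlt
  · have hdd : d ∣ cofac d x := Nat.dvd_of_mod_eq_zero (by omega)
    have hdp := hdvd.1 hdd
    refine ⟨by omega, ?_⟩
    refine wp_conseq (wp_frame (strip_spec (C := cofac d x) (D := d) (by omega) hcpos hd2
      (by simp [hc.hone]) (by simp) (by simp [hd]) (by simp) (by simp))) ?_
    rintro τ t' ⟨⟨c, e, ec, ee, h13, h14, ht'⟩, hf⟩
    obtain ⟨he, hc'⟩ := cofac_eq_of_mul_pow (x := x) (by omega) hdp.1 h13 h14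
    have hcτ : Ctx K l L A τ := (hc.of_eq (by simp [ctxRegs])).frame hf (by decide)
    have hh : τ.h = σ.h := by rw [hf.heap rfl]; simp
    have ep : τ.r .p = base + (x - A) := by rw [hf.reg .p rfl]; simp
    have ed : τ.r .d = d := by rw [hf.reg .d rfl]; simp [hd]
    have ex : τ.r .x = x := by rw [hf.reg .x rfl]; simp [hx]
    have ey : τ.r .y = y := by rw [hf.reg .y rfl]; simp [hy]
    have hcc : c ≤ cofac d x := by
      rw [← h13]; exact Nat.le_mul_of_pos_right _ (pow_pos (by omega) _)
    have hel : e < l + 3 := by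
      have := sum_factorization_lt hB.par h4 (x := x) (by omega) (by omega) (d + 1)
      rw [Finset.sum_range_succ] at this
      omega
    have u1 : ∀ v, Function.update σ.h (base + (x - A)) v (base + 2 * L + (x - y)) = n := by
      intro v
      rw [Function.update_of_ne (by omega), hlen]
    rw [← hrest]
    simp only [wp_seq_eq, wp_op, Op.safe, Op.eval, ArithOp.eval, St.set_r, St.set_h, St.put_r,
      St.put_h, reduceCtorEq, if_false, if_true, ep, ec, ee, ex, ey, ed, hh, hcτ.hcap, hcτ.hBn,
      hcτ.hBs, hcτ.hone, hcτ.htwo, hS, e2, u1, e3, true_and]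
    refine ⟨⟨by omega, by omega, by omega⟩, by omega, by omega, ⟨by omega, by omega⟩, by omega,
      by omega, ⟨by omega, by omega, by omega⟩, by omega, ⟨by omega, by omega, by omega⟩, by omega,
      ⟨by omega, by omega, by omega⟩, ⟨?_, ?_⟩, ?_, by omega⟩
    · rw [Function.update_of_ne (by omega), Function.update_of_ne (by omega),
        Function.update_of_ne (by omega), Function.update_self, hc']
    · rw [Function.update_self, hS, List.range_succ, List.range_succ, facs_succ hdp, flat_append,
        ← hfac, hlen]
      simp only [List.map_append, List.append_assoc]
      congr 1
      · refine List.map_congr_left fun i hi => ?_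
        rw [List.mem_range] at hi
        rw [Function.update_of_ne (by omega), Function.update_of_ne (by omega),
          Function.update_of_ne (by omega), Function.update_of_ne (by omega)]
      · simp only [List.map_cons, List.map_nil, List.cons_append, List.nil_append, flat,
          List.flatMap_cons, List.flatMap_nil, ← he]
        rw [Function.update_of_ne (by omega), Function.update_of_ne (by omega),
          Function.update_self, Function.update_of_ne (by omega), ← add_assoc,
          Function.update_self]
    · intro a ha
      unfold Own at ha
      rw [hS] at ha
      rw [Function.update_of_ne (by omega), Function.update_of_ne (by omega),
        Function.update_of_ne (by omega), Function.update_of_ne (by omega)]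
  · refine ⟨hI.succ fun h => hlt ?_, fun _ _ => trivial, by omega⟩
    rw [Nat.mod_eq_zero_of_dvd (hdvd.2 h)]
    exact Nat.one_pos

/-- The heaps agree outside the cells that belong to the block. -/
def Outside (A K l L y : ℕ) (h h' : ℕ → ℕ) : Prop :=
  ∀ a, (∀ x, y ≤ x → x < y + K → ¬ Own A K l L y x a) → h' a = h a

theorem initB_spec {t : ℕ} {σ : St} (hB : Blk V N K l L A y) (hc : Ctx K l L A σ)
    (hy : σ.r .y = y) (hye : σ.r .ye = y + K) :
    wp V initB (fun σ' t' => (∀ x, y ≤ x → x < y + K → Cell A K l L y 2 x σ'.h) ∧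
      Outside A K l L y σ.h σ'.h ∧ t' ≤ t + 9 * K + 3) σ t := by
  have hb := base_eq
  have h1 := hB.hy
  have h2 := hB.hye
  have h4 := hB.le
  have h5 := hB.hT
  have h6 := hB.hW
  have h6' := hB.hH
  have h7 := hB.par.L_le
  have h8 := hB.par.K_le_L
  have h12 := hB.par.two_le
  simp only [initB, wp_seq_eq, wp_op, Op.safe, Op.eval, ArithOp.eval, hy, hc.hzero, Nat.add_zero]
  refine ⟨by omega, ?_⟩
  refine wp_loop_count K (fun n τ t' => τ.r .x = y + n ∧
    (∀ x, y ≤ x → x < y + n → τ.h (base + (x - A)) = x ∧ τ.h (base + 2 * L + (x - y)) = 0) ∧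
    Outside A K l L y σ.h τ.h ∧ t' ≤ t + 1 + 9 * n) ?_ ?_ ?_
  · exact ⟨by simp, fun x g1 g2 => by omega, fun _ _ => rfl, by omega⟩
  · rintro n hn τ t' hf ⟨g1, g2, g3, g4⟩
    have hcτ : Ctx K l L A τ := (hc.of_eq (by simp [ctxRegs])).frame hf (by decide)
    have ey : τ.r .y = y := by rw [hf.reg .y rfl]; simp [hy]
    have eye : τ.r .ye = y + K := by rw [hf.reg .ye rfl]; simp [hye]
    have e1 : y + n - A + base = base + (y + n - A) := add_comm _ _
    have e2 : y + n - y + (base + 2 * L) = base + 2 * L + n := by omega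
    simp only [wp_seq_eq, wp_op, Op.safe, Op.eval, ArithOp.eval, St.set_r, St.set_h, St.put_r,
      St.put_h, reduceCtorEq, if_false, if_true, g1, ey, eye, hcτ.hA, hcτ.hBc, hcτ.hBn, hcτ.hzero,
      hcτ.hone, e1, e2, true_and]
    refine ⟨by omega, by omega, ⟨by omega, by omega, by omega⟩, by omega,
      ⟨by omega, by omega, by omega⟩, by omega, by omega, ?_, ?_, by omega⟩
    · intro x hx1 hx2
      simp only [Function.update_apply]
      have := g2 x hx1
      split_ifs <;> omega
    · intro a ha
      have h9 := ha (y + n) (by omega) (by omega)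
      unfold Own at h9
      rw [Function.update_of_ne (by omega), Function.update_of_ne (by omega), g3 a ha]
  · rintro τ t' hf ⟨g1, g2, g3, g4⟩
    have eye : τ.r .ye = y + K := by rw [hf.reg .ye rfl]; simp [hye]
    refine ⟨by omega, fun x hx1 hx2 => ?_, g3, by omega⟩
    obtain ⟨g5, g6⟩ := g2 x hx1 hx2
    have : Cell A K l L y 0 x τ.h := ⟨by rw [g5]; rfl, by rw [g6]; rfl⟩
    exact (this.succ (by simp [Nat.not_prime_zero])).succ (by simp [Nat.not_prime_one])

theorem Outside.trans {h h' h'' : ℕ → ℕ} (h₁ : Outside A K l L y h h')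
    (h₂ : Outside A K l L y h' h'') : Outside A K l L y h h'' :=
  fun a ha => (h₂ a ha).trans (h₁ a ha)

theorem sweepS_spec {t d : ℕ} {σ : St} (hB : Blk V N K l L A y) (hc : Ctx K l L A σ)
    (hy : σ.r .y = y) (hye : σ.r .ye = y + K) (hd : σ.r .d = d) (hd2 : 2 ≤ d) (hdL : d < L)
    (hI : ∀ x, y ≤ x → x < y + K → Cell A K l L y d x σ.h) :
    wp V sweepS (fun σ' t' => (∀ x, y ≤ x → x < y + K → Cell A K l L y (d + 1) x σ'.h) ∧
      Outside A K l L y σ.h σ'.h ∧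
      t' ≤ t + 40 + 30 * (K / d) + 5 * ∑ i ∈ Finset.range K, (y + i).factorization d) σ t := by
  have hb := base_eq
  have h1 := hB.hy
  have h2 := hB.hye
  have h4 := hB.le
  have h6 := hB.hW
  have h7 := hB.par.L_le
  have h8 := hB.par.K_le_L
  have h12 := hB.par.two_le
  have hlow : y ≤ firstMul y d := le_firstMul (by omega)
  have hup : firstMul y d < y + d := firstMul_lt (by omega)
  have hdvd : d ∣ firstMul y d := dvd_firstMul y d
  have hmin : ∀ x, d ∣ x → y ≤ x → firstMul y d ≤ x := fun x => firstMul_le (by omega)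
  have hfm : (y + d - 1) / d * d = firstMul y d := rfl
  generalize firstMul y d = x₀ at *
  simp only [sweepS, wp_seq_eq, wp_op, Op.safe, Op.eval, ArithOp.eval, St.set_r, reduceCtorEq,
    if_false, if_true, hy, hd, hc.hone, hfm, true_and]
  refine ⟨by omega, by omega, ?_⟩
  let G : ℕ → ℕ := fun k => ∑ i ∈ Finset.range (min k K), (y + i).factorization d
  refine wp_loop (fun τ t' => ∃ k, τ.r .x = x₀ + k * d ∧ (k = 0 ∨ x₀ + k * d < y + K + d) ∧
    (∀ x, y ≤ x → x < y + K → x₀ + k * d ≤ x → Cell A K l L y d x τ.h) ∧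
    (∀ x, y ≤ x → x < y + K → x < x₀ + k * d → Cell A K l L y (d + 1) x τ.h) ∧
    Outside A K l L y σ.h τ.h ∧ t' ≤ t + 4 + 30 * k + 5 * G (x₀ + k * d - y))
    (fun τ => y + K - τ.r .x) ?_ ?_ ?_
  · refine ⟨0, by simp, .inl rfl, fun x g1 g2 _ => hI x g1 g2, fun x g1 g2 g3 => ?_,
      fun _ _ => rfl, by omega⟩
    refine (hI x g1 g2).succ fun hd => ?_
    have := hmin x hd.2 g1
    omega
  · rintro τ t' hf ⟨k, g1, g2, g3, g4, g5, g6⟩ hlt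
    have hcτ : Ctx K l L A τ := (hc.of_eq (by simp [ctxRegs])).frame hf (by decide)
    have ey : τ.r .y = y := by rw [hf.reg .y rfl]; simp [hy]
    have eye : τ.r .ye = y + K := by rw [hf.reg .ye rfl]; simp [hye]
    have ed : τ.r .d = d := by rw [hf.reg .d rfl]; simp [hd]
    rw [g1, eye] at hlt
    have hdx : d ∣ x₀ + k * d := hdvd.add (Nat.dvd_mul_left _ _)
    have hnext : x₀ + (k + 1) * d = x₀ + k * d + d := by ring
    have hG : G (x₀ + k * d - y) + (x₀ + k * d).factorization d ≤ G (x₀ + k * d + d - y) := by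
      have e : (x₀ + k * d).factorization d = (y + (x₀ + k * d - y)).factorization d := by
        congr 2; omega
      rw [e]
      simp only [G]
      rw [min_eq_left (by omega)]
      refine (Finset.sum_range_succ (fun i => (y + i).factorization d) _).symm.le.trans ?_
      exact Finset.sum_le_sum_of_subset (Finset.range_mono (by omega))
    have hyx : y ≤ x₀ + k * d := by omega
    generalize x₀ + k * d = x at *
    refine wp_seq (visitS_spec hB hcτ ey ed g1 hd2 hdL (by omega) hlt (g3 x (by omega) hlt le_rfl))
      ?_
    rintro τ₁ t₁ ⟨f1, f2, f3⟩ hf₁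
    have ex₁ : τ₁.r .x = x := by rw [hf₁.reg .x rfl, g1]
    have ed₁ : τ₁.r .d = d := by rw [hf₁.reg .d rfl, ed]
    simp only [wp_op, Op.safe, Op.eval, ArithOp.eval, St.set_r, St.set_h, if_true, ex₁, ed₁, g1]
    have hother : ∀ x', y ≤ x' → x' < y + K → x' ≠ x → ∀ D, Cell A K l L y D x' τ.h →
        Cell A K l L y D x' τ₁.h := fun x' g7 g8 g9 D hD =>
      hD.congr hB g8 g7 fun a ha => f2 a fun ha' =>
        g9 (Own.disjoint hB g8 g7 hlt (by omega) ha ha')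
    refine ⟨by omega, ⟨k + 1, by omega, .inr (by omega), ?_, ?_, ?_, ?_⟩, by omega⟩
    · intro x' g7 g8 g9
      exact hother x' g7 g8 (by omega) _ (g3 x' g7 g8 (by omega))
    · intro x' g7 g8 g9
      rcases lt_trichotomy x' x with h9 | rfl | h9
      · exact hother x' g7 g8 (by omega) _ (g4 x' g7 g8 h9)
      · exact f1
      · refine hother x' g7 g8 (by omega) _ ((g3 x' g7 g8 h9.le).succ fun hd' => ?_)
        -- there is no multiple of `d` strictly between `x` and `x + d`
        have h10 := (Nat.dvd_sub hd'.2 hdx)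
        have := Nat.le_of_dvd (by omega) h10
        omega
    · exact g5.trans fun a ha => f2 a (ha x (by omega) hlt)
    · rw [hnext]
      omega
  · rintro τ t' hf ⟨k, g1, g2, g3, g4, g5, g6⟩ hlt
    have eye : τ.r .ye = y + K := by rw [hf.reg .ye rfl]; simp [hye]
    rw [g1, eye] at hlt
    refine ⟨fun x h9 h10 => g4 x h9 h10 (by omega), g5, ?_⟩
    have hk : k ≤ K / d + 1 := by
      rcases g2 with rfl | g2
      · exact Nat.zero_le _
      · cases k with
        | zero => exact Nat.zero_le _
        | succ k =>
          have e : (k + 1) * d = k * d + d := by ring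
          have : k ≤ K / d := (Nat.le_div_iff_mul_le (by omega)).2 (by omega)
          omega
    have hG : G (x₀ + k * d - y) = ∑ i ∈ Finset.range K, (y + i).factorization d := by
      simp only [G]; rw [min_eq_right (by omega)]
    rw [hG] at g6
    generalize K / d = u at *
    omega

/-- In a block of `K` numbers the small divisors take the time `O(L)`, for there are less than `L` of
them, and the pairs of a divisor and a multiple, as well as the divisions of cofactors, number
`O(K * l)`. There are `l` blocks in a segment. -/
theorem smallB_spec {t : ℕ} {σ : St} (hB : Blk V N K l L A y) (hc : Ctx K l L A σ)
    (hy : σ.r .y = y) (hye : σ.r .ye = y + K) :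
    wp V smallB (fun σ' t' => (∀ x, y ≤ x → x < y + K → Cell A K l L y L x σ'.h) ∧
      Outside A K l L y σ.h σ'.h ∧ t' ≤ t + 200 * L) σ t := by
  have h1 := hB.hy
  have h2 := hB.hye
  have h4 := hB.le
  have h6 := hB.hW
  have h7 := hB.par.L_le
  have h8 := hB.par.K_le_L
  have h9 := hB.par.three_le_L
  have h10 := hB.one_le
  have h11 := hB.par.three_le_l
  have h12 := hB.par.two_le
  refine wp_seq (initB_spec hB hc hy hye) ?_
  rintro σ₁ t₁ ⟨f1, f2, f3⟩ hf₁
  have hc₁ := hc.frame hf₁ (by decide)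
  have ey₁ : σ₁.r .y = y := by rw [hf₁.reg .y rfl, hy]
  have eye₁ : σ₁.r .ye = y + K := by rw [hf₁.reg .ye rfl, hye]
  simp only [wp_seq_eq, wp_op, Op.safe, Op.eval, ArithOp.eval, hc₁.htwo, hc₁.hzero, Nat.add_zero]
  refine ⟨by omega, ?_⟩
  refine wp_loop_count (L - 2) (fun n τ t' => τ.r .d = 2 + n ∧
    (∀ x, y ≤ x → x < y + K → Cell A K l L y (2 + n) x τ.h) ∧ Outside A K l L y σ.h τ.h ∧
    t' ≤ t₁ + 1 + ∑ d ∈ Finset.range (2 + n), (50 + 30 * (K / d) +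
      5 * ∑ i ∈ Finset.range K, (y + i).factorization d)) ?_ ?_ ?_
  · exact ⟨by simp, f1, f2, by omega⟩
  · rintro n hn τ t' hf ⟨g1, g2, g3, g4⟩
    have hcτ : Ctx K l L A τ := (hc₁.of_eq (by simp [ctxRegs])).frame hf (by decide)
    have ey : τ.r .y = y := by rw [hf.reg .y rfl]; simp [ey₁]
    have eye : τ.r .ye = y + K := by rw [hf.reg .ye rfl]; simp [eye₁]
    refine ⟨by rw [g1, hcτ.hL]; omega, ?_⟩
    refine wp_seq (sweepS_spec hB hcτ ey eye g1 (by omega) (by omega) g2) ?_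
    rintro τ₁ t₂ ⟨k1, k2, k3⟩ hf₂
    have ed : τ₁.r .d = 2 + n := by rw [hf₂.reg .d rfl, g1]
    have eone : τ₁.r .one = 1 := by rw [hf₂.reg .one rfl, hcτ.hone]
    simp only [wp_op, Op.safe, Op.eval, ArithOp.eval, St.set_r, St.set_h, if_true, ed, eone]
    refine ⟨by omega, by omega, k1, g3.trans k2, ?_⟩
    rw [← add_assoc, Finset.sum_range_succ]
    generalize K / (2 + n) = u at *
    omega
  · rintro τ t' hf ⟨g1, g2, g3, g4⟩
    have eL : τ.r .L = L := by rw [hf.reg .L rfl]; simp [hc₁.hL]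
    rw [show 2 + (L - 2) = L by omega] at g1 g2 g4
    refine ⟨by omega, g2, g3, ?_⟩
    rw [Finset.sum_add_distrib, Finset.sum_add_distrib, ← Finset.mul_sum, ← Finset.mul_sum,
      Finset.sum_comm] at g4
    simp only [Finset.sum_const, Finset.card_range, smul_eq_mul] at g4
    have k1 := hB.par.sum_div_le K
    rw [← hB.par.L_eq] at k1
    have k2 : ∑ i ∈ Finset.range K, ∑ d ∈ Finset.range L, (y + i).factorization d ≤
        ∑ i ∈ Finset.range K, 2 * l := by
      refine Finset.sum_le_sum fun i hi => ?_
      rw [Finset.mem_range] at hi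
      have := sum_factorization_lt hB.par h4 (x := y + i) (by omega) (by omega) L
      omega
    have k3 : K * (2 * l) = 2 * L := by rw [hB.par.L_eq]; ring
    simp only [Finset.sum_const, Finset.card_range, smul_eq_mul, k3] at k2
    omega

end

/-! ### Factorization: the large divisors and the output -/

open Stmt in
/-- Record the divisor `d` of `x` if it divides the cofactor of `x`. -/
def visitF : Stmt :=
  sub .p .x .A ;; add .p .p .Bc ;; load .f .p ;; mod .f .f .d ;; add .p .p .L ;;
  ite .f .one (store .p .d) skip

open Stmt in
/-- Output the small prime factors of `x`. -/
def emitS : Stmt :=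
  sub .p .x .y ;; mul .g .p .cap ;; add .p .p .Bn ;; load .n .p ;; add .g .g .Bs ;;
  add .ge .g .n ;;
  loop .g .ge (load .v .g ;; emit .v ;; add .g .g .one)

open Stmt in
/-- Output the large prime factors of `x`. -/
def emitL : Stmt :=
  sub .p .x .A ;; add .p .p .Bc ;; load .c .p ;; add .p .p .L ;; load .b .p ;;
  ite .one .c
    (ite .zero .b
      (div .u .c .b ;;
       ite .b .u (emit .b ;; emit .one ;; emit .u ;; emit .one)
        (ite .u .b (ite .one .u (emit .u ;; emit .one) skip ;; emit .b ;; emit .one)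
          (emit .b ;; emit .two)))
      (emit .c ;; emit .one))
    skip

open Stmt in
/-- Output the factorizations of the numbers from `x` to `z - 1`. -/
def emitB : Stmt :=
  loop .x .z (emit .x ;; emitS ;; emitL ;; emit .zero ;; add .x .x .one)

open Stmt in
/-- Clear the cells for the large divisors. -/
def clearF : Stmt := add .x .Bb .zero ;; loop .x .Bn (store .x .zero ;; add .x .x .one)

open Stmt in
/-- Compute the cofactors. -/
def cofacF : Stmt :=
  add .y .A .zero ;; loop .y .E (add .ye .y .K ;; smallB ;; add .y .y .K)

open Stmt in
/-- Compute the small prime factors once more, and produce the output. -/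
def outF : Stmt :=
  ite .hi .E (add .w .hi .zero) (add .w .E .zero) ;;
  add .y .A .zero ;;
  loop .y .w
    (add .ye .y .K ;; smallB ;;
     ite .w .ye (add .z .w .zero) (add .z .ye .zero) ;; add .x .y .zero ;; emitB ;;
     add .y .y .K)

/-- The treatment of a segment when one factors integers. -/
def factorBody : Stmt := clearF ;; cofacF ;; large visitF ;; outF

/-- The cofactors are correct. -/
def CofOK (A L : ℕ) (h : ℕ → ℕ) : Prop :=
  ∀ x, A ≤ x → x < A + L → h (base + (x - A)) = cofac L x

/-- The divisors that have been recorded are correct. -/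
def BigOK (A L : ℕ) (h : ℕ → ℕ) : Prop :=
  ∀ x, A ≤ x → x < A + L → h (base + L + (x - A)) = 0 ∨
    L ≤ h (base + L + (x - A)) ∧
    h (base + L + (x - A)) * h (base + L + (x - A)) ≤ 4 * (A + L) ∧
    h (base + L + (x - A)) ∣ cofac L x

/-- A large divisor of `x` has been recorded in case that `d` divides the cofactor of `x`. -/
def BigDone (A L d x : ℕ) (h : ℕ → ℕ) : Prop := d ∣ cofac L x → h (base + L + (x - A)) ≠ 0

section
variable {V : Env} {N K l L A y : ℕ}

theorem visitF_spec (h : Par N K l L) (hW : 1000 * N ≤ V.W) (hA : A ≤ 2 * N)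
    (hT : base + 7 * L ≤ V.T) (hH : 1000 * N ≤ V.H) :
    VisitSpec V K l L A visitF (fun h => CofOK A L h ∧ BigOK A L h) (BigDone A L) := by
  refine ⟨?_, ?_⟩
  · intro y h1 h2; simp [visitF, Stmt.wr, h1, h2]
  · rintro σ t d x hc hd hx hLd hdd hdx hAx hxE ⟨hI, hJ⟩
    have hb := base_eq
    have hL8 := h.L_le
    have hL3 := h.three_le_L
    have hN := h.two_le
    have hd10 := Nat.le_mul_self d
    have e1 : x - A + base = base + (x - A) := add_comm _ _
    have e2 : base + (x - A) + L = base + L + (x - A) := by ring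
    simp only [visitF, wp_seq_eq, wp_op, wp_ite, wp_skip, Op.safe, Op.eval, ArithOp.eval, St.set_r,
      reduceCtorEq, if_false, if_true, St.put_h, St.set_h, hd, hx, hc.hA, hc.hBc, hc.hone, hc.hL,
      e1, e2, true_and, hI x hAx hxE]
    refine ⟨by omega, ⟨by omega, by omega⟩, by omega, ?_⟩
    split_ifs with hlt
    · refine ⟨⟨by omega, by omega, by omega⟩, ⟨?_, ?_⟩, ?_, ?_, by omega⟩
      · intro x' h1 h2
        rw [Function.update_of_ne (by omega)]
        exact hI x' h1 h2
      · intro x' h1 h2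
        by_cases hxx : x' = x
        · subst hxx
          rw [Function.update_self]
          exact .inr ⟨hLd, hdd, Nat.dvd_of_mod_eq_zero (by omega)⟩
        · rw [Function.update_of_ne (by omega)]
          exact hJ x' h1 h2
      · intro _
        rw [Function.update_self]
        omega
      · intro d' x' hd' h'
        simp only [Function.update_apply]
        split_ifs
        · omega
        · exact hd' h'
    · refine ⟨⟨hI, hJ⟩, fun h' => absurd ?_ hlt, fun _ _ h => h, by omega⟩
      rw [Nat.mod_eq_zero_of_dvd h']
      exact Nat.one_pos

theorem Outside.big (hB : Blk V N K l L A y) {h h' : ℕ → ℕ} (ho : Outside A K l L y h h') {x : ℕ}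
    (hAx : A ≤ x) (hx : x < A + L) : h' (base + L + (x - A)) = h (base + L + (x - A)) := by
  refine ho _ fun x' h1 h2 h3 => ?_
  have h4 := hB.hy
  have h5 := hB.hye
  unfold Own at h3
  omega

theorem Outside.cof (hB : Blk V N K l L A y) {h h' : ℕ → ℕ} (ho : Outside A K l L y h h') {x : ℕ}
    (hAx : A ≤ x) (hx : x < A + L) (hxy : x < y ∨ y + K ≤ x) :
    h' (base + (x - A)) = h (base + (x - A)) := by
  refine ho _ fun x' h1 h2 h3 => ?_
  have h4 := hB.hy
  unfold Own at h3
  omega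

theorem clearF_spec {t : ℕ} {σ : St} (h : Par N K l L) (hW : 1000 * N ≤ V.W)
    (hc : Ctx K l L A σ) (hT : base + 7 * L ≤ V.T) :
    wp V clearF (fun σ' t' => (∀ i < L, σ'.h (base + L + i) = 0) ∧ t' ≤ t + 4 * L + 3) σ t := by
  have hb := base_eq
  have hL8 := h.L_le
  have hN := h.two_le
  simp only [clearF, wp_seq_eq, wp_op, Op.safe, Op.eval, ArithOp.eval, hc.hBb, hc.hzero,
    Nat.add_zero]
  refine ⟨by omega, ?_⟩
  refine wp_loop_count L (fun n τ t' => τ.r .x = base + L + n ∧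
    (∀ i < n, τ.h (base + L + i) = 0) ∧ t' ≤ t + 1 + 4 * n) ?_ ?_ ?_
  · exact ⟨by simp, by simp, by omega⟩
  · rintro n hn τ t' hf ⟨h1, h2, h3⟩
    have hcτ : Ctx K l L A τ := (hc.of_eq (by simp [ctxRegs])).frame hf (by decide)
    simp only [wp_seq_eq, wp_op, Op.safe, Op.eval, ArithOp.eval, St.set_r, St.put_r, St.put_h,
      St.set_h, if_true, h1, hcτ.hBn, hcτ.hzero, hcτ.hone]
    refine ⟨by omega, ⟨by omega, by omega, by omega⟩, by omega, by omega, ?_, by omega⟩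
    intro i hi
    simp only [Function.update_apply]
    split_ifs
    · rfl
    · exact h2 i (by omega)
  · rintro τ t' hf ⟨h1, h2, h3⟩
    have hcτ : Ctx K l L A τ := (hc.of_eq (by simp [ctxRegs])).frame hf (by decide)
    exact ⟨by rw [h1, hcτ.hBn]; omega, h2, by omega⟩

theorem Blk.of_lt (h : Par N K l L) (hW : 1000 * N ≤ V.W) (hT : base + 7 * L ≤ V.T)
    (hH : 1000 * N ≤ V.H) (hA1 : 1 ≤ A) (hA : A ≤ 2 * N) {j : ℕ} (hj : j < l) :
    Blk V N K l L A (A + j * K) := by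
  refine ⟨h, hW, hT, hH, hA1, hA, by omega, ?_⟩
  have h1 : (j + 1) * K ≤ l * K := Nat.mul_le_mul_right _ hj
  have h2 : (j + 1) * K = j * K + K := by ring
  have h3 : l * K = L := by rw [h.L_eq, mul_comm]
  omega

theorem cofacF_spec {t : ℕ} {σ : St} (h : Par N K l L) (hW : 1000 * N ≤ V.W)
    (hc : Ctx K l L A σ) (hT : base + 7 * L ≤ V.T) (hH : 1000 * N ≤ V.H) (hA1 : 1 ≤ A)
    (hA : A ≤ 2 * N) :
    wp V cofacF (fun σ' t' => CofOK A L σ'.h ∧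
      (∀ x, A ≤ x → x < A + L → σ'.h (base + L + (x - A)) = σ.h (base + L + (x - A))) ∧
      t' ≤ t + 300 * (L * l)) σ t := by
  have hL8 := h.L_le
  have hL3 := h.three_le_L
  have hN := h.two_le
  have hK1 := h.one_le_K
  have hl3 := h.three_le_l
  have hlK : l * K = L := by rw [h.L_eq, mul_comm]
  simp only [cofacF, wp_seq_eq, wp_op, Op.safe, Op.eval, ArithOp.eval, hc.hA, hc.hzero,
    Nat.add_zero]
  refine ⟨by omega, ?_⟩
  refine wp_loop_count l (fun n τ t' => τ.r .y = A + n * K ∧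
    (∀ x, A ≤ x → x < A + n * K → τ.h (base + (x - A)) = cofac L x) ∧
    (∀ x, A ≤ x → x < A + L → τ.h (base + L + (x - A)) = σ.h (base + L + (x - A))) ∧
    t' ≤ t + 1 + 204 * (L * n)) ?_ ?_ ?_
  · exact ⟨by simp, fun x h1 h2 => by omega, fun _ _ _ => rfl, by omega⟩
  · rintro n hn τ t' hf ⟨h1, h2, h3, h4⟩
    have hcτ : Ctx K l L A τ := (hc.of_eq (by simp [ctxRegs])).frame hf (by decide)
    have hB := Blk.of_lt h hW hT hH hA1 hA hn
    have hye := hB.hye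
    have hnext : A + (n + 1) * K = A + n * K + K := by ring
    have hL : L * (n + 1) = L * n + L := by ring
    rw [hnext]
    generalize A + n * K = y at *
    have hy := hB.hy
    rw [h1, hcτ.hE, wp_seq_eq, wp_op]
    refine ⟨by omega, ?_, ?_⟩
    · simp only [Op.safe, h1, hcτ.hK]; omega
    refine wp_seq (smallB_spec hB (hcτ.of_eq (by simp [ctxRegs, Op.eval])) (by simp [Op.eval, h1])
      (by simp [Op.eval, ArithOp.eval, h1, hcτ.hK])) ?_
    rintro τ₁ t₁ ⟨g1, g2, g3⟩ hf₁
    have ey : τ₁.r .y = y := by rw [hf₁.reg .y rfl]; simp [Op.eval, h1]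
    have eK : τ₁.r .K = K := by rw [hf₁.reg .K rfl]; simp [Op.eval, hcτ.hK]
    simp only [wp_op, Op.safe, Op.eval, ArithOp.eval, St.set_r, St.set_h, if_true, ey, eK]
    refine ⟨by omega, trivial, ?_, ?_, by omega⟩
    · intro x h5 h6
      rcases lt_or_ge x y with h7 | h7
      · rw [g2.cof hB h5 (by omega) (.inl h7)]
        exact h2 x h5 h7
      · exact (g1 x h7 h6).cof
    · intro x h5 h6
      rw [g2.big hB h5 h6]
      exact h3 x h5 h6
  · rintro τ t' hf ⟨h1, h2, h3, h4⟩
    have hcτ : Ctx K l L A τ := (hc.of_eq (by simp [ctxRegs])).frame hf (by decide)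
    rw [hlK] at h1 h2
    have : L * 3 ≤ L * l := Nat.mul_le_mul_left _ hl3
    exact ⟨by rw [h1, hcτ.hE]; omega, h2, h3, by omega⟩

theorem emitS_spec {t x : ℕ} {σ : St} (hB : Blk V N K l L A y) (hc : Ctx K l L A σ)
    (hy : σ.r .y = y) (hx : σ.r .x = x) (hyx : y ≤ x) (hxy : x < y + K)
    (hI : Cell A K l L y L x σ.h) :
    wp V emitS (fun σ' t' => σ'.o = σ.o ++ flat (facs L x) ∧ t' ≤ t + 8 + 20 * l) σ t := by
  have hb := base_eq
  have h1 := hB.hy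
  have h2 := hB.hye
  have h3 := hB.one_le
  have h4 := hB.le
  have h5 := hB.hT
  have h6 := hB.hW
  have h7 := hB.par.L_le
  have h8 := hB.par.K_le_L
  have h9 := hB.slot_le hxy hyx
  have h10 := length_flat_facs_lt hB.par h4 (x := x) (by omega) (by omega) L
  have h12 := hB.par.two_le
  have hlen := hI.length
  have hfac := hI.fac
  have e2 : x - y + (base + 2 * L) = base + 2 * L + (x - y) := add_comm _ _
  generalize hS : (x - y) * (4 * l) = S at *
  generalize hn : (flat (facs L x)).length = n at *
  have e3 : S + (base + 2 * L + K) = base + 2 * L + K + S := by ring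
  rw [hlen] at hfac
  simp only [emitS, wp_seq_eq, wp_op, Op.safe, Op.eval, ArithOp.eval, St.set_r, St.set_h,
    reduceCtorEq, if_false, if_true, hx, hy, hc.hcap, hc.hBn, hc.hBs, hS, e2, e3, hlen, true_and]
  refine ⟨by omega, by omega, ⟨by omega, by omega⟩, by omega, by omega, ?_⟩
  refine wp_loop_count n (fun i τ t' => τ.r .g = base + 2 * L + K + S + i ∧
    τ.o = σ.o ++ (List.range i).map (fun i => σ.h (base + 2 * L + K + S + i)) ∧
    t' ≤ t + 6 + 5 * i) ?_ ?_ ?_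
  · exact ⟨by simp, by simp, by omega⟩
  · rintro i hi τ t' hf ⟨g1, g2, g3⟩
    have ege : τ.r .ge = base + 2 * L + K + S + n := by rw [hf.reg .ge rfl]; simp
    have eone : τ.r .one = 1 := by rw [hf.reg .one rfl]; simp [hc.hone]
    have eh : τ.h = σ.h := by rw [hf.heap rfl]; simp
    simp only [wp_seq_eq, wp_op, Op.safe, Op.eval, ArithOp.eval, St.set_r, St.set_o, St.emit_r,
      St.emit_o, reduceCtorEq, if_false, if_true, g1, ege, eone, eh, g2, true_and]
    refine ⟨by omega, ⟨by omega, by omega⟩, by omega, by omega, ?_, by omega⟩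
    rw [List.range_succ, List.map_append, List.append_assoc]
    rfl
  · rintro τ t' hf ⟨g1, g2, g3⟩
    have ege : τ.r .ge = base + 2 * L + K + S + n := by rw [hf.reg .ge rfl]; simp
    rw [hfac] at g2
    exact ⟨by omega, g2, by omega⟩

/-- If a number without prime factors `< L` is less than `L ^ 3`, then it is the product of at most
two primes; a divisor `b` with `L ≤ b < L ^ 2` is one of them. -/
theorem Rough.prime_and_div {c b : ℕ} (h : Rough L c) (hc : 0 < c) (hcL : c < L * L * L)
    (hL : 2 ≤ L) (hb : b ∣ c) (hLb : L ≤ b) (hbL : b < L * L) :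
    b.Prime ∧ (c / b = 1 ∨ (c / b).Prime) := by
  refine ⟨(h.of_dvd hb).prime (by omega) hbL, ?_⟩
  obtain ⟨u, rfl⟩ := hb
  rw [Nat.mul_div_cancel_left _ (by omega)]
  rcases Nat.lt_or_ge 1 u with h1 | h1
  · refine .inr ((h.of_dvd (Dvd.intro_left b rfl)).prime h1 ?_)
    by_contra h2
    have : L * (L * L) ≤ b * u := Nat.mul_le_mul hLb (by omega)
    have e : L * (L * L) = L * L * L := by ring
    omega
  · left
    have : u ≠ 0 := by rintro rfl; simp at hc
    omega

/-- One recorded divisor `b` of the cofactor `c` suffices: if none is recorded and `c ≠ 1`, then `c`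
is prime, since otherwise its least prime factor would have been recorded; if one is recorded, then
`b` is prime, and `c / b` is `1` or prime. -/
theorem emitL_spec {t x c b : ℕ} {σ : St} (h : Par N K l L) (hW : 1000 * N ≤ V.W)
    (hc : Ctx K l L A σ) (hT : base + 7 * L ≤ V.T) (hA : A ≤ 2 * N)
    (hx : σ.r .x = x) (hAx : A ≤ x) (hxE : x < A + L)
    (ec : σ.h (base + (x - A)) = c) (eb : σ.h (base + L + (x - A)) = b)
    (hcx : c ≤ x) (hc0 : 0 < c) (hr : Rough L c)
    (hb : b = 0 ∨ L ≤ b ∧ b * b ≤ 4 * (A + L) ∧ b ∣ c)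
    (hdone : ∀ d, L ≤ d → d * d < A + L → d ∣ c → b ≠ 0) :
    wp V emitL (fun σ' t' => σ'.o = σ.o ++ flat (facsTwo c) ∧ t' ≤ t + 20) σ t := by
  have hb' := base_eq
  have hL8 := h.L_le
  have hL3 := h.three_le_L
  have hN := h.two_le
  have hend := h.end_le_cube
  have e1 : x - A + base = base + (x - A) := add_comm _ _
  have e2 : base + (x - A) + L = base + L + (x - A) := by ring
  have big : 0 < b → b.Prime ∧ 2 ≤ b ∧ (c / b = 1 ∨ (c / b).Prime) ∧ b * (c / b) = c := by
    intro hb0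
    obtain ⟨hLb, hbb, hbc⟩ := hb.resolve_left (by omega)
    obtain ⟨hbp, hu⟩ : b.Prime ∧ (c / b = 1 ∨ (c / b).Prime) := by
      refine hr.prime_and_div hc0 (by omega) (by omega) hbc hLb ?_
      by_contra hcon
      have k1 : L * L * (L * L) ≤ b * b := Nat.mul_le_mul (by omega) (by omega)
      have k2 : 3 * (L * L * L) ≤ L * (L * L * L) := Nat.mul_le_mul_right _ hL3
      have e : L * L * (L * L) = L * (L * L * L) := by ring
      omega
    exact ⟨hbp, hbp.two_le, hu, Nat.mul_div_cancel' hbc⟩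
  simp only [emitL, wp_seq_eq, wp_op, wp_ite, wp_skip, Op.safe, Op.eval, ArithOp.eval, St.set_r,
    St.set_h, St.set_o, St.emit_r, St.emit_o, reduceCtorEq, if_false, if_true, hx, hc.hA, hc.hBc,
    hc.hL, hc.hone, hc.htwo, hc.hzero, e1, e2, ec, eb, true_and]
  refine ⟨by omega, ⟨by omega, by omega⟩, by omega, ⟨by omega, by omega⟩, ?_⟩
  split_ifs with g1 g2 g3 g4 g5
  · obtain ⟨hbp, hb2, hu, hmul⟩ := big g2
    generalize c / b = u at *
    have hup := hu.resolve_left (by omega)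
    rw [← hmul, facsTwo_mul hbp hup g3]
    exact ⟨by simp [flat], by omega⟩
  · obtain ⟨hbp, hb2, hu, hmul⟩ := big g2
    generalize c / b = u at *
    have hup := hu.resolve_left (by omega)
    rw [← hmul, mul_comm, facsTwo_mul hup hbp g4]
    exact ⟨by simp [flat], by omega⟩
  · obtain ⟨hbp, hb2, hu, hmul⟩ := big g2
    generalize c / b = u at *
    have hu1 : u = 1 := hu.resolve_right fun hp => g5 hp.one_lt
    rw [← hmul, hu1, mul_one, facsTwo_prime hbp]
    exact ⟨by simp [flat], by omega⟩
  · obtain ⟨hbp, hb2, hu, hmul⟩ := big g2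
    generalize c / b = u at *
    obtain rfl : u = b := by omega
    rw [← hmul, facsTwo_mul_self hbp]
    exact ⟨by simp [flat], by omega⟩
  · have hcp : c.Prime := by
      by_contra hp
      have k1 := hr _ (Nat.minFac_prime (by omega)) (Nat.minFac_dvd c)
      have k2 := Nat.minFac_sq_le_self hc0 hp
      rw [sq] at k2
      exact hdone _ k1 (by omega) (Nat.minFac_dvd c) (by omega)
    rw [facsTwo_prime hcp]
    exact ⟨by simp [flat], by omega⟩
  · obtain rfl : c = 1 := by omega
    exact ⟨by simp [flat, facsTwo], by omega⟩

/-- All large divisors have been tried. -/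
def AllBig (A L : ℕ) (h : ℕ → ℕ) : Prop :=
  BigOK A L h ∧ ∀ d x, L ≤ d → d * d < A + L → d ∣ x → A ≤ x → x < A + L → BigDone A L d x h

theorem emitB_spec {t z : ℕ} {σ : St} (hB : Blk V N K l L A y) (hc : Ctx K l L A σ)
    (hy : σ.r .y = y) (hx : σ.r .x = y) (hz : σ.r .z = z) (hyz : y ≤ z) (hzy : z ≤ y + K)
    (hI : ∀ x, y ≤ x → x < y + K → Cell A K l L y L x σ.h) (hJ : AllBig A L σ.h) :
    wp V emitB (fun σ' t' => σ'.o = σ.o ++ (List.range' y (z - y)).flatMap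
      (fun n => encodeFactored n (facsAll L n)) ∧ t' ≤ t + 2 + K * (40 + 20 * l)) σ t := by
  have h1 := hB.hy
  have h2 := hB.hye
  have h3 := hB.one_le
  have h4 := hB.le
  have h6 := hB.hW
  have h7 := hB.par.L_le
  have h12 := hB.par.two_le
  refine wp_loop_count (z - y) (fun n τ t' => τ.r .x = y + n ∧ τ.h = σ.h ∧
    τ.o = σ.o ++ (List.range' y n).flatMap (fun n => encodeFactored n (facsAll L n)) ∧
    t' ≤ t + n * (40 + 20 * l)) ?_ ?_ ?_
  · exact ⟨by simp [hx], rfl, by simp, by omega⟩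
  · rintro n hn τ t' hf ⟨g1, g2, g3, g4⟩
    have hcτ : Ctx K l L A τ := hc.frame hf (by decide)
    have ey : τ.r .y = y := by rw [hf.reg .y rfl, hy]
    have ez : τ.r .z = z := by rw [hf.reg .z rfl, hz]
    have hmul : (n + 1) * (40 + 20 * l) = n * (40 + 20 * l) + 40 + 20 * l := by ring
    refine ⟨by omega, ?_⟩
    rw [wp_seq_eq, wp_op]
    refine ⟨trivial, ?_⟩
    simp only [Op.eval]
    have hcell := hI (y + n) (by omega) (by omega)
    refine wp_seq (emitS_spec (x := y + n) hB (hcτ.of_eq (by simp [ctxRegs])) (by simp [ey])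
      (by simp [g1]) (by omega) (by omega) (by simpa [g2] using hcell)) ?_
    rintro τ₁ t₁ ⟨k1, k2⟩ hf₁
    have hc₁ : Ctx K l L A τ₁ := (hcτ.of_eq (by simp [ctxRegs])).frame hf₁ (by decide)
    have ex₁ : τ₁.r .x = y + n := by rw [hf₁.reg .x rfl]; simp [g1]
    have eh₁ : τ₁.h = σ.h := by rw [hf₁.heap rfl]; simp [g2]
    refine wp_seq (emitL_spec (x := y + n) (c := cofac L (y + n)) hB.par h6 hc₁ hB.hT h4 ex₁
      (by omega) (by omega) (by rw [eh₁, hcell.cof]) rfl (cofac_le (by omega) _)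
      (cofac_pos (by omega) _) (rough_cofac (by omega) _) (by
        rw [eh₁]; exact hJ.1 _ (by omega) (by omega)) (by
        intro d d1 d2 d3
        rw [eh₁]
        exact hJ.2 d (y + n) d1 d2 (d3.trans (cofac_dvd _ _)) (by omega) (by omega) d3)) ?_
    rintro τ₂ t₂ ⟨l1, l2⟩ hf₂
    have ex₂ : τ₂.r .x = y + n := by rw [hf₂.reg .x rfl, ex₁]
    have eh₂ : τ₂.h = σ.h := by rw [hf₂.heap rfl, eh₁]
    have e0 : τ₂.r .zero = 0 := by rw [hf₂.reg .zero rfl, hc₁.hzero]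
    have e1 : τ₂.r .one = 1 := by rw [hf₂.reg .one rfl, hc₁.hone]
    simp only [wp_seq_eq, wp_op, Op.safe, Op.eval, ArithOp.eval, St.set_r, St.set_h, St.set_o,
      St.emit_r, St.emit_h, St.emit_o, if_true, ex₂, eh₂, e0, e1, true_and]
    refine ⟨by omega, by omega, ?_, by omega⟩
    rw [l1, k1, St.emit_o, g1, g3, List.range'_1_concat, List.flatMap_append]
    simp [encodeFactored, facsAll, flat]
  · rintro τ t' hf ⟨g1, g2, g3, g4⟩
    have ez : τ.r .z = z := by rw [hf.reg .z rfl, hz]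
    have hmul : (z - y) * (40 + 20 * l) ≤ K * (40 + 20 * l) := Nat.mul_le_mul_right _ (by omega)
    exact ⟨by omega, g3, by omega⟩

theorem outF_spec {t hi : ℕ} {σ : St} (h : Par N K l L) (hW : 1000 * N ≤ V.W)
    (hc : Ctx K l L A σ) (hT : base + 7 * L ≤ V.T) (hH : 1000 * N ≤ V.H) (hA1 : 1 ≤ A)
    (hA : A ≤ 2 * N) (hhi : σ.r .hi = hi) (hJ : AllBig A L σ.h) :
    wp V outF (fun σ' t' => σ'.o = σ.o ++ (List.range' A (min (A + L) hi - A)).flatMap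
      (fun n => encodeFactored n (facsAll L n)) ∧ t' ≤ t + 300 * (L * l)) σ t := by
  have hL8 := h.L_le
  have hL3 := h.three_le_L
  have hN := h.two_le
  have hK1 := h.one_le_K
  have hl3 := h.three_le_l
  have hlK : l * K = L := by rw [h.L_eq, mul_comm]
  obtain ⟨w, hw⟩ : ∃ w, w = min (A + L) hi := ⟨_, rfl⟩
  rw [← hw]
  have key : ∀ τ₀ t₀, Ctx K l L A τ₀ → τ₀.h = σ.h → τ₀.o = σ.o → τ₀.r .w = w → t₀ ≤ t + 3 →
      wp V (Stmt.add .y .A .zero ;; Stmt.loop .y .w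
        (Stmt.add .ye .y .K ;; smallB ;;
          Stmt.ite .w .ye (Stmt.add .z .w .zero) (Stmt.add .z .ye .zero) ;;
          Stmt.add .x .y .zero ;; emitB ;; Stmt.add .y .y .K))
        (fun σ' t' => σ'.o = σ.o ++ (List.range' A (w - A)).flatMap
          (fun n => encodeFactored n (facsAll L n)) ∧ t' ≤ t + 300 * (L * l)) τ₀ t₀ := by
    intro τ₀ t₀ hc₀ eh eo ew ht₀
    simp only [wp_seq_eq, wp_op, Op.safe, Op.eval, ArithOp.eval, hc₀.hA, hc₀.hzero, Nat.add_zero]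
    refine ⟨by omega, ?_⟩
    refine wp_loop (fun τ t' => ∃ n ≤ l, τ.r .y = A + n * K ∧ AllBig A L τ.h ∧
      τ.o = σ.o ++ (List.range' A (min w (A + n * K) - A)).flatMap
        (fun n => encodeFactored n (facsAll L n)) ∧
      t' ≤ t + 4 + 270 * (L * n)) (fun τ => w - τ.r .y) ?_ ?_ ?_
    · exact ⟨0, by omega, by simp, by simpa [eh] using hJ, by simp [eo], by omega⟩
    · rintro τ t' hf ⟨n, hnl, h1, h2, h3, h4⟩ hlt
      have hcτ : Ctx K l L A τ := (hc₀.of_eq (by simp [ctxRegs])).frame hf (by decide)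
      have ewτ : τ.r .w = w := by rw [hf.reg .w rfl]; simp [ew]
      have hn : n < l := by
        refine lt_of_le_of_ne hnl ?_
        rintro rfl
        rw [hlK] at h1
        omega
      have hB := Blk.of_lt h hW hT hH hA1 hA hn
      have hye := hB.hye
      have hnext : A + (n + 1) * K = A + n * K + K := by ring
      have hL : L * (n + 1) = L * n + L := by ring
      have hKl : K * (40 + 20 * l) = 40 * K + 20 * L := by rw [h.L_eq]; ring
      have hK3 : K * 3 ≤ L := by rw [h.L_eq]; exact Nat.mul_le_mul_left _ hl3
      generalize A + n * K = y at *
      have hy := hB.hy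
      rw [h1, ewτ] at hlt
      rw [wp_seq_eq, wp_op]
      refine ⟨?_, ?_⟩
      · simp only [Op.safe, h1, hcτ.hK]; omega
      refine wp_seq (smallB_spec hB (hcτ.of_eq (by simp [ctxRegs, Op.eval]))
        (by simp [Op.eval, h1]) (by simp [Op.eval, ArithOp.eval, h1, hcτ.hK])) ?_
      rintro τ₁ t₁ ⟨g1, g2, g3⟩ hf₁
      have hc₁ : Ctx K l L A τ₁ := (hcτ.of_eq (by simp [ctxRegs, Op.eval])).frame hf₁ (by decide)
      have ey : τ₁.r .y = y := by rw [hf₁.reg .y rfl]; simp [Op.eval, h1]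
      have eye : τ₁.r .ye = y + K := by
        rw [hf₁.reg .ye rfl]; simp [Op.eval, ArithOp.eval, h1, hcτ.hK]
      have ew₁ : τ₁.r .w = w := by rw [hf₁.reg .w rfl]; simp [Op.eval, ewτ]
      have eo₁ : τ₁.o = τ.o := by rw [hf₁.out rfl]; simp [Op.eval]
      have hJ₁ : AllBig A L τ₁.h := by
        have e : ∀ x, A ≤ x → x < A + L →
            τ₁.h (base + L + (x - A)) = τ.h (base + L + (x - A)) := fun x k1 k2 =>
          (g2.big hB k1 k2).trans (by simp [Op.eval])
        refine ⟨fun x k1 k2 => ?_, fun d x k3 k4 k5 k1 k2 => ?_⟩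
        · rw [e x k1 k2]; exact h2.1 x k1 k2
        · unfold BigDone; rw [e x k1 k2]; exact h2.2 d x k3 k4 k5 k1 k2
      have fin : ∀ τ₂ t₂, Ctx K l L A τ₂ → τ₂.h = τ₁.h → τ₂.o = τ₁.o → τ₂.r .y = y →
          τ₂.r .x = y → τ₂.r .z = min w (y + K) → t₂ ≤ t₁ + 4 →
          wp V (emitB ;; Stmt.add .y .y .K) (fun τ' t'' => (∃ n ≤ l, τ'.r .y = A + n * K ∧
            AllBig A L τ'.h ∧ τ'.o = σ.o ++ (List.range' A (min w (A + n * K) - A)).flatMap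
              (fun n => encodeFactored n (facsAll L n)) ∧
            t'' + 1 ≤ t + 4 + 270 * (L * n)) ∧ w - τ'.r .y < w - y) τ₂ t₂ := by
        intro τ₂ t₂ hc₂ eh₂ eo₂ ey₂ ex₂ ez₂ ht₂
        refine wp_seq (emitB_spec hB hc₂ ey₂ ex₂ ez₂ (by omega) (by omega)
          (by rw [eh₂]; exact g1) (by rw [eh₂]; exact hJ₁)) ?_
        rintro τ₃ t₃ ⟨k1, k2⟩ hf₃
        have ey₃ : τ₃.r .y = y := by rw [hf₃.reg .y rfl, ey₂]
        have eK₃ : τ₃.r .K = K := by rw [hf₃.reg .K rfl, hc₂.hK]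
        have eh₃ : τ₃.h = τ₁.h := by rw [hf₃.heap rfl, eh₂]
        simp only [wp_op, Op.safe, Op.eval, ArithOp.eval, St.set_r, St.set_h, St.set_o, if_true,
          ey₃, eK₃, eh₃]
        refine ⟨by omega, ⟨n + 1, hn, by omega, hJ₁, ?_, by omega⟩, by omega⟩
        rw [k1, eo₂, eo₁, h3, List.append_assoc, ← List.flatMap_append, hnext]
        congr 2
        rw [show min w (y + K) - A = (min w y - A) + (min w (y + K) - y) by omega,
          ← List.range'_append_1]
        congr 2
        omega
      generalize (emitB ;; _) = rest at fin ⊢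
      rw [h1]
      simp only [wp_seq_eq, wp_op, wp_ite, Op.safe, Op.eval, ArithOp.eval, St.set_r,
        reduceCtorEq, if_false, ew₁, eye, hc₁.hzero, ey, Nat.add_zero]
      split_ifs with k1
      · exact ⟨by omega, by omega, fin _ _ (hc₁.of_eq (by simp [ctxRegs])) rfl rfl (by simp [ey])
          (by simp) (by simp; omega) (by omega)⟩
      · exact ⟨by omega, by omega, fin _ _ (hc₁.of_eq (by simp [ctxRegs])) rfl rfl (by simp [ey])
          (by simp) (by simp; omega) (by omega)⟩
    · rintro τ t' hf ⟨n, hnl, h1, h2, h3, h4⟩ hlt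
      have ewτ : τ.r .w = w := by rw [hf.reg .w rfl]; simp [ew]
      rw [h1, ewτ] at hlt
      rw [min_eq_left (by omega)] at h3
      have k1 : L * n ≤ L * l := Nat.mul_le_mul_left _ hnl
      have k2 : L * 3 ≤ L * l := Nat.mul_le_mul_left _ hl3
      exact ⟨h3, by omega⟩
  unfold outF
  generalize (Stmt.add .y .A .zero ;; _) = rest at key ⊢
  simp only [wp_seq_eq, wp_op, wp_ite, Op.safe, Op.eval, ArithOp.eval, hhi, hc.hzero, hc.hE,
    Nat.add_zero]
  split_ifs with h5
  · exact ⟨by omega, key _ _ (hc.of_eq (by simp [ctxRegs])) rfl rfl (by simp; omega) (by omega)⟩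
  · exact ⟨by omega, key _ _ (hc.of_eq (by simp [ctxRegs])) rfl rfl (by simp; omega) (by omega)⟩

theorem factorBody_spec {lo hi : ℕ} (h : Par N K l L) (hW : 1000 * N ≤ V.W)
    (hT : base + 7 * L ≤ V.T) (hH : 1000 * N ≤ V.H) (hlo : 1 ≤ lo) :
    SegSpec V N K l L lo hi factorBody (fun n => encodeFactored n (facsAll L n)) 71000 := by
  have hl3 := h.three_le_l
  have hL3 := h.three_le_L
  refine ⟨by decide, fun A σ t hc hhi hloA hA _ => ?_⟩
  have hLl : L * 3 ≤ L * l := Nat.mul_le_mul_left _ hl3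
  refine wp_seq (clearF_spec h hW hc hT) ?_
  rintro σ₁ t₁ ⟨f1, ht₁⟩ hf₁
  have hc₁ := hc.frame hf₁ (by decide)
  refine wp_seq (cofacF_spec h hW hc₁ hT hH (by omega) hA) ?_
  rintro σ₂ t₂ ⟨f2, f2', ht₂⟩ hf₂
  have hc₂ := hc₁.frame hf₂ (by decide)
  have hBig : BigOK A L σ₂.h := fun x h1 h2 => .inl (by rw [f2' x h1 h2, f1 _ (by omega)])
  refine wp_seq (large_spec h hW (visitF_spec h hW hA hT hH) hc₂ hA ⟨f2, hBig⟩) ?_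
  rintro σ₃ t₃ ⟨⟨-, f3⟩, f4, ht₃⟩ hf₃
  have hc₃ := hc₂.frame hf₃ (by decide)
  have ehi : σ₃.r .hi = hi := by
    rw [hf₃.reg .hi (by decide), hf₂.reg .hi (by decide), hf₁.reg .hi (by decide), hhi]
  refine wp_conseq (outF_spec h hW hc₃ hT hH (by omega) hA ehi ⟨f3, f4⟩) ?_
  rintro σ₄ t₄ ⟨g1, g2⟩
  refine ⟨?_, by omega⟩
  rw [g1, hf₃.out (by decide), hf₂.out (by decide), hf₁.out (by decide)]

end

/-! ### Estimates -/

/-- The length of the segments, up to a constant. -/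
noncomputable def scale (N : ℕ) : ℝ := (N : ℝ) ^ (1 / 3 : ℝ) * Real.log N ^ (2 / 3 : ℝ)

theorem log_ge {N : ℕ} (hN : 2 ≤ N) : 0.69 ≤ Real.log N := by
  have h1 := Real.log_two_gt_d9
  have h2 : Real.log 2 ≤ Real.log N := Real.log_le_log (by norm_num) (by exact_mod_cast hN)
  linarith

theorem scale_nonneg (N : ℕ) : 0 ≤ scale N := by
  have := Real.log_natCast_nonneg N
  unfold scale; positivity

theorem scale_cube {N : ℕ} : scale N ^ 3 = N * Real.log N ^ 2 := by
  have := Real.log_natCast_nonneg N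
  rw [scale, mul_pow, ← Real.rpow_natCast, ← Real.rpow_natCast, ← Real.rpow_mul (by positivity),
    ← Real.rpow_mul this]
  norm_num

theorem le_of_cube_le {a b : ℝ} (hb : 0 ≤ b) (h : a ^ 3 ≤ b ^ 3) : a ≤ b := by
  by_contra hcon
  have : b ^ 3 < a ^ 3 := pow_lt_pow_left₀ (not_le.1 hcon) hb (by norm_num)
  linarith

theorem log_le_scale {N : ℕ} (hN : 2 ≤ N) : Real.log N ≤ scale N := by
  have h1 := log_ge hN
  have h2 : Real.log N ≤ N := (Real.log_le_sub_one_of_pos (by positivity)).trans (by linarith)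
  refine le_of_cube_le (scale_nonneg N) ?_
  rw [scale_cube, pow_succ']
  exact mul_le_mul_of_nonneg_right h2 (by positivity)

theorem scale_le {N : ℕ} (hN : 2 ≤ N) : scale N ≤ N := by
  have h1 := log_ge hN
  have h2 : Real.log N ≤ N := (Real.log_le_sub_one_of_pos (by positivity)).trans (by linarith)
  refine le_of_cube_le (by positivity) ?_
  rw [scale_cube, pow_succ' (N : ℝ) 2]
  gcongr

theorem Par.l_le_log {N K l L : ℕ} (h : Par N K l L) : (l : ℝ) ≤ 5 * Real.log N := by
  have h1 := log_ge h.two_le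
  have h2 := Real.log_two_gt_d9
  have h3 : ((2 : ℝ) ^ (l - 2)) ≤ N := by exact_mod_cast h.pow_le
  have h4 := Real.log_le_log (by positivity) h3
  rw [Real.log_pow, Nat.cast_sub (by have := h.three_le_l; omega)] at h4
  have h5 : (3 : ℝ) ≤ l := by exact_mod_cast h.three_le_l
  push_cast at h4
  nlinarith

theorem Par.L_le_scale {N K l L : ℕ} (h : Par N K l L) : (L : ℝ) ≤ 6 * scale N := by
  have h1 := h.l_le_log
  have h2 := scale_nonneg N
  refine le_of_cube_le (by positivity) ?_
  rw [mul_pow, scale_cube]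
  have h3 : (L : ℝ) ^ 3 = (K * K * K * l) * l ^ 2 := by rw [h.L_eq]; push_cast; ring
  have h4 : (K * K * K * l : ℝ) ≤ 8 * N := by exact_mod_cast h.cube_le
  rw [h3]
  calc (K * K * K * l : ℝ) * l ^ 2 ≤ (8 * N) * (5 * Real.log N) ^ 2 := by gcongr
    _ ≤ _ := by
      have : 0 ≤ N * Real.log N ^ 2 := by positivity
      nlinarith

theorem cellBits_le_log {m : ℕ} (hm : 1 ≤ m) : (cellBits m : ℝ) ≤ 1 + Real.log m / Real.log 2 := by
  have h1 : 1 ≤ m.size := Nat.size_pos.2 hm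
  have h2 : 2 ^ (m.size - 1) ≤ m := Nat.lt_size.1 (by omega)
  have h3 : ((2 : ℝ) ^ (m.size - 1)) ≤ m := by exact_mod_cast h2
  have h4 := Real.log_le_log (by positivity) h3
  rw [Real.log_pow, Nat.cast_sub h1] at h4
  have h5 : 0 < Real.log 2 := Real.log_pos (by norm_num)
  rw [cellBits, max_eq_right h1]
  have h6 := (le_div_iff₀ h5).2 h4
  push_cast at h6
  linarith

theorem cellBits_thousand_mul_le {N : ℕ} (hN : 2 ≤ N) :
    (cellBits (1000 * N) : ℝ) ≤ 20 * Real.log N := by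
  have h1 := cellBits_le_log (m := 1024 * N) (by omega)
  have h2 : (cellBits (1000 * N) : ℝ) ≤ cellBits (1024 * N) := by
    exact_mod_cast cellBits_mono (by omega)
  have h3 : Real.log ((1024 * N : ℕ) : ℝ) = 10 * Real.log 2 + Real.log N := by
    push_cast
    rw [Real.log_mul (by norm_num) (by positivity), show (1024 : ℝ) = 2 ^ 10 by norm_num,
      Real.log_pow]
    norm_num
  have h4 := Real.log_two_gt_d9
  have h5 := log_ge hN
  have h6 : Real.log N / Real.log 2 ≤ 2 * Real.log N := by
    rw [div_le_iff₀ (by linarith)]; nlinarith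
  rw [h3, add_div, mul_div_cancel_right₀ _ (by linarith)] at h1
  linarith

/-- The length of the encoding of a factorization. -/
theorem sum_cellBits_encodeFactored_le {n : ℕ} (hn : 1 ≤ n) {F : List (ℕ × ℕ)}
    (hF : IsFactorization n F) :
    (((encodeFactored n F).map cellBits).sum : ℝ) ≤ 2 + 4 * (Real.log n / Real.log 2) := by
  have hlog2 : 0 < Real.log 2 := Real.log_pos (by norm_num)
  obtain ⟨hnd, hmem⟩ := hF
  have h1 : (((encodeFactored n F).map cellBits).sum : ℝ) =
      cellBits n + (F.map fun pk => (cellBits pk.1 + cellBits pk.2 : ℝ)).sum + 1 := by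
    have h2 : ∀ F : List (ℕ × ℕ), (((F.flatMap fun pk => [pk.1, pk.2]).map cellBits).sum : ℝ) =
        (F.map fun pk => (cellBits pk.1 + cellBits pk.2 : ℝ)).sum := by
      intro F
      induction F with
      | nil => simp
      | cons a F ih =>
        simp only [List.flatMap_cons, List.cons_append, List.nil_append, List.map_cons,
          List.sum_cons, Nat.cast_add, ih]
        ring
    rw [← h2]
    have h0 : cellBits 0 = 1 := by simp [cellBits]
    simp only [encodeFactored, List.map_append, List.map_cons, List.cons_append, List.sum_cons,
      List.sum_append, List.map_nil, List.sum_nil, h0]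
    push_cast
    ring
  have h3 : (F.map fun pk => (cellBits pk.1 + cellBits pk.2 : ℝ)).sum ≤
      (F.map fun pk => 3 * (pk.2 * Real.log pk.1 / Real.log 2)).sum := by
    refine List.sum_le_sum ?_
    rintro ⟨p, k⟩ hpk
    obtain ⟨hp, hpn, hk⟩ := (hmem p k).1 hpk
    have := Fact.mk hp
    have hk1 : 1 ≤ k := by rw [hk]; exact one_le_padicValNat_of_dvd (by omega) hpn
    have h4 := cellBits_le_log hp.one_le
    have h5 : (cellBits k : ℝ) ≤ k := by
      have : cellBits k ≤ k := max_le hk1 (Nat.size_le.2 Nat.lt_two_pow_self)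
      exact_mod_cast this
    have h6 : 1 ≤ Real.log p / Real.log 2 := by
      rw [le_div_iff₀ hlog2, one_mul]
      exact Real.log_le_log (by norm_num) (by exact_mod_cast hp.two_le)
    have h7 : (1 : ℝ) ≤ k := by exact_mod_cast hk1
    simp only [mul_div_assoc]
    nlinarith
  have h4 : (F.map fun pk => 3 * (pk.2 * Real.log pk.1 / Real.log 2)).sum =
      3 * (Real.log n / Real.log 2) := by
    have h5 : F.toFinset = n.primeFactors.image fun p => (p, padicValNat p n) := by
      ext ⟨p, k⟩
      simp only [List.mem_toFinset, hmem, Finset.mem_image, Nat.mem_primeFactors, Prod.mk.injEq]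
      constructor
      · rintro ⟨h6, h7, rfl⟩
        exact ⟨p, ⟨h6, h7, by omega⟩, rfl, rfl⟩
      · rintro ⟨q, ⟨h6, h7, -⟩, rfl, rfl⟩
        exact ⟨h6, h7, rfl⟩
    rw [← List.sum_toFinset _ hnd, h5, Finset.sum_image fun p _ q _ h => (Prod.mk.inj h).1,
      ← Finset.mul_sum, ← Finset.sum_div]
    congr 2
    conv_rhs => rw [← Nat.prod_factorization_pow_eq_self (show n ≠ 0 by omega)]
    rw [Finsupp.prod, Nat.cast_prod, Real.log_prod]
    · refine Finset.sum_congr rfl fun p hp => ?_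
      rw [Nat.cast_pow, Real.log_pow, Nat.factorization_def _ (Nat.prime_of_mem_primeFactors hp)]
    · intro p hp
      have := (Nat.prime_of_mem_primeFactors hp).pos
      positivity
  have h5 := cellBits_le_log hn
  rw [h1]
  linarith

/-! ### The programs -/

theorem sieve_spec {V : Env} {N lo hi c t : ℕ} {σ : St} {body : Stmt} {g : ℕ → ℕ → List ℕ}
    (hN : 2 ≤ N) (hW : 1000 * N ≤ V.W)
    (hb : ∀ K l L, Par N K l L → SegSpec V N K l L lo hi body (g L) c) (hσ : σ.r .N = N)
    (hlo : σ.r .A = lo) (hhi : σ.r .hi = hi) (hhiN : hi ≤ 2 * N + 1) :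
    wp V (prelude ;; segments body) (fun σ' t' => ∃ K l L, Par N K l L ∧
      σ'.o = σ.o ++ (List.range' lo (hi - lo)).flatMap (g L) ∧
      t' ≤ t + (c + 60) * ((hi - lo + L) * l)) σ t := by
  refine wp_seq (prelude_spec hN hW hσ) ?_
  rintro σ₁ t₁ ⟨K, l, L, hP, hc, ht⟩ hf
  refine wp_conseq (segments_spec hP hW (hb K l L hP) hc (by rw [hf.reg .A rfl, hlo])
    (by rw [hf.reg .hi rfl, hhi]) hhiN) ?_
  rintro σ₂ t₂ ⟨h1, h2⟩
  refine ⟨K, l, L, hP, by rw [h1, hf.out rfl], ?_⟩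
  have h3 : L * 3 ≤ (hi - lo + L) * l := Nat.mul_le_mul (by omega) hP.three_le_l
  have h4 := hP.three_le_L
  have e : (c + 60) * ((hi - lo + L) * l) =
    (c + 4) * ((hi - lo + L) * l) + 56 * ((hi - lo + L) * l) := by ring
  omega

/-- The execution of a sieve on the machine. A segment takes the time `O(L * l)`, so that an interval
of length `X` takes `O((X + L) * l)`. -/
theorem exists_sieve_run {V : Env} {N lo hi c : ℕ} {input : List ℕ} {setup body : Stmt}
    {g : ℕ → ℕ → List ℕ} (hN : 2 ≤ N) (hW : 1000 * N ≤ V.W) (hB : base ≤ V.T) (hH : V.H ≤ V.W)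
    (hlen : input.length ≤ base) (hin : ∀ v ∈ input, v ≤ V.W)
    (hb : ∀ K l L, Par N K l L → SegSpec V N K l L lo hi body (g L) c) (hhiN : hi ≤ 2 * N + 1)
    (hset : wp V setup (fun σ t => σ.r .N = N ∧ σ.r .A = lo ∧ σ.r .hi = hi ∧ σ.o = [] ∧ t ≤ 10)
      (initSt input) 0) :
    ∃ t : ℕ, (t : ℝ) ≤ (c + 70) * (((hi - lo : ℕ) + 6 * scale N) * (5 * Real.log N)) ∧
      (configAt ((setup ;; prelude ;; segments body).compile 0) input t).Halted
        ((setup ;; prelude ;; segments body).compile 0) ∧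
      (∃ K l L, Par N K l L ∧
        (configAt ((setup ;; prelude ;; segments body).compile 0) input t).out =
          (List.range' lo (hi - lo)).flatMap (g L)) ∧
      ∀ j ≤ t, Valid V (configAt ((setup ;; prelude ;; segments body).compile 0) input j) ∧
        (configAt ((setup ;; prelude ;; segments body).compile 0) input j).out <+:
          (configAt ((setup ;; prelude ;; segments body).compile 0) input t).out := by
  have hlog := log_ge hN
  have hsc := scale_nonneg N
  obtain ⟨t, ht, h⟩ := exists_run (s := setup ;; prelude ;; segments body)
    (n := ⌊(c + 70) * (((hi - lo : ℕ) + 6 * scale N) * (5 * Real.log N))⌋₊)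
    (Good := fun out => ∃ K l L, Par N K l L ∧ out = (List.range' lo (hi - lo)).flatMap (g L))
    hB hH hlen hin (by
      refine wp_seq hset ?_
      rintro σ t ⟨h1, h2, h3, h4, h5⟩ -
      refine wp_conseq (sieve_spec hN hW hb h1 h2 h3 hhiN) ?_
      rintro σ' t' ⟨K, l, L, hP, h6, h7⟩
      refine ⟨⟨K, l, L, hP, by rw [h6, h4, List.nil_append]⟩, Nat.le_floor ?_⟩
      have h8 : t' ≤ (c + 70) * ((hi - lo + L) * l) := by
        have h9 : 3 * 3 ≤ (hi - lo + L) * l :=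
          Nat.mul_le_mul (by have := hP.three_le_L; omega) hP.three_le_l
        have e : (c + 70) * ((hi - lo + L) * l) =
          (c + 60) * ((hi - lo + L) * l) + 10 * ((hi - lo + L) * l) := by ring
        omega
      have h9 : (t' : ℝ) ≤ (c + 70) * (((hi - lo : ℕ) + L) * l) := by exact_mod_cast h8
      refine h9.trans ?_
      gcongr
      · exact hP.L_le_scale
      · exact hP.l_le_log)
  refine ⟨t, ?_, h⟩
  exact (Nat.cast_le.2 ht).trans (Nat.floor_le (by positivity))

theorem Valid.mem_le {V : Env} {c : Config} (h : Valid V c) (hH : V.H ≤ V.W) (i : ℕ) :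
    c.mem i ≤ V.W := by
  rcases lt_or_ge i base with hi | hi
  · exact h.reg i hi
  · exact (h.heap i hi).trans hH

open Stmt in
/-- The program that lists the primes. -/
def listPrimes : Stmt :=
  (cst .one 1 ;; add .hi .N .one ;; cst .A 1) ;; prelude ;;
    segments (primesBody (emit .x) skip)

open Stmt in
/-- The program that factors the integers. -/
def listFactors : Stmt :=
  (cst .one 1 ;; add .hi .N .one ;; cst .A 1) ;; prelude ;; segments factorBody

open Stmt in
/-- The program that finds the primes in an interval. -/
def intervalPrimes : Stmt :=
  (cst .one 1 ;; sub .A .N .Dl ;; add .hi .N .Dl ;; add .hi .hi .one) ;; prelude ;;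
    segments (primesBody (emit .one) (emit .zero))

open Stmt in
/-- The program that factors the positive integers in an interval. -/
def intervalFactors : Stmt :=
  (cst .one 1 ;; sub .A .N .Dl ;; ite .A .one (cst .A 1) skip ;; add .hi .N .Dl ;;
    add .hi .hi .one) ;; prelude ;; segments factorBody

/-- The resources of a sieve for primes. -/
noncomputable def envP (N : ℕ) : Env := ⟨base + ⌊6 * scale N⌋₊, 1000 * N, 1⟩

/-- The resources of a sieve for factorizations. -/
noncomputable def envF (N : ℕ) : Env := ⟨base + 7 * ⌊6 * scale N⌋₊, 1000 * N, 1000 * N⟩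

theorem Par.L_le_floor {N K l L : ℕ} (h : Par N K l L) : L ≤ ⌊6 * scale N⌋₊ :=
  Nat.le_floor h.L_le_scale

theorem memBits_le_of_valid_envP {N : ℕ} (hN : 2 ≤ N) {c : Config} (h : Valid (envP N) c) :
    (c.memBits : ℝ) ≤ 1300 * scale N := by
  have h1 := h.memBits_le (Nat.le_add_right _ _)
  have h2 := cellBits_thousand_mul_le hN
  have h3 := log_le_scale hN
  have h4 : ((⌊6 * scale N⌋₊ : ℕ) : ℝ) ≤ 6 * scale N :=
    Nat.floor_le (by have := scale_nonneg N; positivity)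
  have h5 : cellBits 1 = 1 := by simp [cellBits]
  simp only [envP, h5, Nat.add_sub_cancel_left, mul_one, base_eq] at h1
  have h6 : (c.memBits : ℝ) ≤ 64 * cellBits (1000 * N) + (⌊6 * scale N⌋₊ : ℕ) := by
    exact_mod_cast h1
  linarith

theorem memBits_le_of_valid_envF {N : ℕ} (hN : 2 ≤ N) {c : Config} (h : Valid (envF N) c) :
    (c.memBits : ℝ) ≤ 3000 * (scale N * Real.log N) := by
  have h1 := h.memBits_le (Nat.le_add_right _ _)
  have h2 := cellBits_thousand_mul_le hN
  have h3 := log_le_scale hN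
  have h7 := log_ge hN
  have h4 : ((⌊6 * scale N⌋₊ : ℕ) : ℝ) ≤ 6 * scale N :=
    Nat.floor_le (by have := scale_nonneg N; positivity)
  simp only [envF, Nat.add_sub_cancel_left, base_eq] at h1
  have h6 : (c.memBits : ℝ) ≤ 64 * cellBits (1000 * N) +
      7 * (⌊6 * scale N⌋₊ : ℕ) * cellBits (1000 * N) := by
    exact_mod_cast h1
  calc (c.memBits : ℝ) ≤ 64 * (20 * Real.log N) + 7 * (6 * scale N) * (20 * Real.log N) := by
        have h8 := scale_nonneg N
        refine h6.trans ?_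
        gcongr
    _ ≤ _ := by nlinarith

theorem emitSpec_emit {V : Env} {K l L : ℕ} (x : Reg) (val : ℕ → List ℕ)
    (h : ∀ {σ A}, Ctx K l L A σ → val (σ.r .x) = [σ.r x]) :
    EmitSpec V K l L (.emit x) val :=
  ⟨fun hc => by
    simp only [wp_op, Op.safe, Op.eval, true_and]
    exact ⟨by rw [h hc], le_rfl⟩, fun _ => rfl⟩

theorem emitSpec_skip {V : Env} {K l L : ℕ} : EmitSpec V K l L .skip fun _ => [] :=
  ⟨fun _ => by simp [St.emit], fun _ => rfl⟩

theorem listPrimes_spec {N : ℕ} (hN : 2 ≤ N) :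
    RunsWithin (listPrimes.compile 0) [N] (IsPrimeList N) Config.memBits
      (3000000 * (N * Real.log N)) (3000000 * N)
      (3000000 * ((N : ℝ) ^ (1 / 3 : ℝ) * Real.log N ^ (2 / 3 : ℝ))) := by
  have hb := base_eq
  have hlog := log_ge hN
  have hsc := scale_le hN
  obtain ⟨t, h1, h2, ⟨K, l, L, hP, h3⟩, h4⟩ := exists_sieve_run (V := envP N) (N := N) (lo := 1)
    (hi := N + 1) (c := 70100) (input := [N])
    (setup := Stmt.cst .one 1 ;; .add .hi .N .one ;; .cst .A 1)
    (body := primesBody (.emit .x) .skip) (g := fun _ n => if n.Prime then [n] else []) hN le_rfl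
    (Nat.le_add_right _ _) (show 1 ≤ 1000 * N by omega) (by simp; omega)
    (by simp [envP]; omega)
    (fun K l L hP => primesBody_spec hP le_rfl (Nat.add_le_add_left hP.L_le_floor _) le_rfl
      (by omega) (emitSpec_emit .x (fun n => [n]) fun _ => rfl) emitSpec_skip) (by omega)
    (by
      simp only [wp_seq_eq, wp_op, Op.safe, Op.eval, ArithOp.eval, St.set_r, reduceCtorEq,
        if_false, if_true]
      exact ⟨by simp [envP]; omega, by simp [envP, initSt, Reg.ctorIdx]; omega,
        by simp [envP]; omega, rfl, trivial, rfl, rfl, by omega⟩)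
  refine ⟨t, ?_, h2, ?_, fun s hs => ⟨fun i => ?_, ?_⟩⟩
  · refine h1.trans ?_
    rw [Nat.add_sub_cancel]
    push_cast
    nlinarith
  · unfold IsPrimeList
    refine h3.trans ?_
    rw [Nat.add_sub_cancel]
    induction List.range' 1 N with
    | nil => rfl
    | cons a l ih =>
      rw [List.flatMap_cons, List.filter_cons, ih]
      split_ifs <;> simp_all
  · have := (h4 s hs).1.mem_le (show 1 ≤ 1000 * N by omega) i
    have h5 : ((configAt (listPrimes.compile 0) [N] s).mem i : ℝ) ≤ 1000 * N := by
      exact_mod_cast this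
    have : (0 : ℝ) ≤ N := by positivity
    linarith
  · have := memBits_le_of_valid_envP hN (h4 s hs).1
    have h5 := scale_nonneg N
    change _ ≤ 3000000 * scale N
    exact this.trans (by linarith)

theorem listFactors_spec {N : ℕ} (hN : 2 ≤ N) :
    RunsWithin (listFactors.compile 0) [N] (IsFactorTable (List.range' 1 N)) Config.memBits
      (3000000 * (N * Real.log N)) (3000000 * N)
      (3000000 * ((N : ℝ) ^ (1 / 3 : ℝ) * Real.log N ^ (5 / 3 : ℝ))) := by
  have hb := base_eq
  have hlog := log_ge hN
  have hsc := scale_le hN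
  obtain ⟨t, h1, h2, ⟨K, l, L, hP, h3⟩, h4⟩ := exists_sieve_run (V := envF N) (N := N) (lo := 1)
    (hi := N + 1) (c := 71000) (input := [N])
    (setup := Stmt.cst .one 1 ;; .add .hi .N .one ;; .cst .A 1)
    (body := factorBody) (g := fun L n => encodeFactored n (facsAll L n)) hN le_rfl
    (Nat.le_add_right _ _) le_rfl (by simp; omega) (by simp [envF]; omega)
    (fun K l L hP => factorBody_spec hP le_rfl
      (Nat.add_le_add_left (Nat.mul_le_mul_left 7 hP.L_le_floor) _) le_rfl le_rfl) (by omega)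
    (by
      simp only [wp_seq_eq, wp_op, Op.safe, Op.eval, ArithOp.eval, St.set_r, reduceCtorEq,
        if_false, if_true]
      exact ⟨by simp [envF]; omega, by simp [envF, initSt, Reg.ctorIdx]; omega,
        by simp [envF]; omega, rfl, trivial, rfl, rfl, by omega⟩)
  refine ⟨t, ?_, h2, ?_, fun s hs => ⟨fun i => ?_, ?_⟩⟩
  · refine h1.trans ?_
    rw [Nat.add_sub_cancel]
    push_cast
    nlinarith
  · refine ⟨facsAll L, fun n hn => ?_, h3.trans (by rw [Nat.add_sub_cancel])⟩
    rw [List.mem_range'_1] at hn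
    have := hP.end_le_cube
    exact isFactorization_facsAll (by omega) (by omega)
  · have := (h4 s hs).1.mem_le le_rfl i
    have h5 : ((configAt (listFactors.compile 0) [N] s).mem i : ℝ) ≤ 1000 * N := by
      exact_mod_cast this
    have : (0 : ℝ) ≤ N := by positivity
    linarith
  · have := memBits_le_of_valid_envF hN (h4 s hs).1
    have h5 := scale_nonneg N
    have h6 : (N : ℝ) ^ (1 / 3 : ℝ) * Real.log N ^ (5 / 3 : ℝ) = scale N * Real.log N := by
      rw [scale, mul_assoc, ← Real.rpow_add_one (by linarith)]
      norm_num
    rw [h6]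
    have h7 : 0 ≤ scale N * Real.log N := by positivity
    exact this.trans (by linarith)

theorem sum_cellBits_le_of_prefix {l l' : List ℕ} (h : l <+: l') :
    (l.map cellBits).sum ≤ (l'.map cellBits).sum := by
  obtain ⟨r, rfl⟩ := h
  simp

theorem intervalPrimes_spec {N D : ℕ} (hN : 2 ≤ N) (hD : scale N ≤ D) (hDN : D ≤ N) :
    RunsWithin (intervalPrimes.compile 0) [N, D] (IsPrimeIndicator (interval N D))
      Config.totalBits (10000000 * (D * Real.log N)) (10000000 * N) (10000000 * D) := by
  have hb := base_eq
  have hlog := log_ge hN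
  have hD1 : (1 : ℝ) ≤ D := by
    have h0 : (0 : ℝ) < D := lt_of_lt_of_le (by linarith) ((log_le_scale hN).trans hD)
    exact_mod_cast h0
  obtain ⟨t, h1, h2, ⟨K, l, L, hP, h3⟩, h4⟩ := exists_sieve_run (V := envP N) (N := N)
    (lo := N - D) (hi := N + D + 1) (c := 70100) (input := [N, D])
    (setup := Stmt.cst .one 1 ;; .sub .A .N .Dl ;; .add .hi .N .Dl ;; .add .hi .hi .one)
    (body := primesBody (.emit .one) (.emit .zero))
    (g := fun _ n => if n.Prime then [1] else [0]) hN le_rfl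
    (Nat.le_add_right _ _) (show 1 ≤ 1000 * N by omega) (by simp; omega)
    (by simp [envP]; omega)
    (fun K l L hP => primesBody_spec hP le_rfl (Nat.add_le_add_left hP.L_le_floor _) le_rfl
      (by omega) (emitSpec_emit .one (fun n => [1]) fun hc => by rw [hc.hone])
      (emitSpec_emit .zero (fun n => [0]) fun hc => by rw [hc.hzero])) (by omega)
    (by
      simp only [wp_seq_eq, wp_op, Op.safe, Op.eval, ArithOp.eval, St.set_r, reduceCtorEq,
        if_false, if_true]
      exact ⟨by simp [envP]; omega, trivial, by simp [envP, initSt, Reg.ctorIdx]; omega,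
        by simp [envP, initSt, Reg.ctorIdx]; omega, rfl, rfl, rfl, rfl, by omega⟩)
  have hcard : N + D + 1 - (N - D) = 2 * D + 1 := by omega
  rw [hcard] at h1 h3
  have hout : ((List.range' (N - D) (2 * D + 1)).flatMap
      fun n => if n.Prime then [1] else [0]) =
      (interval N D).map fun n => if n.Prime then 1 else 0 := by
    rw [interval, List.map_eq_flatMap]
    congr 1
    funext n
    split_ifs <;> rfl
  have hbits : ∀ l : List ℕ, ((l.map fun n => if n.Prime then 1 else 0).map cellBits).sum =
      l.length := by
    intro l
    induction l with
    | nil => rfl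
    | cons a l ih =>
      rw [List.map_cons, List.map_cons, List.sum_cons, ih, List.length_cons]
      split_ifs <;> simp [cellBits, add_comm]
  refine ⟨t, ?_, h2, h3.trans hout, fun s hs => ⟨fun i => ?_, ?_⟩⟩
  · refine h1.trans ?_
    push_cast
    nlinarith
  · have := (h4 s hs).1.mem_le (show 1 ≤ 1000 * N by omega) i
    have h5 : ((configAt (intervalPrimes.compile 0) [N, D] s).mem i : ℝ) ≤ 1000 * N := by
      exact_mod_cast this
    have : (0 : ℝ) ≤ N := by positivity
    linarith
  · have h5 := memBits_le_of_valid_envP hN (h4 s hs).1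
    have h6 := sum_cellBits_le_of_prefix (h4 s hs).2
    rw [h3, hout, hbits, interval, List.length_range'] at h6
    have h7 : (((configAt (intervalPrimes.compile 0) [N, D] s).out.map cellBits).sum : ℝ) ≤
      2 * D + 1 := by exact_mod_cast h6
    have h8 : ((configAt (intervalPrimes.compile 0) [N, D] s).memBits : ℝ) ≤ 1300 * scale N := h5
    simp only [Config.totalBits]
    push_cast at h7 ⊢
    linarith

theorem intervalFactors_spec {N D : ℕ} (hN : 2 ≤ N) (hD : scale N ≤ D) (hDN : D ≤ N) :
    RunsWithin (intervalFactors.compile 0) [N, D]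
      (IsFactorTable ((interval N D).filter fun n => n ≠ 0))
      Config.totalBits (10000000 * (D * Real.log N)) (10000000 * N)
      (10000000 * (D * Real.log N)) := by
  have hb := base_eq
  have hlog := log_ge hN
  have hD1 : (1 : ℝ) ≤ D := by
    have h0 : (0 : ℝ) < D := lt_of_lt_of_le (by linarith) ((log_le_scale hN).trans hD)
    exact_mod_cast h0
  have hsc := scale_nonneg N
  obtain ⟨t, h1, h2, ⟨K, l, L, hP, h3⟩, h4⟩ := exists_sieve_run (V := envF N) (N := N)
    (lo := max 1 (N - D)) (hi := N + D + 1) (c := 71000) (input := [N, D])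
    (setup := Stmt.cst .one 1 ;; .sub .A .N .Dl ;; .ite .A .one (.cst .A 1) .skip ;;
      .add .hi .N .Dl ;; .add .hi .hi .one)
    (body := factorBody) (g := fun L n => encodeFactored n (facsAll L n)) hN le_rfl
    (Nat.le_add_right _ _) le_rfl (by simp; omega) (by simp [envF]; omega)
    (fun K l L hP => factorBody_spec hP le_rfl
      (Nat.add_le_add_left (Nat.mul_le_mul_left 7 hP.L_le_floor) _) le_rfl (by omega)) (by omega)
    (by
      have eN : (initSt [N, D]).r .N = N := rfl
      have eD : (initSt [N, D]).r .Dl = D := rfl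
      simp only [wp_seq_eq, wp_op, wp_ite, wp_skip, Op.safe, Op.eval, ArithOp.eval, St.set_r,
        reduceCtorEq, if_false, if_true, eN, eD, true_and, envF]
      refine ⟨by omega, ?_⟩
      split_ifs
      · exact ⟨by omega, by omega, by omega, by omega, rfl, by omega⟩
      · exact ⟨by omega, by omega, by omega, rfl, by omega⟩)
  have hrange : ((interval N D).filter fun n => n ≠ 0) =
      List.range' (max 1 (N - D)) (N + D + 1 - max 1 (N - D)) := by
    rcases Nat.eq_zero_or_pos (N - D) with h0 | h0
    · rw [interval, h0, List.range'_succ, List.filter_cons, List.filter_eq_self.2]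
      · simp; omega
      · intro a ha
        rw [List.mem_range'_1] at ha
        simp; omega
    · rw [interval, List.filter_eq_self.2, max_eq_right h0]
      · congr 1; omega
      · intro a ha
        rw [List.mem_range'_1] at ha
        simp; omega
  have hcard : N + D + 1 - max 1 (N - D) ≤ 2 * D + 1 := by omega
  have hcard' : ((N + D + 1 - max 1 (N - D) : ℕ) : ℝ) ≤ 2 * D + 1 := by exact_mod_cast hcard
  have hF : ∀ n, 1 ≤ n → n ≤ 2 * N → IsFactorization n (facsAll L n) := fun n hn1 hn2 => by
    have := hP.end_le_cube
    exact isFactorization_facsAll (by omega) (by omega)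
  refine ⟨t, ?_, h2, ?_, fun s hs => ⟨fun i => ?_, ?_⟩⟩
  · refine h1.trans ?_
    push_cast
    have h5 : ((N + D + 1 - max 1 (N - D) : ℕ) : ℝ) + 6 * scale N ≤ 9 * D := by linarith
    calc (71000 + 70) * ((((N + D + 1 - max 1 (N - D) : ℕ) : ℝ) + 6 * scale N) *
          (5 * Real.log N)) ≤ (71000 + 70) * ((9 * D) * (5 * Real.log N)) := by gcongr
      _ ≤ _ := by
        have : 0 ≤ D * Real.log N := by positivity
        nlinarith
  · refine ⟨facsAll L, fun n hn => ?_, by rw [hrange]; exact h3⟩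
    rw [hrange, List.mem_range'_1] at hn
    exact hF n (by omega) (by omega)
  · have := (h4 s hs).1.mem_le le_rfl i
    have h5 : ((configAt (intervalFactors.compile 0) [N, D] s).mem i : ℝ) ≤ 1000 * N := by
      exact_mod_cast this
    have : (0 : ℝ) ≤ N := by positivity
    linarith
  · have h5 : ((configAt (intervalFactors.compile 0) [N, D] s).memBits : ℝ) ≤
        3000 * (scale N * Real.log N) := memBits_le_of_valid_envF hN (h4 s hs).1
    have h6 := sum_cellBits_le_of_prefix (h4 s hs).2
    rw [h3] at h6
    have hlog2 := Real.log_two_gt_d9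
    have key : ∀ m a, 1 ≤ a → a + m ≤ 2 * N + 1 →
        ((((List.range' a m).flatMap fun n => encodeFactored n (facsAll L n)).map
          cellBits).sum : ℝ) ≤ m * (20 * Real.log N) := by
      intro m
      induction m with
      | zero => intro a _ _; simp
      | succ m ih =>
        intro a ha ham
        rw [List.range'_succ, List.flatMap_cons, List.map_append, List.sum_append]
        have h7 := ih (a + 1) (by omega) (by omega)
        have h8 := sum_cellBits_encodeFactored_le ha (hF a ha (by omega))
        have h9 : Real.log a ≤ Real.log 2 + Real.log N := by
          rw [← Real.log_mul (by norm_num) (by positivity)]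
          exact Real.log_le_log (by positivity) (by exact_mod_cast (by omega : a ≤ 2 * N))
        have h10 : Real.log a / Real.log 2 ≤ 1 + 2 * Real.log N := by
          rw [div_le_iff₀ (by linarith)]; nlinarith
        push_cast at h7 h8 ⊢
        linarith
    have h7 := key _ (max 1 (N - D)) (by omega)
      (show max 1 (N - D) + (N + D + 1 - max 1 (N - D)) ≤ 2 * N + 1 by omega)
    have h8 : (((configAt (intervalFactors.compile 0) [N, D] s).out.map cellBits).sum : ℝ) ≤
        (2 * D + 1) * (20 * Real.log N) :=
      (Nat.cast_le.2 h6).trans (h7.trans (by gcongr))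
    have h9 : scale N * Real.log N ≤ D * Real.log N := by gcongr
    simp only [Config.totalBits]
    push_cast at h8 ⊢
    nlinarith

end SieveRAM

theorem mainTheorem1 :
    -- all primes up to `N`
    (∃ (P : SieveRAM.Program) (C : ℝ), ∀ N : ℕ, 2 ≤ N →
      SieveRAM.RunsWithin P [N] (SieveRAM.IsPrimeList N) SieveRAM.Config.memBits
        (C * (N * Real.log N)) (C * N)
        (C * ((N : ℝ) ^ (1 / 3 : ℝ) * Real.log N ^ (2 / 3 : ℝ)))) ∧
    -- factorization of all integers up to `N`
    (∃ (P : SieveRAM.Program) (C : ℝ), ∀ N : ℕ, 2 ≤ N →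
      SieveRAM.RunsWithin P [N] (SieveRAM.IsFactorTable (List.range' 1 N))
        SieveRAM.Config.memBits
        (C * (N * Real.log N)) (C * N)
        (C * ((N : ℝ) ^ (1 / 3 : ℝ) * Real.log N ^ (5 / 3 : ℝ)))) ∧
    -- all primes in `[N - Δ, N + Δ]`; the output is included in the space bound
    (∃ (P : SieveRAM.Program) (C : ℝ), ∀ N Δ : ℕ, 2 ≤ N →
      (N : ℝ) ^ (1 / 3 : ℝ) * Real.log N ^ (2 / 3 : ℝ) ≤ Δ → Δ ≤ N →
      SieveRAM.RunsWithin P [N, Δ] (SieveRAM.IsPrimeIndicator (SieveRAM.interval N Δ))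
        SieveRAM.Config.totalBits
        (C * (Δ * Real.log N)) (C * N) (C * Δ)) ∧
    -- factorization of all positive integers in `[N - Δ, N + Δ]`; the output is included in
    -- the space bound
    (∃ (P : SieveRAM.Program) (C : ℝ), ∀ N Δ : ℕ, 2 ≤ N →
      (N : ℝ) ^ (1 / 3 : ℝ) * Real.log N ^ (2 / 3 : ℝ) ≤ Δ → Δ ≤ N →
      SieveRAM.RunsWithin P [N, Δ]
        (SieveRAM.IsFactorTable ((SieveRAM.interval N Δ).filter fun n => n ≠ 0))
        SieveRAM.Config.totalBits
        (C * (Δ * Real.log N)) (C * N) (C * (Δ * Real.log N))) := by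
  open SieveRAM in
  exact ⟨⟨listPrimes.compile 0, 3000000, fun _ hN => listPrimes_spec hN⟩,
    ⟨listFactors.compile 0, 3000000, fun _ hN => listFactors_spec hN⟩,
    ⟨intervalPrimes.compile 0, 10000000, fun _ _ hN hD hDN => intervalPrimes_spec hN hD hDN⟩,
    ⟨intervalFactors.compile 0, 10000000, fun _ _ hN hD hDN => intervalFactors_spec hN hD hDN⟩⟩
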